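/- Let $n=2\nu+3$ with $\nu\in\{0,1,2,\dots\}$, let $m\ge 1$ be an integer and $a>0$, and let $\Delta=\sum_{k=1}^n\partial_{x_k}^2$ be the Laplacian on $\mathbb R^n$. Let $f$ be a (real- or complex-valued) $C^\infty$ function on $\mathbb R^n\times[0,\infty)$ and let $\varphi_0,\dots,\varphi_{2m-1}$ be (real- or complex-valued) $C^\infty$ functions on $\mathbb R^n$. At $t=0$, time derivatives are understood as one-sided. **Notation.** For a function $g$ on $\mathbb R^n$ and $\tau>0$ put $$\mathcal M_\tau g(x)=\frac{1}{S_n(\tau)}\int_{|\xi-x|=a\tau}g(\xi)\,dS(\xi),\qquad S_n(\tau)=2(2\pi)^{\nu+1}(a\tau)^{n-1},$$ where $dS$ is the surface measure. For a function $h$ of one variable put $(Jh)(t)=\int_0^t h(s)\,s\,ds$, so that $J^\nu$ is a $\nu$-fold iterated integral ($J^0h=h$). Put $$(K_mh)(t)=\int_0^t\frac{(t^2-\tau^2)^{m-2}\,\tau^2}{(2m-2)!!\,(2m-4)!!}\,h(\tau)\,d\tau\quad(m\ge2),\qquad (K_1h)(t)=t\,h(t),$$ with $0!!=1$. (For every $m\ge1$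 this is $\frac1{(2m-2)!!}J^{m-1}$ applied to $\tau\mapsto\tau h(\tau)$.) **Theorem.** The Cauchy problem $$\Bigl(\frac{\partial^2}{\partial t^2}-a^2\Delta\Bigr)^m u=f(x,t)\quad(x\in\mathbb R^n,\ t>0),\qquad \frac{\partial^r u}{\partial t^r}\Big|_{t=0}=\varphi_r(x)\quad(r=0,1,\dots,2m-1)$$ has exactly one solution of class $C^{2m}$ on $\mathbb R^n\times[0,\infty)$. This solution is of class $C^\infty$ on $\mathbb R^n\times[0,\infty)$, and for all $x\in\mathbb R^n$, $t\ge0$ it is given by $$\begin{aligned} u(x,t)={}&\int_0^t K_m\Bigl[J^\nu\bigl[\tau'\mapsto (a^2\Delta)^\nu \mathcal M_{\tau'}f(\cdot,\tau)(x)\bigr]\Bigr](t-\tau)\,d\tau\\ &+\frac1{(2m-2)!!}\sum_{r=0}^{\nu-1}\int_0^t\frac{(t-\tau)^{2m+2r-1}}{(2m+2r-1)!!\,(2r)!!}\,(a^2\Delta)^r f(x,\tau)\,d\tau\\ &+\sum_{k=0}^{m-1}(-1)^k\binom mk (a^2\Delta)^{k+\nu}\sum_{r=0}^{2m-1-2k}\frac{\partial^{\,2m-1-2k-r}}{\partial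 t^{\,2m-1-2k-r}}\,K_m\Bigl[J^\nu\bigl[\tau\mapsto\mathcal M_\tau\varphi_r(x)\bigr]\Bigr](t)\\ &+\sum_{k=0}^{m-1}(-1)^k\binom mk\sum_{r=0}^{2m-1-2k}\sum_{i=0}^{\nu-1}\binom{m-1+i}{i}\frac{t^{2k+2i+r}}{(2k+2i+r)!}\,(a^2\Delta)^{k+i}\varphi_r(x). \end{aligned}$$ -/

import Mathlib

open MeasureTheory
open scoped ContDiff

noncomputable section

namespace MultiWave

variable {𝕜 : Type*} [RCLike 𝕜] {n : ℕ}

/-- The spatial operator `a² Δ` on functions on `ℝⁿ`. -/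
def scaledLaplacian (a : ℝ) (g : EuclideanSpace ℝ (Fin n) → 𝕜) :
    EuclideanSpace ℝ (Fin n) → 𝕜 :=
  fun x => a ^ 2 • Laplacian.laplacian g x

/-- The `r`-th time derivative on `[0, ∞)`: the usual derivative at `t > 0`, the one-sided
derivative at `t = 0`. -/
def timeDeriv (r : ℕ) (g : ℝ → 𝕜) : ℝ → 𝕜 :=
  iteratedDerivWithin r g (Set.Ici 0)

/-- The wave operator `∂ₜ² - a² Δ` on functions `u (x, t)`. -/
def waveOp (a : ℝ) (u : EuclideanSpace ℝ (Fin n) → ℝ → 𝕜) :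
    EuclideanSpace ℝ (Fin n) → ℝ → 𝕜 :=
  fun x t => timeDeriv 2 (u x) t - scaledLaplacian a (fun y => u y t) x

/-- `u` is a classical solution (of class `C^{2m}` on `ℝⁿ × [0, ∞)`) of the Cauchy problem
`(∂ₜ² - a² Δ)^m u = f` for `t > 0`, with `∂ₜ^r u = φ r` at `t = 0` for `0 ≤ r ≤ 2m - 1`. -/
structure IsCauchySolution (m : ℕ) (a : ℝ) (f : EuclideanSpace ℝ (Fin n) → ℝ → 𝕜)
    (φ : ℕ → EuclideanSpace ℝ (Fin n) → 𝕜) (u : EuclideanSpace ℝ (Fin n) → ℝ → 𝕜) : Prop where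
  contDiffOn : ContDiffOn ℝ ((2 * m : ℕ) : WithTop ℕ∞) (Function.uncurry u)
    (Set.univ ×ˢ Set.Ici 0)
  equation : ∀ x : EuclideanSpace ℝ (Fin n), ∀ t : ℝ, 0 < t → ((waveOp a)^[m] u) x t = f x t
  initial : ∀ r < 2 * m, ∀ x : EuclideanSpace ℝ (Fin n), timeDeriv r (u x) 0 = φ r x

/-- The integral of `g` with respect to surface measure over the sphere of centre `x` and
radius `ρ` in `ℝⁿ`, parametrized by the unit sphere with its surface measure. -/
def sphereIntegral (g : EuclideanSpace ℝ (Fin n) → 𝕜) (x : EuclideanSpace ℝ (Fin n)) (ρ : ℝ) : 𝕜 :=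
  ρ ^ (n - 1) • ∫ p : Metric.sphere (0 : EuclideanSpace ℝ (Fin n)) 1,
    g (x + ρ • (p : EuclideanSpace ℝ (Fin n)))
      ∂(volume : Measure (EuclideanSpace ℝ (Fin n))).toSphere

/-- `(1 / S_n) ∫_{S_n} g dS_n` over the sphere of centre `x` and radius `a τ`, where
`S_n = 2 (2π)^(ν+1) (a τ)^(n-1)`. -/
def sphericalMean (ν : ℕ) (a : ℝ) (g : EuclideanSpace ℝ (Fin n) → 𝕜) (x : EuclideanSpace ℝ (Fin n))
    (τ : ℝ) : 𝕜 :=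
  (1 / (2 * (2 * Real.pi) ^ (ν + 1) * (a * τ) ^ (n - 1))) • sphereIntegral g x (a * τ)

/-- One integration `∫₀ᵗ g(s) s ds`; its `ν`-th iterate is the `ν`-fold iterated integral. -/
def weightedPrimitive (g : ℝ → 𝕜) : ℝ → 𝕜 :=
  fun t => ∫ s in (0 : ℝ)..t, s • g s

/-- The kernel integral `∫₀ᵗ (t² - τ²)^(m-2) τ² / ((2m-2)‼ (2m-4)‼) h(τ) dτ` for `m ≥ 2`.
For `m ≥ 2` it equals `1 / (2m-2)‼` times the `(m-1)`-fold iterate of `∫₀ᵗ · s ds` applied to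
`τ h(τ)`; for `m = 1` the formal expression stands for the zero-fold iterate, which is `t h(t)`. -/
def kernelIntegral (m : ℕ) (h : ℝ → 𝕜) : ℝ → 𝕜 :=
  fun t =>
    if m = 1 then t • h t
    else ∫ τ in (0 : ℝ)..t,
      ((t ^ 2 - τ ^ 2) ^ (m - 2) * τ ^ 2 / ((Nat.doubleFactorial (2 * m - 2) : ℝ) * (Nat.doubleFactorial (2 * m - 4) : ℝ))) • h τ

/-- The spherical-mean term of the source. -/
def sourceMeanTerm (ν m : ℕ) (a : ℝ) (f : EuclideanSpace ℝ (Fin n) → ℝ → 𝕜)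
    (x : EuclideanSpace ℝ (Fin n)) (t : ℝ) : 𝕜 :=
  ∫ τ in (0 : ℝ)..t,
    kernelIntegral m
      (weightedPrimitive^[ν] fun s =>
        ((scaledLaplacian a)^[ν] fun y => sphericalMean ν a (fun ξ => f ξ τ) y s) x)
      (t - τ)

/-- The term of the source that contains no spherical means. -/
def sourcePolyTerm (ν m : ℕ) (a : ℝ) (f : EuclideanSpace ℝ (Fin n) → ℝ → 𝕜)
    (x : EuclideanSpace ℝ (Fin n)) (t : ℝ) : 𝕜 :=
  (1 / (Nat.doubleFactorial (2 * m - 2) : ℝ)) • ∑ r ∈ Finset.range ν,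
    ∫ τ in (0 : ℝ)..t,
      ((t - τ) ^ (2 * m + 2 * r - 1) / ((Nat.doubleFactorial (2 * m + 2 * r - 1) : ℝ) * (Nat.doubleFactorial (2 * r) : ℝ))) •
        ((scaledLaplacian a)^[r] fun y => f y τ) x

/-- The spherical-mean term of the initial data. -/
def dataMeanTerm (ν m : ℕ) (a : ℝ) (φ : ℕ → EuclideanSpace ℝ (Fin n) → 𝕜)
    (x : EuclideanSpace ℝ (Fin n)) (t : ℝ) : 𝕜 :=
  ∑ k ∈ Finset.range m, ((-1 : ℝ) ^ k * (m.choose k : ℝ)) •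
    ((scaledLaplacian a)^[k + ν] fun y =>
      ∑ r ∈ Finset.range (2 * m - 2 * k),
        timeDeriv (2 * m - 1 - 2 * k - r)
          (kernelIntegral m (weightedPrimitive^[ν] fun τ => sphericalMean ν a (φ r) y τ)) t) x

/-- The term of the initial data that is polynomial in `t`. -/
def dataPolyTerm (ν m : ℕ) (a : ℝ) (φ : ℕ → EuclideanSpace ℝ (Fin n) → 𝕜)
    (x : EuclideanSpace ℝ (Fin n)) (t : ℝ) : 𝕜 :=
  ∑ k ∈ Finset.range m, ((-1 : ℝ) ^ k * (m.choose k : ℝ)) •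
    ∑ r ∈ Finset.range (2 * m - 2 * k), ∑ i ∈ Finset.range ν,
      (((m - 1 + i).choose i : ℝ) * (t ^ (2 * k + 2 * i + r) / (Nat.factorial (2 * k + 2 * i + r) : ℝ))) •
        ((scaledLaplacian a)^[k + i] (φ r)) x

/-- The explicit formula for the solution of the Cauchy problem. -/
def solutionFormula (ν m : ℕ) (a : ℝ) (f : EuclideanSpace ℝ (Fin n) → ℝ → 𝕜)
    (φ : ℕ → EuclideanSpace ℝ (Fin n) → 𝕜) (x : EuclideanSpace ℝ (Fin n)) (t : ℝ) : 𝕜 :=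
  sourceMeanTerm ν m a f x t + sourcePolyTerm ν m a f x t +
    dataMeanTerm ν m a φ x t + dataPolyTerm ν m a φ x t

end MultiWave

end

/-!
The solution is built in closed form by composing a few operators on smooth functions on the closed
half-space: `∂ₜ`, `a² Δ`, multiplication by `t`, and the weighted primitive `J u = ∫₀ᵗ u s ds`. All
of them commute with `a² Δ`; moreover `∂ₜ J` is multiplication by `t`, and a function is determined
by its time derivative and its initial value (`HalfSpaceFun.eq_of_dt_eq`). The identities between
operators that are needed follow from these facts by differentiation.

*Wave equation.* The spherical mean `M` of a function `g` over the sphere of radius `a t` satisfies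
the Darboux equation `t ∂ₜ² M + (n - 1) ∂ₜ M = t a² Δ M` (`HalfSpaceFun.darboux_mean`). It holds
because the Laplacian minus its radial part is a sum of squares of infinitesimal rotations, whose
integrals over a sphere vanish (`darboux_sphere`). Each application of `J` lowers the coefficient of
`∂ₜ` in the Darboux equation by two (`HalfSpaceFun.radial_prim_mean`). In odd dimension `2ν + 3` the
coefficient is used up after `ν + 1` steps, and `(a² Δ)^ν (t J^ν M)` plus a polynomial in `t` solves
the wave equation with initial value zero and initial velocity `g` (`HalfSpaceFun.box_waveSol`).

*Iterated equation.* If `u` vanishes at `t = 0`, then `□ J u = 2 u + J □ u`, where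
`□ = ∂ₜ² - a² Δ` (`HalfSpaceFun.box_prim`). Hence `J^k / (2k)!!` applied to that solution is
annihilated by `□^(k+1)`, and its initial derivatives up to the order `2k + 1` vanish except for the
last one, which is `g` (`HalfSpaceFun.fundSol`). A source is treated by Duhamel's integral. For
general data one combines time derivatives of these fundamental solutions with the coefficients of
the binomial expansion of `□^m`; the initial derivatives then come out right because `□^m`
annihilates the fundamental solution (`HalfSpaceFun.sum_dt_pow_fundSol_apply_zero`). Expanding
the operators gives the explicit formula (`HalfSpaceFun.solutionFormula_eq`).

*Uniqueness.* Applying `□` reduces the order (`IsCauchySolution.waveOp`), so it suffices to treat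
the wave equation with zero data. There a solution is paired with the solution constructed above for a
test function, run backwards in time; the latter has compact support in space, and the pairing is
constant in time (`integral_pairing_eq_zero`).
-/

open MeasureTheory
open scoped ContDiff

noncomputable section

namespace MultiWave

open Set Filter Topology

/-! ### Integrals depending on a parameter in a convex set -/

section Parametric

variable {Y X V G : Type*} [NormedAddCommGroup Y] [NormedSpace ℝ Y]
  [NormedAddCommGroup V] [NormedSpace ℝ V] [NormedAddCommGroup G] [NormedSpace ℝ G]
  [TopologicalSpace X] [T2Space X] [MeasurableSpace X] [OpensMeasurableSpace X]
  {μ : Measure X} [IsFiniteMeasureOnCompacts μ] {S : Set Y} {K : Set X}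

lemma integrableOn_slice {Y G : Type*} [TopologicalSpace Y] [NormedAddCommGroup G] {S : Set Y}
    {F : Y → X → G} (hK : IsCompact K)
    (hF : ContinuousOn (Function.uncurry F) (S ×ˢ K)) {y : Y} (hy : y ∈ S) :
    IntegrableOn (F y) K μ := by
  refine ContinuousOn.integrableOn_compact hK ?_
  exact hF.comp (f := fun x => (y, x)) (by fun_prop) fun x hx => ⟨hy, hx⟩

lemma continuousOn_setIntegral_param {Y : Type*} [TopologicalSpace Y] {S : Set Y}
    {F : Y → X → G} (hK : IsCompact K) (hF : ContinuousOn (Function.uncurry F) (S ×ˢ K)) :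
    ContinuousOn (fun y => ∫ x in K, F y x ∂μ) S := by
  intro y hy
  rw [ContinuousWithinAt, Metric.tendsto_nhds]
  intro ε hε
  have hM : 0 < μ.real K + 1 := by positivity
  obtain ⟨v, hv, H⟩ := hK.mem_uniformity_of_prod hF hy
    (Metric.dist_mem_uniformity (show 0 < ε / (μ.real K + 1) by positivity))
  filter_upwards [hv, self_mem_nhdsWithin] with p hp hpS
  rw [dist_eq_norm, ← integral_sub (integrableOn_slice hK hF hpS) (integrableOn_slice hK hF hy)]
  calc ‖∫ x in K, (F p x - F y x) ∂μ‖ ≤ ε / (μ.real K + 1) * μ.real K := by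
        refine norm_setIntegral_le_of_norm_le_const hK.measure_lt_top fun x hx => ?_
        have := H p hp x hx
        simp only [mem_ofPred_eq, dist_eq_norm] at this
        exact this.le
    _ < ε / (μ.real K + 1) * (μ.real K + 1) := by
        have : 0 < ε / (μ.real K + 1) := by positivity
        nlinarith
    _ = ε := by field_simp

/-- Differentiation under the integral sign at a point of a convex set, possibly a boundary point.
The convexity lets the mean value inequality replace a neighbourhood of the point. -/
lemma hasFDerivWithinAt_setIntegral_param [CompleteSpace G] {F : Y → X → G}
    {F' : Y → X → Y →L[ℝ] G}
    (hS : Convex ℝ S) (hK : IsCompact K)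
    (hF : ContinuousOn (Function.uncurry F) (S ×ˢ K))
    (hF' : ContinuousOn (Function.uncurry F') (S ×ˢ K))
    (hd : ∀ y ∈ S, ∀ x ∈ K, HasFDerivWithinAt (fun y => F y x) (F' y x) S y) {y : Y} (hy : y ∈ S) :
    HasFDerivWithinAt (fun y => ∫ x in K, F y x ∂μ) (∫ x in K, F' y x ∂μ) S y := by
  rw [hasFDerivWithinAt_iff_isLittleO, Asymptotics.isLittleO_iff]
  intro ε hε
  have hM : 0 < μ.real K + 1 := by positivity
  obtain ⟨v, hv, H⟩ := hK.mem_uniformity_of_prod hF' hy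
    (Metric.dist_mem_uniformity (show 0 < ε / (μ.real K + 1) by positivity))
  obtain ⟨δ, hδ, hδv⟩ := Metric.mem_nhdsWithin_iff.1 hv
  have hev : Metric.ball y δ ∩ S ∈ 𝓝[S] y :=
    inter_mem (mem_nhdsWithin_of_mem_nhds (Metric.ball_mem_nhds y hδ)) self_mem_nhdsWithin
  filter_upwards [hev] with p hp
  rw [ContinuousLinearMap.integral_apply (integrableOn_slice hK hF' hy),
    ← integral_sub (integrableOn_slice hK hF hp.2) (integrableOn_slice hK hF hy),
    ← integral_sub (f := fun x => F p x - F y x)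
      ((integrableOn_slice hK hF hp.2).sub (integrableOn_slice hK hF hy))
      ((integrableOn_slice hK hF' hy).apply_continuousLinearMap _)]
  calc ‖∫ x in K, (F p x - F y x - F' y x (p - y)) ∂μ‖
      ≤ (ε / (μ.real K + 1) * ‖p - y‖) * μ.real K := by
        refine norm_setIntegral_le_of_norm_le_const hK.measure_lt_top fun x hx => ?_
        refine Convex.norm_image_sub_le_of_norm_hasFDerivWithin_le' (s := Metric.ball y δ ∩ S)
          (f := fun y => F y x) (f' := fun y => F' y x)
          (fun z hz => (hd z hz.2 x hx).mono inter_subset_right) (fun z hz => ?_)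
          ((convex_ball y δ).inter hS) ⟨Metric.mem_ball_self hδ, hy⟩ hp
        have := H z (hδv hz) x hx
        simp only [mem_ofPred_eq, dist_eq_norm] at this
        exact this.le
    _ ≤ (ε / (μ.real K + 1) * ‖p - y‖) * (μ.real K + 1) := by
        have : 0 ≤ ε / (μ.real K + 1) * ‖p - y‖ := by positivity
        nlinarith
    _ = ε * ‖p - y‖ := by field_simp

lemma hasDerivWithinAt_setIntegral_param [CompleteSpace G] {S : Set ℝ} {F F' : ℝ → X → G}
    (hS : Convex ℝ S) (hK : IsCompact K)
    (hF : ContinuousOn (Function.uncurry F) (S ×ˢ K))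
    (hF' : ContinuousOn (Function.uncurry F') (S ×ˢ K))
    (hd : ∀ y ∈ S, ∀ x ∈ K, HasDerivWithinAt (fun y => F y x) (F' y x) S y) {y : ℝ} (hy : y ∈ S) :
    HasDerivWithinAt (fun y => ∫ x in K, F y x ∂μ) (∫ x in K, F' y x ∂μ) S y := by
  let Φ : G →L[ℝ] (ℝ →L[ℝ] G) := ContinuousLinearMap.toSpanSingletonCLE.toContinuousLinearMap
  have h := hasFDerivWithinAt_setIntegral_param (μ := μ) (F := F) (F' := fun y x => Φ (F' y x))
    hS hK hF
    (Φ.continuous.comp_continuousOn hF') (fun y hy x hx => (hd y hy x hx).hasFDerivWithinAt) hy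
  have h2 := h.hasDerivWithinAt
  rw [ContinuousLinearMap.integral_apply] at h2
  · simpa [Φ] using h2
  · exact integrableOn_slice (F := fun y x => Φ (F' y x)) hK (Φ.continuous.comp_continuousOn hF') hy

end Parametric

section ParametricSmooth

universe u

-- The induction on the order of differentiability replaces the target `G` by `Y →L[ℝ] G`, which has
-- to stay in the same universe; this is why `Y` lives in `Type`.
variable {Y V : Type} {X : Type*} [NormedAddCommGroup Y] [NormedSpace ℝ Y]
  [NormedAddCommGroup V] [NormedSpace ℝ V]
  [TopologicalSpace X] [T2Space X] [MeasurableSpace X] [OpensMeasurableSpace X]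
  {μ : Measure X} [IsFiniteMeasureOnCompacts μ] {S : Set Y} {K : Set X}

lemma hasFDerivWithinAt_left {G : Type*} [NormedAddCommGroup G] [NormedSpace ℝ G] {T : Set V}
    {F : Y × V → G} {y : Y} {v : V} (hF : DifferentiableWithinAt ℝ F (S ×ˢ T) (y, v)) (hv : v ∈ T) :
    HasFDerivWithinAt (fun y => F (y, v))
      ((fderivWithin ℝ F (S ×ˢ T) (y, v)).comp (ContinuousLinearMap.inl ℝ Y V)) S y :=
  hF.hasFDerivWithinAt.comp y (f := fun y => (y, v)) (hasFDerivAt_prodMk_left y v).hasFDerivWithinAt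
    fun _ hz => ⟨hz, hv⟩

/-- An integral over a compact set of a function that depends smoothly on a parameter in a convex
set and on the integration variable is smooth in the parameter. The integration variable enters
through a continuous map `c`, so that the measure may live on a sphere. -/
lemma contDiffOn_setIntegral_param_nat (hS : Convex ℝ S) (hK : IsCompact K) {T : Set V}
    (hST : UniqueDiffOn ℝ (S ×ˢ T)) (hS' : UniqueDiffOn ℝ S)
    {c : X → V} (hc : Continuous c) (hcT : MapsTo c K T)
    (k : ℕ) :
    ∀ {G : Type u} [NormedAddCommGroup G] [NormedSpace ℝ G] [CompleteSpace G] {F : Y × V → G},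
    ContDiffOn ℝ k F (S ×ˢ T) →
    ContDiffOn ℝ k (fun y => ∫ x in K, F (y, c x) ∂μ) S := by
  have hmap : MapsTo (fun p : Y × X => (p.1, c p.2)) (S ×ˢ K) (S ×ˢ T) :=
    fun p hp => ⟨hp.1, hcT hp.2⟩
  induction k with
  | zero =>
    intro G _ _ _ F hF
    simp only [Nat.cast_zero, contDiffOn_zero] at hF ⊢
    exact continuousOn_setIntegral_param (F := fun y x => F (y, c x)) hK
      (hF.comp (f := fun p : Y × X => (p.1, c p.2)) (by fun_prop) hmap)
  | succ k ih =>
    intro G _ _ _ F hF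
    have hF1 : ContDiffOn ℝ k (fun p => (fderivWithin ℝ F (S ×ˢ T) p).comp
        (ContinuousLinearMap.inl ℝ Y V)) (S ×ˢ T) :=
      (hF.fderivWithin hST (m := k) (by simp)).clm_comp contDiffOn_const
    have hd : ∀ y ∈ S, HasFDerivWithinAt (fun y => ∫ x in K, F (y, c x) ∂μ)
        (∫ x in K, (fderivWithin ℝ F (S ×ˢ T) (y, c x)).comp
          (ContinuousLinearMap.inl ℝ Y V) ∂μ) S y := fun y hy =>
      hasFDerivWithinAt_setIntegral_param (F := fun y x => F (y, c x))
        (F' := fun y x => (fderivWithin ℝ F (S ×ˢ T) (y, c x)).comp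
          (ContinuousLinearMap.inl ℝ Y V)) hS hK
        (hF.continuousOn.comp (f := fun p : Y × X => (p.1, c p.2)) (by fun_prop) hmap)
        (hF1.continuousOn.comp (f := fun p : Y × X => (p.1, c p.2)) (by fun_prop) hmap)
        (fun y hy x hx => hasFDerivWithinAt_left
          (hF.differentiableOn (by simp) _ ⟨hy, hcT hx⟩) (hcT hx)) hy
    have hcast : ((k + 1 : ℕ) : WithTop ℕ∞) = (k : WithTop ℕ∞) + 1 := by push_cast; rfl
    rw [hcast, contDiffOn_succ_iff_fderivWithin hS']
    refine ⟨fun y hy => (hd y hy).differentiableWithinAt, fun h => ?_, ?_⟩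
    · exact absurd h (by exact WithTop.natCast_ne_top k)
    · exact (ih hF1).congr fun y hy => (hd y hy).fderivWithin (hS' y hy)

lemma contDiffOn_setIntegral_param (hS : Convex ℝ S) (hK : IsCompact K) {T : Set V}
    (hST : UniqueDiffOn ℝ (S ×ˢ T)) (hS' : UniqueDiffOn ℝ S)
    {c : X → V} (hc : Continuous c) (hcT : MapsTo c K T)
    {G : Type u} [NormedAddCommGroup G] [NormedSpace ℝ G] [CompleteSpace G] {F : Y × V → G}
    (hF : ContDiffOn ℝ ∞ F (S ×ˢ T)) :
    ContDiffOn ℝ ∞ (fun y => ∫ x in K, F (y, c x) ∂μ) S :=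
  contDiffOn_infty.2 fun k =>
    contDiffOn_setIntegral_param_nat hS hK hST hS' hc hcT k (contDiffOn_infty.1 hF k)

end ParametricSmooth

/-! ### Partial derivatives of families of functions on the half-space -/

variable {𝕜 : Type*} [RCLike 𝕜] {n : ℕ}

/-- Euclidean space of dimension `n`. -/
abbrev Euc (n : ℕ) := EuclideanSpace ℝ (Fin n)

/-- The domain of the variables `(τ, x, t)` of a family, indexed by `τ ≥ 0`, of functions on the
half-space `ℝⁿ × [0, ∞)`. -/
def paramHalfSpace (n : ℕ) : Set (ℝ × EuclideanSpace ℝ (Fin n) × ℝ) :=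
  Ici 0 ×ˢ univ ×ˢ Ici 0

/-- The family `F τ`, `τ ≥ 0`, of functions of `(x, t)` is jointly of class `C^k` in
`(τ, x, t)`, up to the boundaries `τ = 0` and `t = 0`. -/
def IsSmoothFamily (k : WithTop ℕ∞) (F : ℝ → Euc n → ℝ → 𝕜) : Prop :=
  ContDiffOn ℝ k (fun p : ℝ × Euc n × ℝ => F p.1 p.2.1 p.2.2) (paramHalfSpace n)

/-- The derivative of a function of `(x, t)` with respect to `x` in the direction `v`. -/
def dirDeriv (v : Euc n) (u : Euc n → ℝ → 𝕜) : Euc n → ℝ → 𝕜 :=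
  fun x t => fderiv ℝ (fun y => u y t) x v

/-- The time derivative of a function of `(x, t)`, one-sided at `t = 0`. -/
def dt (u : Euc n → ℝ → 𝕜) : Euc n → ℝ → 𝕜 :=
  fun x t => derivWithin (u x) (Ici 0) t

lemma convex_paramHalfSpace : Convex ℝ (paramHalfSpace n) :=
  (convex_Ici 0).prod (convex_univ.prod (convex_Ici 0))

lemma uniqueDiffOn_paramHalfSpace : UniqueDiffOn ℝ (paramHalfSpace n) :=
  (uniqueDiffOn_Ici 0).prod (uniqueDiffOn_univ.prod (uniqueDiffOn_Ici 0))

lemma mem_closure_interior_paramHalfSpace {p : ℝ × Euc n × ℝ} (hp : p ∈ paramHalfSpace n) :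
    p ∈ closure (interior (paramHalfSpace n)) := by
  simpa [paramHalfSpace, interior_prod_eq, closure_prod_eq] using hp

namespace IsSmoothFamily

variable {k l : WithTop ℕ∞} {F : ℝ → Euc n → ℝ → 𝕜}

lemma hasDerivWithinAt (hF : IsSmoothFamily k F) (hk : k ≠ 0) {τ t : ℝ} (hτ : 0 ≤ τ) (ht : 0 ≤ t)
    (x : Euc n) :
    HasDerivWithinAt (F τ x) (fderivWithin ℝ (fun p : ℝ × Euc n × ℝ => F p.1 p.2.1 p.2.2)
      (paramHalfSpace n) (τ, x, t) (0, 0, 1)) (Ici 0) t := by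
  have h := (hF.differentiableOn hk (τ, x, t) ⟨hτ, mem_univ _, ht⟩).hasFDerivWithinAt
  refine h.comp_hasDerivWithinAt (f := fun s => (τ, x, s)) t ?_ fun s hs => ⟨hτ, mem_univ _, hs⟩
  exact ((hasDerivAt_const t τ).prodMk ((hasDerivAt_const t x).prodMk
    (hasDerivAt_id t))).hasDerivWithinAt

lemma hasFDerivAt (hF : IsSmoothFamily k F) (hk : k ≠ 0) {τ t : ℝ} (hτ : 0 ≤ τ) (ht : 0 ≤ t)
    (x : Euc n) :
    HasFDerivAt (fun y => F τ y t) ((fderivWithin ℝ (fun p : ℝ × Euc n × ℝ => F p.1 p.2.1 p.2.2)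
      (paramHalfSpace n) (τ, x, t)).comp
      ((0 : Euc n →L[ℝ] ℝ).prod ((ContinuousLinearMap.id ℝ (Euc n)).prod 0))) x := by
  have h := (hF.differentiableOn hk (τ, x, t) ⟨hτ, mem_univ _, ht⟩).hasFDerivWithinAt
  rw [← hasFDerivWithinAt_univ]
  refine h.comp (f := fun y => (τ, y, t)) x ?_ fun s hs => ⟨hτ, mem_univ _, ht⟩
  exact ((hasFDerivAt_const τ x).prodMk ((hasFDerivAt_id x).prodMk
    (hasFDerivAt_const t x))).hasFDerivWithinAt

lemma dt_eq (hF : IsSmoothFamily k F) (hk : k ≠ 0) {τ t : ℝ} (hτ : 0 ≤ τ) (ht : 0 ≤ t) (x : Euc n) :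
    dt (F τ) x t = fderivWithin ℝ (fun p : ℝ × Euc n × ℝ => F p.1 p.2.1 p.2.2)
      (paramHalfSpace n) (τ, x, t) (0, 0, 1) :=
  (hF.hasDerivWithinAt hk hτ ht x).derivWithin (uniqueDiffOn_Ici 0 t ht)

lemma dirDeriv_eq (hF : IsSmoothFamily k F) (hk : k ≠ 0) {τ t : ℝ} (hτ : 0 ≤ τ) (ht : 0 ≤ t)
    (v x : Euc n) :
    dirDeriv v (F τ) x t = fderivWithin ℝ (fun p : ℝ × Euc n × ℝ => F p.1 p.2.1 p.2.2)
      (paramHalfSpace n) (τ, x, t) (0, v, 0) := by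
  rw [dirDeriv, (hF.hasFDerivAt hk hτ ht x).fderiv]
  simp

lemma fderivWithin_apply (hF : IsSmoothFamily k F) (hl : l + 1 ≤ k) (w : ℝ × Euc n × ℝ) :
    IsSmoothFamily l (fun τ x t => fderivWithin ℝ (fun p : ℝ × Euc n × ℝ => F p.1 p.2.1 p.2.2)
      (paramHalfSpace n) (τ, x, t) w) :=
  (ContDiffOn.fderivWithin hF uniqueDiffOn_paramHalfSpace hl).clm_apply contDiffOn_const

lemma congr {F' : ℝ → Euc n → ℝ → 𝕜} (hF : IsSmoothFamily k F)
    (h : ∀ τ, 0 ≤ τ → ∀ x t, 0 ≤ t → F' τ x t = F τ x t) : IsSmoothFamily k F' :=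
  ContDiffOn.congr hF fun p hp => h p.1 hp.1 p.2.1 p.2.2 hp.2.2

lemma ne_zero_of_add_one_le (hl : l + 1 ≤ k) : k ≠ 0 := by
  rintro rfl
  simp at hl

protected lemma dt (hF : IsSmoothFamily k F) (hl : l + 1 ≤ k) :
    IsSmoothFamily l (fun τ => dt (F τ)) :=
  (hF.fderivWithin_apply hl (0, 0, 1)).congr fun _ hτ x _ ht =>
    hF.dt_eq (ne_zero_of_add_one_le hl) hτ ht x

protected lemma dirDeriv (hF : IsSmoothFamily k F) (hl : l + 1 ≤ k) (v : Euc n) :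
    IsSmoothFamily l (fun τ => dirDeriv v (F τ)) :=
  (hF.fderivWithin_apply hl (0, v, 0)).congr fun _ hτ x _ ht =>
    hF.dirDeriv_eq (ne_zero_of_add_one_le hl) hτ ht v x

lemma fderivWithin_fderivWithin (hF : IsSmoothFamily k F) (hk : 2 ≤ k) {p : ℝ × Euc n × ℝ}
    (hp : p ∈ paramHalfSpace n) (w w' : ℝ × Euc n × ℝ) :
    fderivWithin ℝ (fun q : ℝ × Euc n × ℝ =>
      fderivWithin ℝ (fun p : ℝ × Euc n × ℝ => F p.1 p.2.1 p.2.2)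
        (paramHalfSpace n) q w) (paramHalfSpace n) p w' =
    fderivWithin ℝ (fun q : ℝ × Euc n × ℝ =>
      fderivWithin ℝ (fun p : ℝ × Euc n × ℝ => F p.1 p.2.1 p.2.2)
        (paramHalfSpace n) q w') (paramHalfSpace n) p w := by
  have hd : DifferentiableWithinAt ℝ (fderivWithin ℝ (fun p : ℝ × Euc n × ℝ => F p.1 p.2.1 p.2.2)
      (paramHalfSpace n)) (paramHalfSpace n) p :=
    (ContDiffOn.fderivWithin (m := 1) hF uniqueDiffOn_paramHalfSpace
      (le_trans (by norm_num) hk)).differentiableOn (by simp) p hp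
  have hu := uniqueDiffOn_paramHalfSpace p hp
  rw [fderivWithin_clm_apply hu hd (by fun_prop), fderivWithin_clm_apply hu hd (by fun_prop)]
  have := ContDiffWithinAt.isSymmSndFDerivWithinAt (hF p hp) (by simpa using hk)
    uniqueDiffOn_paramHalfSpace (mem_closure_interior_paramHalfSpace hp) hp
  simpa using this w' w

lemma dt_dirDeriv (hF : IsSmoothFamily k F) (hk : 2 ≤ k) {τ t : ℝ} (hτ : 0 ≤ τ) (ht : 0 ≤ t)
    (v x : Euc n) :
    dt (MultiWave.dirDeriv v (F τ)) x t = MultiWave.dirDeriv v (MultiWave.dt (F τ)) x t := by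
  have h2 : (1 : WithTop ℕ∞) + 1 ≤ k := le_trans (by norm_num) hk
  have hk0 := ne_zero_of_add_one_le h2
  rw [(hF.dirDeriv h2 v).dt_eq (by simp) hτ ht, (hF.dt h2).dirDeriv_eq (by simp) hτ ht]
  have hp : ((τ, x, t) : ℝ × Euc n × ℝ) ∈ paramHalfSpace n := ⟨hτ, mem_univ _, ht⟩
  have e1 := fderivWithin_congr (𝕜 := ℝ) (s := paramHalfSpace n) (x := (τ, x, t))
    (f₁ := fun q : ℝ × Euc n × ℝ => MultiWave.dirDeriv v (F q.1) q.2.1 q.2.2)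
    (fun q hq => hF.dirDeriv_eq hk0 hq.1 hq.2.2 v q.2.1) (hF.dirDeriv_eq hk0 hτ ht v x)
  have e2 := fderivWithin_congr (𝕜 := ℝ) (s := paramHalfSpace n) (x := (τ, x, t))
    (f₁ := fun q : ℝ × Euc n × ℝ => MultiWave.dt (F q.1) q.2.1 q.2.2)
    (fun q hq => hF.dt_eq hk0 hq.1 hq.2.2 q.2.1) (hF.dt_eq hk0 hτ ht x)
  rw [e1, e2]
  exact hF.fderivWithin_fderivWithin hk hp _ _

end IsSmoothFamily

/-- A function of class `C^k` on the half-space, seen as a constant family. -/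
lemma isSmoothFamily_const_iff {k : WithTop ℕ∞} {u : Euc n → ℝ → 𝕜} :
    IsSmoothFamily k (fun _ => u) ↔ ContDiffOn ℝ k (Function.uncurry u) (univ ×ˢ Ici 0) := by
  constructor
  · intro h
    exact ContDiffOn.comp h (f := fun q : Euc n × ℝ => ((0 : ℝ), q.1, q.2)) (by fun_prop)
      fun q hq => ⟨self_mem_Ici, mem_univ _, hq.2⟩
  · intro h
    exact ContDiffOn.comp h (f := fun p : ℝ × Euc n × ℝ => (p.2.1, p.2.2)) (by fun_prop)
      fun q hq => ⟨mem_univ _, hq.2.2⟩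

lemma laplacian_eq_sum {g : Euc n → 𝕜} (hg : ContDiff ℝ 2 g) (x : Euc n) :
    Laplacian.laplacian g x =
      ∑ i, fderiv ℝ (fun y => fderiv ℝ g y (EuclideanSpace.basisFun (Fin n) ℝ i))
      x (EuclideanSpace.basisFun (Fin n) ℝ i) := by
  rw [InnerProductSpace.laplacian_eq_iteratedFDeriv_orthonormalBasis g
    (EuclideanSpace.basisFun (Fin n) ℝ)]
  refine Finset.sum_congr rfl fun i _ => ?_
  rw [iteratedFDeriv_two_apply, fderiv_clm_apply _ (by fun_prop)]
  · simp
  · exact ((hg.fderiv_right (m := 1) (by norm_num)).differentiable (by simp)) x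

/-- The operator `a² Δ` in the space variable. -/
def spaceOp (a : ℝ) (u : Euc n → ℝ → 𝕜) : Euc n → ℝ → 𝕜 :=
  fun x t => scaledLaplacian a (fun y => u y t) x

namespace IsSmoothFamily

variable {k l : WithTop ℕ∞} {F : ℝ → Euc n → ℝ → 𝕜}

lemma contDiff_space (hF : IsSmoothFamily k F) {τ t : ℝ} (hτ : 0 ≤ τ) (ht : 0 ≤ t) :
    ContDiff ℝ k (fun y => F τ y t) := by
  rw [← contDiffOn_univ]
  exact ContDiffOn.comp hF (f := fun y => (τ, y, t)) (by fun_prop)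
    fun q hq => ⟨hτ, mem_univ _, ht⟩

lemma spaceOp_eq (hF : IsSmoothFamily k F) (hk : 2 ≤ k) (a : ℝ) {τ t : ℝ} (hτ : 0 ≤ τ)
    (ht : 0 ≤ t) (x : Euc n) :
    spaceOp a (F τ) x t = a ^ 2 • ∑ i, MultiWave.dirDeriv (EuclideanSpace.basisFun (Fin n) ℝ i)
      (MultiWave.dirDeriv (EuclideanSpace.basisFun (Fin n) ℝ i) (F τ)) x t := by
  rw [spaceOp, scaledLaplacian, laplacian_eq_sum ((hF.contDiff_space hτ ht).of_le hk)]
  rfl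

protected lemma spaceOp (hF : IsSmoothFamily k F) (hl : l + 2 ≤ k) (a : ℝ) :
    IsSmoothFamily l (fun τ => spaceOp a (F τ)) := by
  have h2 : l + 1 + 1 ≤ k := by rwa [add_assoc, one_add_one_eq_two]
  refine IsSmoothFamily.congr (F := fun τ x t => a ^ 2 • ∑ i,
    MultiWave.dirDeriv (EuclideanSpace.basisFun (Fin n) ℝ i)
      (MultiWave.dirDeriv (EuclideanSpace.basisFun (Fin n) ℝ i) (F τ)) x t) ?_
    fun τ hτ x t ht => hF.spaceOp_eq (le_trans (by simp) hl) a hτ ht x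
  exact (ContDiffOn.sum fun i _ => (hF.dirDeriv h2 _).dirDeriv le_rfl _).const_smul _

end IsSmoothFamily

/-! ### Smooth functions on the half-space and the operators acting on them -/

/-- Smooth functions on the closed half-space `ℝⁿ × [0, ∞)`, extended by zero to `t < 0`.
The extension makes the representative unique, so that identities between operators are
equalities of endomorphisms. -/
def halfSpaceSubmodule (𝕜 : Type*) [RCLike 𝕜] (n : ℕ) : Submodule ℝ (Euc n → ℝ → 𝕜) where
  carrier := {u | IsSmoothFamily ∞ (fun _ => u) ∧ ∀ x, ∀ t < 0, u x t = 0}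
  add_mem' {u v} hu hv :=
    ⟨ContDiffOn.add hu.1 hv.1, fun x t ht => by simp [hu.2 x t ht, hv.2 x t ht]⟩
  zero_mem' := ⟨contDiffOn_const, fun _ _ _ => rfl⟩
  smul_mem' c u hu := ⟨ContDiffOn.const_smul c hu.1, fun x t ht => by simp [hu.2 x t ht]⟩

/-- The real vector space of smooth functions on the closed half-space. -/
abbrev HalfSpaceFun (𝕜 : Type*) [RCLike 𝕜] (n : ℕ) := ↥(halfSpaceSubmodule 𝕜 n)

/-- A family of smooth functions on the half-space that is jointly smooth with its parameter. -/
def IsJointlySmooth (F : ℝ → HalfSpaceFun 𝕜 n) : Prop :=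
  IsSmoothFamily ∞ (fun τ => (F τ).1)

lemma two_le_infty : (2 : WithTop ℕ∞) ≤ ∞ :=
  WithTop.coe_le_coe.2 (show (2 : ℕ∞) ≤ ⊤ from le_top)

namespace HalfSpaceFun

variable (u v : HalfSpaceFun 𝕜 n)

lemma smooth : IsSmoothFamily ∞ (fun _ => u.1) := u.2.1

lemma apply_of_neg (x : Euc n) {t : ℝ} (ht : t < 0) : u.1 x t = 0 := u.2.2 x t ht

variable {u v} in
lemma ext_of_nonneg
    (h : ∀ x t, 0 ≤ t → u.1 x t = v.1 x t) : u = v := by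
  refine Subtype.ext (funext fun x => funext fun t => ?_)
  rcases lt_or_ge t 0 with ht | ht
  · rw [u.apply_of_neg x ht, v.apply_of_neg x ht]
  · exact h x t ht

lemma contDiff_space (t : ℝ) : ContDiff ℝ ∞ (fun y => u.1 y t) := by
  rcases lt_or_ge t 0 with ht | ht
  · simp only [u.apply_of_neg _ ht]; exact contDiff_const
  · exact u.smooth.contDiff_space (τ := 0) le_rfl ht

lemma contDiffOn_time (x : Euc n) : ContDiffOn ℝ ∞ (u.1 x) (Ici 0) :=
  ContDiffOn.comp u.smooth (f := fun t => ((0 : ℝ), x, t)) (by fun_prop)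
    fun _ ht => ⟨self_mem_Ici, mem_univ _, ht⟩

lemma dt_of_neg (x : Euc n) {t : ℝ} (ht : t < 0) : MultiWave.dt u.1 x t = 0 := by
  refine derivWithin_zero_of_notMem_closure ?_
  rw [closure_Ici]
  exact fun h => absurd ht (not_lt.2 h)

lemma differentiableWithinAt_time (x : Euc n) {t : ℝ} (ht : 0 ≤ t) :
    DifferentiableWithinAt ℝ (u.1 x) (Ici 0) t :=
  (u.contDiffOn_time x).differentiableOn (by simp) t ht

/-- The time derivative as an endomorphism. -/
def dt : Module.End ℝ (HalfSpaceFun 𝕜 n) where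
  toFun u := ⟨MultiWave.dt u.1, u.smooth.dt (by simp), fun x _ ht => u.dt_of_neg x ht⟩
  map_add' u v := ext_of_nonneg fun x t ht =>
    derivWithin_add (u.differentiableWithinAt_time x ht) (v.differentiableWithinAt_time x ht)
  map_smul' c u := ext_of_nonneg fun x t ht =>
    derivWithin_const_smul c (u.differentiableWithinAt_time x ht)

lemma hasDerivWithinAt (x : Euc n) {t : ℝ} (ht : 0 ≤ t) :
    HasDerivWithinAt (u.1 x) ((dt u).1 x t) (Ici 0) t :=
  (u.differentiableWithinAt_time x ht).hasDerivWithinAt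

variable {u} in
lemma dt_apply_eq {x : Euc n} {t : ℝ} (ht : 0 ≤ t) {g : 𝕜}
    (h : HasDerivWithinAt (u.1 x) g (Ici 0) t) :
    (dt u).1 x t = g :=
  h.derivWithin (uniqueDiffOn_Ici 0 t ht)

/-- The directional derivative in a space direction as an endomorphism. -/
def dirDeriv (w : Euc n) : Module.End ℝ (HalfSpaceFun 𝕜 n) where
  toFun u := ⟨MultiWave.dirDeriv w u.1, u.smooth.dirDeriv (by simp) w,
    fun x t ht => by simp [MultiWave.dirDeriv, u.apply_of_neg _ ht]⟩
  map_add' u v := by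
    refine Subtype.ext (funext fun x => funext fun t => ?_)
    have := fderiv_add ((u.contDiff_space t).differentiable (by simp) x)
      ((v.contDiff_space t).differentiable (by simp) x)
    exact congrArg (fun l => l w) this
  map_smul' c u := by
    refine Subtype.ext (funext fun x => funext fun t => ?_)
    have := fderiv_const_smul ((u.contDiff_space t).differentiable (by simp) x) c
    exact congrArg (fun l => l w) this

/-- The operator `a² Δ` as an endomorphism. -/
def spaceOp (a : ℝ) : Module.End ℝ (HalfSpaceFun 𝕜 n) :=
  a ^ 2 • ∑ i, dirDeriv (EuclideanSpace.basisFun (Fin n) ℝ i) *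
    dirDeriv (EuclideanSpace.basisFun (Fin n) ℝ i)

lemma sum_coe {ι : Type*} (s : Finset ι) (f : ι → HalfSpaceFun 𝕜 n) (x : Euc n) (t : ℝ) :
    (∑ i ∈ s, f i).1 x t =
      ∑ i ∈ s, (f i).1 x t := by
  rw [Submodule.coe_sum, Finset.sum_apply, Finset.sum_apply]

lemma spaceOp_apply_eq_sum (a : ℝ) (x : Euc n) (t : ℝ) :
    (spaceOp a u).1 x t = a ^ 2 • ∑ i, (dirDeriv (EuclideanSpace.basisFun (Fin n) ℝ i)
      (dirDeriv (EuclideanSpace.basisFun (Fin n) ℝ i) u)).1 x t := by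
  rw [← sum_coe, spaceOp, LinearMap.smul_apply, LinearMap.sum_apply]
  rfl

lemma coe_spaceOp (a : ℝ) : (spaceOp a u).1 = MultiWave.spaceOp a u.1 := by
  funext x t
  rw [spaceOp_apply_eq_sum, MultiWave.spaceOp, scaledLaplacian,
    laplacian_eq_sum ((u.contDiff_space t).of_le two_le_infty)]
  rfl

/-- Multiplication by `t` as an endomorphism. -/
def mulTime : Module.End ℝ (HalfSpaceFun 𝕜 n) where
  toFun u := ⟨fun x t => t • u.1 x t,
    ContDiffOn.smul (f := fun p : ℝ × Euc n × ℝ => p.2.2) (by fun_prop) u.smooth,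
    fun x t ht => by simp [u.apply_of_neg _ ht]⟩
  map_add' u v := Subtype.ext (funext fun x => funext fun t => smul_add _ _ _)
  map_smul' c u := Subtype.ext (funext fun x => funext fun t => smul_comm _ _ _)

lemma mulTime_apply (x : Euc n) (t : ℝ) :
    (mulTime u).1 x t = t • u.1 x t := rfl

end HalfSpaceFun

/-! ### The weighted primitive -/

/-- Rescaling to a fixed interval turns an integral with variable end point into an integral that
depends on a parameter. -/
lemma intervalIntegral_eq_smul_setIntegral (h : ℝ → 𝕜) (t : ℝ) :
    ∫ s in (0 : ℝ)..t, h s = t • ∫ θ in Icc (0 : ℝ) 1, h (t * θ) := by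
  rw [integral_Icc_eq_integral_Ioc, ← intervalIntegral.integral_of_le zero_le_one,
    intervalIntegral.smul_integral_comp_mul_left]
  simp

lemma IsSmoothFamily.weightedPrimitive {F : ℝ → Euc n → ℝ → 𝕜} (hF : IsSmoothFamily ∞ F) :
    IsSmoothFamily ∞ (fun τ x => weightedPrimitive (F τ x)) := by
  have : IsSmoothFamily ∞ (fun τ x t => t • ∫ θ in Icc (0 : ℝ) 1, (t * θ) • F τ x (t * θ)) := by
    refine ContDiffOn.smul (f := fun p : ℝ × Euc n × ℝ => p.2.2) (by fun_prop) ?_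
    refine contDiffOn_setIntegral_param (V := ℝ) (c := id) (T := Icc 0 1)
      (F := fun q : (ℝ × Euc n × ℝ) × ℝ =>
        (q.1.2.2 * q.2) • F q.1.1 q.1.2.1 (q.1.2.2 * q.2))
      convex_paramHalfSpace isCompact_Icc
      (uniqueDiffOn_paramHalfSpace.prod (uniqueDiffOn_Icc one_pos)) uniqueDiffOn_paramHalfSpace
      continuous_id (mapsTo_id _) ?_
    refine ContDiffOn.smul (f := fun q : (ℝ × Euc n × ℝ) × ℝ => q.1.2.2 * q.2) (by fun_prop) ?_
    refine ContDiffOn.comp hF (f := fun q : (ℝ × Euc n × ℝ) × ℝ =>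
      (q.1.1, q.1.2.1, q.1.2.2 * q.2)) (by fun_prop) fun q hq => ?_
    exact ⟨hq.1.1, mem_univ _, mul_nonneg hq.1.2.2 hq.2.1⟩
  exact this.congr fun τ _ x t _ => intervalIntegral_eq_smul_setIntegral (fun s => s • F τ x s) t

lemma hasDerivWithinAt_intervalIntegral {h : ℝ → 𝕜} (hc : ContinuousOn h (Ici 0)) {t : ℝ}
    (ht : 0 ≤ t) :
    HasDerivWithinAt (fun t => ∫ s in (0 : ℝ)..t, h s) (h t) (Ici 0) t := by
  -- Constant extension to negative times, so that the two-sided fundamental theorem applies.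
  have hc' : Continuous (fun s => h (max s 0)) :=
    hc.comp_continuous (by fun_prop) fun s => le_max_right s 0
  have h1 := (hc'.integral_hasStrictDerivAt 0 t).hasDerivAt.hasDerivWithinAt (s := Ici 0)
  rw [max_eq_left ht] at h1
  have h2 : ∀ s ∈ Ici (0 : ℝ), ∫ s in (0 : ℝ)..s, h s = ∫ s in (0 : ℝ)..s, h (max s 0) := by
    intro s hs
    refine intervalIntegral.integral_congr fun r hr => ?_
    rw [uIcc_of_le hs] at hr
    simp only [max_eq_left hr.1]
  exact h1.congr h2 (h2 t ht)

lemma weightedPrimitive_congr {g h : ℝ → 𝕜} (hgh : ∀ t, 0 < t → g t = h t) {t : ℝ} (ht : 0 ≤ t) :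
    weightedPrimitive g t = weightedPrimitive h t := by
  refine intervalIntegral.integral_congr_ae (ae_of_all _ fun s hs => ?_)
  rw [uIoc_of_le ht] at hs
  rw [hgh s hs.1]

section DirDeriv

variable {X : Type*} [TopologicalSpace X] [T2Space X] [MeasurableSpace X] [OpensMeasurableSpace X]
  {μ : Measure X} [IsFiniteMeasureOnCompacts μ] {K : Set X}

/-- Differentiation under the integral sign in a space direction, when the integral is already
known to be differentiable. -/
lemma fderiv_setIntegral_apply {H : Euc n → X → 𝕜} {w : Euc n} (hK : IsCompact K)
    (hH : ContinuousOn (Function.uncurry H) (univ ×ˢ K))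
    (hH' : ContinuousOn (fun p : Euc n × X => fderiv ℝ (fun y => H y p.2) p.1 w) (univ ×ˢ K))
    (hd : ∀ ξ ∈ K, Differentiable ℝ (fun y => H y ξ)) {x : Euc n}
    (hx : DifferentiableAt ℝ (fun y => ∫ ξ in K, H y ξ ∂μ) x) :
    fderiv ℝ (fun y => ∫ ξ in K, H y ξ ∂μ) x w = ∫ ξ in K, fderiv ℝ (fun y => H y ξ) x w ∂μ := by
  have hline : ∀ r : ℝ, HasDerivAt (fun r : ℝ => x + r • w) w r := fun r => by
    simpa using ((hasDerivAt_id r).smul_const w).const_add x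
  have h1 := hasDerivWithinAt_setIntegral_param (μ := μ) (S := univ)
    (F := fun r ξ => H (x + r • w) ξ)
    (F' := fun r ξ => fderiv ℝ (fun y => H y ξ) (x + r • w) w) (y := (0 : ℝ)) convex_univ hK
    (hH.comp (f := fun p : ℝ × X => (x + p.1 • w, p.2)) (by fun_prop)
      fun p hp => ⟨mem_univ _, hp.2⟩)
    (hH'.comp (f := fun p : ℝ × X => (x + p.1 • w, p.2)) (by fun_prop)
      fun p hp => ⟨mem_univ _, hp.2⟩)
    (fun r _ ξ hξ => (HasFDerivAt.comp_hasDerivAt (l := fun y => H y ξ) r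
      (hd ξ hξ (x + r • w)).hasFDerivAt (hline r)).hasDerivWithinAt)
    (mem_univ _)
  have hx' : DifferentiableAt ℝ (fun y => ∫ ξ in K, H y ξ ∂μ) (x + (0 : ℝ) • w) := by simpa using hx
  have h2 := hx'.hasFDerivAt.comp_hasDerivAt 0 (hline 0)
  simpa using h2.unique (hasDerivWithinAt_univ.1 h1)

end DirDeriv

namespace HalfSpaceFun

variable (u v : HalfSpaceFun 𝕜 n)

/-- The operator `u ↦ ∫₀ᵗ u(x, s) s ds` as an endomorphism. -/
def prim : Module.End ℝ (HalfSpaceFun 𝕜 n) where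
  toFun u := ⟨fun x => weightedPrimitive (u.1 x), u.smooth.weightedPrimitive,
    fun x t ht => by
      simp only [MultiWave.weightedPrimitive]
      rw [intervalIntegral.integral_symm, intervalIntegral.integral_of_le ht.le,
        integral_Ioc_eq_integral_Ioo, setIntegral_congr_fun (g := fun _ => 0) measurableSet_Ioo]
      · simp
      · exact fun s hs => by simp [u.apply_of_neg x hs.2]⟩
  map_add' u v := ext_of_nonneg fun x t ht => by
    have h : ∀ w : HalfSpaceFun 𝕜 n, IntervalIntegrable (fun s => s • w.1 x s) volume 0 t :=
      fun w => ContinuousOn.intervalIntegrable_of_Icc ht (ContinuousOn.smul (by fun_prop)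
        ((w.contDiffOn_time x).continuousOn.mono Icc_subset_Ici_self))
    simpa [weightedPrimitive] using intervalIntegral.integral_add (h u) (h v)
  map_smul' c u := ext_of_nonneg fun x t _ => by
    simp only [weightedPrimitive, Submodule.coe_smul, Pi.smul_apply, RingHom.id_apply,
      ← intervalIntegral.integral_smul]
    simp only [smul_comm c]

lemma coe_prim (x : Euc n) :
    (prim u).1 x = weightedPrimitive (u.1 x) := rfl

lemma dt_mul_prim : dt * prim = (mulTime : Module.End ℝ (HalfSpaceFun 𝕜 n)) := by
  refine LinearMap.ext fun u => ext_of_nonneg fun x t ht => dt_apply_eq ht ?_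
  exact hasDerivWithinAt_intervalIntegral (h := fun s => s • u.1 x s)
    (ContinuousOn.smul (by fun_prop) (u.contDiffOn_time x).continuousOn) ht

lemma dt_prim : dt (prim u) = mulTime u := congrArg (fun l => l u) dt_mul_prim

lemma dt_mulTime : dt (mulTime u) = mulTime (dt u) + u := by
  refine ext_of_nonneg fun x t ht => dt_apply_eq ht ?_
  have := (hasDerivAt_id t).hasDerivWithinAt (s := Ici 0) |>.smul (u.hasDerivWithinAt x ht)
  have e : (mulTime (dt u) + u).1 x t = id t • (dt u).1 x t + (1 : ℝ) • u.1 x t := by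
    simp [mulTime_apply]
  rw [e]
  exact this

lemma prim_apply_zero (x : Euc n) : (prim u).1 x 0 = 0 := by
  simp [coe_prim, weightedPrimitive]

lemma mulTime_apply_zero (x : Euc n) : (mulTime u).1 x 0 = 0 := by
  simp [mulTime_apply]

variable {u v} in
/-- A function is determined by its time derivative and its initial values. -/
lemma eq_of_dt_eq (h : dt u = dt v)
    (h0 : ∀ x, u.1 x 0 = v.1 x 0) : u = v := by
  refine ext_of_nonneg fun x t ht => ?_
  have hd : ∀ s, 0 ≤ s → HasDerivWithinAt (fun s => u.1 x s -
      v.1 x s) 0 (Ici 0) s := fun s hs => by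
    have := (u.hasDerivWithinAt x hs).sub (v.hasDerivWithinAt x hs)
    rw [h, sub_self] at this
    exact this
  have := constant_of_has_deriv_right_zero (a := 0) (b := t)
    (fun s hs => ((hd s hs.1).mono Icc_subset_Ici_self).continuousWithinAt)
    (fun s hs => (hd s hs.1).mono (Ici_subset_Ici.2 hs.1)) t ⟨ht, le_rfl⟩
  simp only [h0, sub_self] at this
  exact sub_eq_zero.1 this

lemma commute_dt_dirDeriv (w : Euc n) :
    Commute (dt : Module.End ℝ (HalfSpaceFun 𝕜 n)) (dirDeriv w) :=
  LinearMap.ext fun u => ext_of_nonneg fun x _ ht =>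
    u.smooth.dt_dirDeriv two_le_infty (τ := 0) le_rfl ht w x

lemma commute_mulTime_dirDeriv (w : Euc n) :
    Commute (mulTime : Module.End ℝ (HalfSpaceFun 𝕜 n)) (dirDeriv w) := by
  refine LinearMap.ext fun u => ext_of_nonneg fun x t _ => ?_
  have := fderiv_const_smul ((u.contDiff_space t).differentiable (by simp) x) t
  exact (congrArg (fun l => l w) this).symm

lemma commute_prim_dirDeriv (w : Euc n) :
    Commute (prim : Module.End ℝ (HalfSpaceFun 𝕜 n)) (dirDeriv w) := by
  refine LinearMap.ext fun u => eq_of_dt_eq ?_ fun x => ?_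
  · have e1 := congrArg (fun l => l u) (commute_mulTime_dirDeriv (𝕜 := 𝕜) w).eq
    have e2 := congrArg (fun l => l (prim u)) (commute_dt_dirDeriv (𝕜 := 𝕜) w).eq
    simp only [Module.End.mul_apply] at e1 e2 ⊢
    rw [dt_prim, e1, e2, dt_prim]
  · have : (dirDeriv w (prim u)).1 x 0 =
        fderiv ℝ (fun y => (prim u).1 y 0) x w := rfl
    simp [Module.End.mul_apply, prim_apply_zero, this]

lemma commute_spaceOp_of_forall {A : Module.End ℝ (HalfSpaceFun 𝕜 n)}
    (h : ∀ w, Commute A (dirDeriv w)) (a : ℝ) : Commute A (spaceOp a) :=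
  (Commute.sum_right _ _ _ fun _ _ => (h _).mul_right (h _)).smul_right _

lemma commute_dt_spaceOp (a : ℝ) :
    Commute (dt : Module.End ℝ (HalfSpaceFun 𝕜 n)) (spaceOp a) :=
  commute_spaceOp_of_forall commute_dt_dirDeriv a

lemma commute_mulTime_spaceOp (a : ℝ) :
    Commute (mulTime : Module.End ℝ (HalfSpaceFun 𝕜 n)) (spaceOp a) :=
  commute_spaceOp_of_forall commute_mulTime_dirDeriv a

lemma commute_prim_spaceOp (a : ℝ) :
    Commute (prim : Module.End ℝ (HalfSpaceFun 𝕜 n)) (spaceOp a) :=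
  commute_spaceOp_of_forall commute_prim_dirDeriv a

end HalfSpaceFun

/-! ### Integrals over the unit sphere -/

section Sphere

variable {n : ℕ}

/-- The surface measure of the unit sphere. -/
abbrev sphereMeasure (n : ℕ) : Measure (Metric.sphere (0 : Euc n) 1) :=
  (volume : Measure (Euc n)).toSphere

/-- The surface area of the unit sphere in odd dimension. It differs from the normalization of the
spherical means by the factor `1 / (2ν + 1)!!`. -/
lemma real_sphereMeasure_univ (ν : ℕ) :
    (sphereMeasure (2 * ν + 3)).real univ =
      2 * (2 * Real.pi) ^ (ν + 1) / (Nat.doubleFactorial (2 * ν + 1) : ℝ) := by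
  have hs : √Real.pi ^ 2 = Real.pi := Real.sq_sqrt Real.pi_pos.le
  have hsp : √Real.pi ≠ 0 := (Real.sqrt_pos.2 Real.pi_pos).ne'
  have hG : Real.Gamma (((2 * ν + 3 : ℕ) : ℝ) / 2 + 1) =
      ((2 * ν + 3 : ℕ) : ℝ) / 2 *
        ((Nat.doubleFactorial (2 * ν + 1) : ℝ) * √Real.pi / 2 ^ (ν + 1)) := by
    rw [Real.Gamma_add_one (by positivity)]
    congr 1
    have := Real.Gamma_nat_add_half (ν + 1)
    rw [show 2 * (ν + 1) - 1 = 2 * ν + 1 by omega] at this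
    rw [← this]; congr 1; push_cast; ring
  have hd : (Nat.doubleFactorial (2 * ν + 1) : ℝ) ≠ 0 := by
    exact_mod_cast (Nat.doubleFactorial_pos _).ne'
  rw [Measure.toSphere_real_apply_univ, Measure.real, EuclideanSpace.volume_ball]
  simp only [Fintype.card_fin, finrank_euclideanSpace, ENNReal.ofReal_one, one_pow, one_mul]
  rw [hG, ENNReal.toReal_ofReal (by positivity)]
  rw [show 2 * ν + 3 = 2 * (ν + 1) + 1 by ring, pow_succ, pow_mul, hs, mul_pow]
  have : ((2 * (ν + 1) + 1 : ℕ) : ℝ) ≠ 0 := by positivity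
  field_simp

lemma integral_sphere_comp_isometry {G : Type*} [NormedAddCommGroup G] [NormedSpace ℝ G]
    (R : Euc n ≃ₗᵢ[ℝ] Euc n) (h : Euc n → G) :
    ∫ p : Metric.sphere (0 : Euc n) 1, h (R p) ∂sphereMeasure n =
      ∫ p : Metric.sphere (0 : Euc n) 1, h p ∂sphereMeasure n := by
  let e : Metric.sphere (0 : Euc n) 1 ≃ₜ Metric.sphere (0 : Euc n) 1 :=
    { toFun := fun p => ⟨R p, by simp⟩
      invFun := fun p => ⟨R.symm p, by simp⟩
      left_inv := fun p => by simp
      right_inv := fun p => by simp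
      continuous_toFun := by fun_prop
      continuous_invFun := by fun_prop }
  have hmp : MeasurePreserving e (sphereMeasure n) (sphereMeasure n) := by
    refine ⟨e.continuous.measurable, Measure.ext fun s hs => ?_⟩
    rw [Measure.map_apply e.continuous.measurable hs, Measure.toSphere_apply' _ hs,
      Measure.toSphere_apply' _ (e.continuous.measurable hs)]
    congr 1
    rw [← R.symm.measurePreserving.measure_preimage_equiv
      (f := R.symm.toHomeomorph.toMeasurableEquiv)]
    congr 1
    ext y
    constructor
    · rintro ⟨c, hc, _, ⟨p, hp, rfl⟩, hy⟩
      refine ⟨c, hc, _, ⟨e p, hp, rfl⟩, ?_⟩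
      have hy' : c • (p : Euc n) = R.symm y := hy
      change c • R p = y
      rw [← map_smul, hy', R.apply_symm_apply]
    · rintro ⟨c, hc, _, ⟨p, hp, rfl⟩, rfl⟩
      refine ⟨c, hc, _, ⟨e.symm p, by simpa using hp, rfl⟩, ?_⟩
      exact (map_smul R.symm c (p : Euc n)).symm
  exact hmp.integral_comp e.measurableEmbedding (fun p => h p)

/-- The rotation by the angle `θ` in the plane spanned by the orthonormal vectors `u` and `v`. -/
def planeRotation {u v : Euc n} (hu : ‖u‖ = 1) (hv : ‖v‖ = 1) (huv : inner ℝ u v = 0) (θ : ℝ) :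
    Euc n ≃ₗᵢ[ℝ] Euc n :=
  LinearIsometry.toLinearIsometryEquiv
    { toLinearMap := LinearMap.id +
        ((innerₛₗ ℝ u).smulRight ((Real.cos θ - 1) • u + Real.sin θ • v) +
          (innerₛₗ ℝ v).smulRight ((Real.cos θ - 1) • v - Real.sin θ • u))
      norm_map' := fun p => by
        have h1 : ∀ w : Euc n, ‖w‖ = ‖p‖ ↔ inner ℝ w w = inner ℝ p p := fun w => by
          rw [real_inner_self_eq_norm_sq, real_inner_self_eq_norm_sq,
            sq_eq_sq₀ (norm_nonneg _) (norm_nonneg _)]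
        have hvu : inner ℝ v u = 0 := by rw [real_inner_comm]; exact huv
        have huu : inner ℝ u u = 1 := by rw [real_inner_self_eq_norm_sq, hu, one_pow]
        have hvv : inner ℝ v v = 1 := by rw [real_inner_self_eq_norm_sq, hv, one_pow]
        rw [h1]
        simp only [LinearMap.add_apply, LinearMap.id_apply, LinearMap.smulRight_apply,
          innerₛₗ_apply_apply, inner_add_left, inner_add_right, inner_smul_left, inner_smul_right,
          inner_sub_left, inner_sub_right, hvu, huu, hvv, huv, real_inner_comm u p,
          real_inner_comm v p, conj_trivial]
        linear_combination (inner ℝ u p ^ 2 + inner ℝ v p ^ 2) * Real.sin_sq_add_cos_sq θ }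
    rfl

/-- The surface integral of the derivative of a function along an infinitesimal rotation is zero. -/
lemma integral_sphere_fderiv_rotation {𝕜 : Type*} [RCLike 𝕜] {h : Euc n → 𝕜} (hh : ContDiff ℝ 1 h)
    {u v : Euc n} (hu : ‖u‖ = 1) (hv : ‖v‖ = 1) (huv : inner ℝ u v = 0) :
    ∫ p : Metric.sphere (0 : Euc n) 1,
      fderiv ℝ h p (inner ℝ u (p : Euc n) • v - inner ℝ v (p : Euc n) • u)
        ∂sphereMeasure n = 0 := by
  let R : ℝ → Euc n → Euc n := fun θ p =>
    p + (inner ℝ u p • ((Real.cos θ - 1) • u + Real.sin θ • v) +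
      inner ℝ v p • ((Real.cos θ - 1) • v - Real.sin θ • u))
  let R' : ℝ → Euc n → Euc n := fun θ p =>
    inner ℝ u p • ((- Real.sin θ) • u + Real.cos θ • v) +
      inner ℝ v p • ((- Real.sin θ) • v - Real.cos θ • u)
  have hR : ∀ θ p, HasDerivAt (fun θ => R θ p) (R' θ p) θ := fun θ p => by
    have hc := (Real.hasDerivAt_cos θ).sub_const 1
    have hs := Real.hasDerivAt_sin θ
    exact ((((hc.smul_const u).add (hs.smul_const v)).const_smul (inner ℝ u p)).add
      (((hc.smul_const v).sub (hs.smul_const u)).const_smul (inner ℝ v p))).const_add p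
  have hfd : Continuous (fderiv ℝ h) := hh.continuous_fderiv (by simp)
  have h1 := hasDerivWithinAt_setIntegral_param (μ := sphereMeasure n) (S := univ) (K := univ)
    (F := fun θ (p : Metric.sphere (0 : Euc n) 1) => h (R θ p))
    (F' := fun θ p => fderiv ℝ h (R θ p) (R' θ p)) (y := (0 : ℝ)) convex_univ isCompact_univ
    (by
      apply Continuous.continuousOn
      exact hh.continuous.comp (by fun_prop))
    (by
      apply Continuous.continuousOn
      exact (hfd.comp (by fun_prop)).clm_apply (by fun_prop))
    (fun θ _ p _ => (HasFDerivAt.comp_hasDerivAt (l := h) θ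
      (hh.differentiable (by simp) _).hasFDerivAt (hR θ p)).hasDerivWithinAt)
    (mem_univ _)
  simp only [Measure.restrict_univ, hasDerivWithinAt_univ] at h1
  have h2 : (fun θ => ∫ p : Metric.sphere (0 : Euc n) 1, h (R θ p) ∂sphereMeasure n) =
      fun _ => ∫ p : Metric.sphere (0 : Euc n) 1, h p ∂sphereMeasure n :=
    funext fun θ => integral_sphere_comp_isometry (planeRotation hu hv huv θ) h
  rw [h2] at h1
  have h3 := h1.unique (hasDerivAt_const _ _)
  simpa [R, R', sub_eq_add_neg] using h3

end Sphere

/-! ### Spherical means and the Darboux equation -/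

lemma integrable_sphere {G : Type*} [NormedAddCommGroup G]
    {h : Metric.sphere (0 : Euc n) 1 → G} (hh : Continuous h) :
    Integrable h (sphereMeasure n) :=
  hh.integrable_of_hasCompactSupport (HasCompactSupport.of_compactSpace h)

lemma laplacian_eq_sum_fderiv_fderiv (g : Euc n → 𝕜) (x : Euc n) :
    Laplacian.laplacian g x = ∑ i, fderiv ℝ (fderiv ℝ g) x (EuclideanSpace.basisFun (Fin n) ℝ i)
      (EuclideanSpace.basisFun (Fin n) ℝ i) := by
  rw [InnerProductSpace.laplacian_eq_iteratedFDeriv_orthonormalBasis g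
    (EuclideanSpace.basisFun (Fin n) ℝ)]
  exact Finset.sum_congr rfl fun i _ => iteratedFDeriv_two_apply ..

lemma sum_basisFun_smul (p : Euc n) : ∑ i, p i • EuclideanSpace.basisFun (Fin n) ℝ i = p := by
  simpa using (EuclideanSpace.basisFun (Fin n) ℝ).sum_repr p

/-- The second-order part of the sum of the squares of the infinitesimal rotations in all
coordinate planes: twice the trace of the Hessian minus its radial component. -/
lemma sum_rotation_sq {G : Type*} [NormedAddCommGroup G] [NormedSpace ℝ G]
    (B : Euc n →L[ℝ] Euc n →L[ℝ] G) {p : Euc n} (hp : ‖p‖ = 1) :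
    ∑ i, ∑ j, B (p i • EuclideanSpace.basisFun (Fin n) ℝ j -
          p j • EuclideanSpace.basisFun (Fin n) ℝ i)
        (p i • EuclideanSpace.basisFun (Fin n) ℝ j - p j • EuclideanSpace.basisFun (Fin n) ℝ i) =
      (2 : ℝ) • (∑ i, B (EuclideanSpace.basisFun (Fin n) ℝ i)
        (EuclideanSpace.basisFun (Fin n) ℝ i) - B p p) := by
  have hp2 : ∑ i, p i * p i = 1 := by
    have := EuclideanSpace.norm_sq_eq p
    simp only [hp, one_pow, Real.norm_eq_abs, sq_abs] at this
    simpa [sq] using this.symm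
  set e := EuclideanSpace.basisFun (Fin n) ℝ with he
  have h1 : ∑ i, ∑ j, (p i * p i) • B (e j) (e j) = ∑ i, B (e i) (e i) := by
    simp only [← Finset.smul_sum, ← Finset.sum_smul, hp2, one_smul]
  have h2 : ∑ i, ∑ j, (p j * p j) • B (e i) (e i) = ∑ i, B (e i) (e i) := by
    simp only [← Finset.sum_smul, hp2, one_smul]
  have h3 : ∑ i, ∑ j, (p i * p j) • B (e i) (e j) = B p p := by
    conv_rhs => rw [← sum_basisFun_smul p]
    simp only [map_sum, map_smul, _root_.sum_apply, _root_.smul_apply,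
      Finset.smul_sum, smul_smul, ← he]
    rw [Finset.sum_comm]
    exact Finset.sum_congr rfl fun i _ => Finset.sum_congr rfl fun j _ => by rw [mul_comm]
  have h4 : ∑ i, ∑ j, (p i * p j) • B (e j) (e i) = B p p := by
    rw [Finset.sum_comm, ← h3]
    exact Finset.sum_congr rfl fun i _ => Finset.sum_congr rfl fun j _ => by rw [mul_comm]
  calc _ = ∑ i, ∑ j, ((p i * p i) • B (e j) (e j) + (p j * p j) • B (e i) (e i)
        - (p i * p j) • B (e i) (e j) - (p i * p j) • B (e j) (e i)) := by
        refine Finset.sum_congr rfl fun i _ => Finset.sum_congr rfl fun j _ => ?_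
        simp only [map_sub, map_smul, _root_.sub_apply,
          _root_.smul_apply, smul_sub, smul_smul]
        rw [mul_comm (p j) (p i)]
        abel
    _ = _ := by
        simp only [Finset.sum_sub_distrib, Finset.sum_add_distrib, h1, h2, h3, h4, two_smul]
        abel

/-- The first-order part of the sum of the squares of the infinitesimal rotations in all coordinate
planes. -/
lemma sum_rotation_rotation (p : Euc n) :
    ∑ i, ∑ j, ((p i • EuclideanSpace.basisFun (Fin n) ℝ j -
            p j • EuclideanSpace.basisFun (Fin n) ℝ i) i • EuclideanSpace.basisFun (Fin n) ℝ j -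
        (p i • EuclideanSpace.basisFun (Fin n) ℝ j -
            p j • EuclideanSpace.basisFun (Fin n) ℝ i) j • EuclideanSpace.basisFun (Fin n) ℝ i) =
      (-(2 * ((n : ℝ) - 1))) • p := by
  set e := EuclideanSpace.basisFun (Fin n) ℝ with he
  have h1 : ∑ i : Fin n, ∑ j : Fin n, p j • e j = (n : ℝ) • p := by
    rw [he]; simp only [sum_basisFun_smul]; simp [← Nat.cast_smul_eq_nsmul ℝ]
  have h2 : ∑ i : Fin n, ∑ j : Fin n, p i • e i = (n : ℝ) • p := by
    rw [Finset.sum_comm, h1]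
  have h3 : ∑ i : Fin n, ∑ j : Fin n, (if i = j then (2 : ℝ) * p i else 0) • e i = (2 : ℝ) • p := by
    conv_rhs => rw [← sum_basisFun_smul p]
    simp [ite_smul, Finset.smul_sum, smul_smul, he]
  calc _ = ∑ i, ∑ j, ((if i = j then (2 : ℝ) * p i else 0) • e i - p j • e j - p i • e i) := by
        refine Finset.sum_congr rfl fun i _ => Finset.sum_congr rfl fun j _ => ?_
        by_cases hij : i = j
        · subst hij
          simp only [he, EuclideanSpace.basisFun_apply, sub_self, PiLp.zero_apply, zero_smul,
            if_true]
          module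
        · simp [he, hij, Ne.symm hij]
    _ = _ := by
        simp only [Finset.sum_sub_distrib, h1, h2, h3]
        module

/-- The Darboux equation: on integrals over a sphere centred at `x`, the Laplacian acts as its
radial part. -/
lemma darboux_sphere {g : Euc n → 𝕜} (hg : ContDiff ℝ 2 g) (x : Euc n) (s : ℝ) :
    ∫ p : Metric.sphere (0 : Euc n) 1, s • Laplacian.laplacian g (x + s • (p : Euc n))
        ∂sphereMeasure n =
      ∫ p : Metric.sphere (0 : Euc n) 1,
        (s • fderiv ℝ (fderiv ℝ g) (x + s • (p : Euc n)) p p +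
          ((n : ℝ) - 1) • fderiv ℝ g (x + s • (p : Euc n)) p) ∂sphereMeasure n := by
  set e := EuclideanSpace.basisFun (Fin n) ℝ with he
  have hD1 : ContDiff ℝ 1 (fderiv ℝ g) := hg.fderiv_right (by norm_num)
  have hD2 : Continuous (fderiv ℝ (fderiv ℝ g)) := hD1.continuous_fderiv (by simp)
  -- `A i j` generates the rotations of the plane of the coordinates `i` and `j`, and `Q i j` is its
  -- square applied to `p ↦ g (x + s p)`, up to a factor `s`.
  let A : Fin n → Fin n → Euc n →L[ℝ] Euc n := fun i j =>
    (EuclideanSpace.proj (𝕜 := ℝ) i).smulRight (e j) -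
      (EuclideanSpace.proj (𝕜 := ℝ) j).smulRight (e i)
  have hA : ∀ i j p, A i j p = p i • e j - p j • e i := fun i j p => rfl
  let Q : Fin n → Fin n → Euc n → 𝕜 := fun i j p =>
    s • fderiv ℝ (fderiv ℝ g) (x + s • p) (A i j p) (A i j p) +
      fderiv ℝ g (x + s • p) (A i j (A i j p))
  have hQc : ∀ i j, Continuous (Q i j) := fun i j => by
    have hc : Continuous fun p : Euc n => x + s • p := by fun_prop
    have h1 := hD2.comp hc
    have h2 := hD1.continuous.comp hc
    exact ((((h1.clm_apply (by fun_prop)).clm_apply (by fun_prop)).const_smul s)).add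
      (h2.clm_apply (by fun_prop))
  have hQ : ∀ i j, ∫ p : Metric.sphere (0 : Euc n) 1, Q i j p ∂sphereMeasure n = 0 := by
    intro i j
    by_cases hij : i = j
    · subst hij
      simp [Q, hA]
    · have hrot := integral_sphere_fderiv_rotation (n := n)
        (h := fun p => fderiv ℝ g (x + s • p) (A i j p))
        ((hD1.comp (by fun_prop)).clm_apply (by fun_prop)) (u := e i) (v := e j)
        (by simp) (by simp) (e.orthonormal.2 hij)
      rw [← hrot]
      refine integral_congr_ae (ae_of_all _ fun p => ?_)
      have hd : HasFDerivAt (fun p : Euc n => x + s • p) (s • ContinuousLinearMap.id ℝ (Euc n)) p :=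
        ((hasFDerivAt_id (p : Euc n)).const_smul s).const_add x
      have h1 := ((hD1.differentiable (by simp) (x + s • (p : Euc n))).hasFDerivAt.comp
        (p : Euc n) hd).clm_apply (A i j).hasFDerivAt
      simp only [Function.comp_def] at h1
      have e1 : inner ℝ (e i) (p : Euc n) = (p : Euc n) i := by
        simp [he, EuclideanSpace.inner_single_left]
      have e2 : inner ℝ (e j) (p : Euc n) = (p : Euc n) j := by
        simp [he, EuclideanSpace.inner_single_left]
      simp only [e1, e2, ← hA]
      rw [h1.fderiv]
      simp [Q, add_comm]
  have hsum : ∀ p : Metric.sphere (0 : Euc n) 1, ∑ i, ∑ j, Q i j p =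
      (2 : ℝ) • (s • Laplacian.laplacian g (x + s • (p : Euc n)) -
        (s • fderiv ℝ (fderiv ℝ g) (x + s • (p : Euc n)) p p +
          ((n : ℝ) - 1) • fderiv ℝ g (x + s • (p : Euc n)) p)) := by
    intro p
    have hp : ‖(p : Euc n)‖ = 1 := by simp
    simp only [Q, Finset.sum_add_distrib, ← Finset.smul_sum, ← map_sum, hA]
    rw [sum_rotation_sq _ hp, sum_rotation_rotation, laplacian_eq_sum_fderiv_fderiv g, map_smul]
    module
  have hzero : ∫ p : Metric.sphere (0 : Euc n) 1, ∑ i, ∑ j, Q i j p ∂sphereMeasure n = 0 := by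
    have hint : ∀ i j, Integrable (fun p : Metric.sphere (0 : Euc n) 1 => Q i j p)
      (sphereMeasure n) := fun i j => integrable_sphere ((hQc i j).comp continuous_subtype_val)
    rw [integral_finsetSum _ fun i _ => integrable_finsetSum _ fun j _ => hint i j]
    refine Finset.sum_eq_zero fun i _ => ?_
    rw [integral_finsetSum _ fun j _ => hint i j]
    exact Finset.sum_eq_zero fun j _ => hQ i j
  simp only [hsum] at hzero
  have hc : Continuous fun p : Metric.sphere (0 : Euc n) 1 => x + s • (p : Euc n) := by fun_prop
  have hc0 : Continuous fun p : Metric.sphere (0 : Euc n) 1 => (p : Euc n) := by fun_prop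
  rw [integral_smul, integral_sub, smul_eq_zero_iff_right two_ne_zero, sub_eq_zero] at hzero
  · exact hzero
  · refine integrable_sphere (Continuous.const_smul ?_ s)
    simp only [laplacian_eq_sum_fderiv_fderiv g]
    exact continuous_finsetSum _ fun i _ =>
      ((hD2.comp hc).clm_apply continuous_const).clm_apply continuous_const
  · exact integrable_sphere (((((hD2.comp hc).clm_apply hc0).clm_apply hc0).const_smul s).add
      (((hD1.continuous.comp hc).clm_apply hc0).const_smul _))

/-! ### Spherical means as smooth functions on the half-space -/

/-- Smooth functions on `ℝⁿ`. -/
abbrev SmoothData (𝕜 : Type*) [RCLike 𝕜] (n : ℕ) := {g : Euc n → 𝕜 // ContDiff ℝ ∞ g}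

/-- A family, indexed by `τ ≥ 0`, of functions of `x` that is jointly smooth in `(τ, x)`. -/
def IsJointlySmoothData (g : ℝ → SmoothData 𝕜 n) : Prop :=
  ContDiffOn ℝ ∞ (fun p : ℝ × Euc n => (g p.1).1 p.2) (Ici 0 ×ˢ univ)

lemma isJointlySmoothData_const (g : SmoothData 𝕜 n) : IsJointlySmoothData (fun _ => g) :=
  (g.2.comp contDiff_snd).contDiffOn

/-- The directional derivative of smooth data. -/
def SmoothData.dirDeriv (w : Euc n) (g : SmoothData 𝕜 n) : SmoothData 𝕜 n :=
  ⟨fun x => fderiv ℝ g.1 x w, (g.2.fderiv_right (by simp)).clm_apply contDiff_const⟩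

namespace IsJointlySmooth

variable {F G : ℝ → HalfSpaceFun 𝕜 n}

lemma add (hF : IsJointlySmooth F) (hG : IsJointlySmooth G) :
    IsJointlySmooth (fun τ => F τ + G τ) :=
  ContDiffOn.add hF hG

lemma const_smul (hF : IsJointlySmooth F) (c : ℝ) : IsJointlySmooth (fun τ => c • F τ) :=
  ContDiffOn.const_smul c hF

lemma sum {ι : Type*} {s : Finset ι} {F : ι → ℝ → HalfSpaceFun 𝕜 n}
    (hF : ∀ i ∈ s, IsJointlySmooth (F i)) : IsJointlySmooth (fun τ => ∑ i ∈ s, F i τ) := by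
  have := ContDiffOn.sum hF
  refine IsSmoothFamily.congr (F := fun τ x t => ∑ i ∈ s, (F i τ).1 x t) this
    fun τ _ x t _ => HalfSpaceFun.sum_coe s _ x t

lemma mulTime (hF : IsJointlySmooth F) :
    IsJointlySmooth (fun τ => HalfSpaceFun.mulTime (F τ)) :=
  ContDiffOn.smul (f := fun p : ℝ × Euc n × ℝ => p.2.2) (by fun_prop) hF

lemma prim (hF : IsJointlySmooth F) : IsJointlySmooth (fun τ => HalfSpaceFun.prim (F τ)) :=
  hF.weightedPrimitive

lemma dt (hF : IsJointlySmooth F) : IsJointlySmooth (fun τ => HalfSpaceFun.dt (F τ)) :=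
  IsSmoothFamily.dt hF (by simp)

lemma dirDeriv (hF : IsJointlySmooth F) (w : Euc n) :
    IsJointlySmooth (fun τ => HalfSpaceFun.dirDeriv w (F τ)) :=
  IsSmoothFamily.dirDeriv hF (by simp) w

lemma spaceOp (hF : IsJointlySmooth F) (a : ℝ) :
    IsJointlySmooth (fun τ => HalfSpaceFun.spaceOp a (F τ)) := by
  refine IsSmoothFamily.congr (IsSmoothFamily.spaceOp (l := ∞) hF (le_of_eq rfl) a)
    fun τ _ x t _ => ?_
  rw [HalfSpaceFun.coe_spaceOp]

lemma pow {A : Module.End ℝ (HalfSpaceFun 𝕜 n)}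
    (hA : ∀ F, IsJointlySmooth F → IsJointlySmooth (fun τ => A (F τ)))
    (hF : IsJointlySmooth F) (k : ℕ) : IsJointlySmooth (fun τ => (A ^ k) (F τ)) := by
  induction k with
  | zero => exact hF
  | succ k ih =>
    simp only [pow_succ', Module.End.mul_apply]
    exact hA _ ih

end IsJointlySmooth

lemma isSmoothFamily_ofData {g : ℝ → SmoothData 𝕜 n} (hg : IsJointlySmoothData g) :
    IsSmoothFamily ∞ (fun τ x (t : ℝ) => if 0 ≤ t then (g τ).1 x else 0) := by
  refine IsSmoothFamily.congr (F := fun τ x _ => (g τ).1 x) ?_ fun τ _ x t ht => if_pos ht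
  exact ContDiffOn.comp hg (f := fun p : ℝ × Euc n × ℝ => (p.1, p.2.1)) (by fun_prop)
    fun p hp => ⟨hp.1, mem_univ _⟩

/-- The normalisation `1 / (2 (2π)^(ν+1))` of the spherical means. -/
def meanConst (ν : ℕ) : ℝ := 1 / (2 * (2 * Real.pi) ^ (ν + 1))

lemma isSmoothFamily_mean (c a : ℝ) {g : ℝ → SmoothData 𝕜 n} (hg : IsJointlySmoothData g) :
    IsSmoothFamily ∞ (fun τ x (t : ℝ) => if 0 ≤ t then
      c • ∫ p : Metric.sphere (0 : Euc n) 1, (g τ).1 (x + (a * t) • (p : Euc n)) ∂sphereMeasure n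
      else 0) := by
  refine IsSmoothFamily.congr (F := fun τ x t => c • ∫ p : Metric.sphere (0 : Euc n) 1 in univ,
    (g τ).1 (x + (a * t) • (p : Euc n)) ∂sphereMeasure n) ?_ fun τ _ x t ht => ?_
  · refine ContDiffOn.const_smul c ?_
    refine contDiffOn_setIntegral_param (V := Euc n) (c := Subtype.val) (T := univ)
      (F := fun q : (ℝ × Euc n × ℝ) × Euc n => (g q.1.1).1 (q.1.2.1 + (a * q.1.2.2) • q.2))
      convex_paramHalfSpace isCompact_univ (uniqueDiffOn_paramHalfSpace.prod uniqueDiffOn_univ)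
      uniqueDiffOn_paramHalfSpace continuous_subtype_val (mapsTo_univ _ _) ?_
    exact ContDiffOn.comp hg (f := fun q : (ℝ × Euc n × ℝ) × Euc n =>
      (q.1.1, q.1.2.1 + (a * q.1.2.2) • q.2)) (by fun_prop) fun q hq => ⟨hq.1.1, mem_univ _⟩
  · rw [if_pos ht, Measure.restrict_univ]

namespace HalfSpaceFun

/-- A function of `x` as a function of `(x, t)` that does not depend on `t ≥ 0`. -/
def ofData (g : SmoothData 𝕜 n) : HalfSpaceFun 𝕜 n :=
  ⟨fun x t => if 0 ≤ t then g.1 x else 0, isSmoothFamily_ofData (isJointlySmoothData_const g),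
    fun _ _ ht => if_neg (not_le.2 ht)⟩

/-- The spherical mean over the sphere of radius `a t` as a function of `(x, t)`. It is smooth up to
`t = 0` because the sphere is parametrized by the unit sphere. -/
def mean (ν : ℕ) (a : ℝ) (g : SmoothData 𝕜 n) : HalfSpaceFun 𝕜 n :=
  ⟨fun x t => if 0 ≤ t then meanConst ν •
    ∫ p : Metric.sphere (0 : Euc n) 1, g.1 (x + (a * t) • (p : Euc n)) ∂sphereMeasure n else 0,
    isSmoothFamily_mean (meanConst ν) a (isJointlySmoothData_const g),
    fun _ _ ht => if_neg (not_le.2 ht)⟩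

lemma ofData_apply (g : SmoothData 𝕜 n) (x : Euc n) {t : ℝ} (ht : 0 ≤ t) :
    (ofData g).1 x t = g.1 x := if_pos ht

lemma mean_apply (ν : ℕ) (a : ℝ) (g : SmoothData 𝕜 n) (x : Euc n) {t : ℝ} (ht : 0 ≤ t) :
    (mean ν a g).1 x t = meanConst ν •
      ∫ p : Metric.sphere (0 : Euc n) 1, g.1 (x + (a * t) • (p : Euc n)) ∂sphereMeasure n :=
  if_pos ht

lemma dt_ofData (g : SmoothData 𝕜 n) : dt (ofData g) = 0 :=
  ext_of_nonneg fun x t ht => dt_apply_eq ht <|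
    (hasDerivWithinAt_const t _ (g.1 x)).congr (fun _ hs => ofData_apply g x hs)
      (ofData_apply g x ht)

lemma dirDeriv_mean (ν : ℕ) (a : ℝ) (g : SmoothData 𝕜 n) (w : Euc n) :
    dirDeriv w (mean ν a g) = mean ν a (g.dirDeriv w) := by
  refine ext_of_nonneg fun x t ht => ?_
  have hslice : (fun y => (mean ν a g).1 y t) = fun y => meanConst ν •
      ∫ p : Metric.sphere (0 : Euc n) 1 in univ, g.1 (y + (a * t) • (p : Euc n)) ∂sphereMeasure n :=
    funext fun y => by rw [mean_apply ν a g y ht, Measure.restrict_univ]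
  have hc : meanConst ν ≠ 0 := by unfold meanConst; positivity
  have hd : Differentiable ℝ fun y => ∫ p : Metric.sphere (0 : Euc n) 1 in univ,
      g.1 (y + (a * t) • (p : Euc n)) ∂sphereMeasure n := by
    have h := (((mean ν a g).contDiff_space t).differentiable (by simp)).fun_const_smul
      (meanConst ν)⁻¹
    simpa only [mean_apply ν a g _ ht, inv_smul_smul₀ hc, Measure.restrict_univ] using h
  have hg1 : ContDiff ℝ 1 g.1 := g.2.of_le (by simp)
  have hgd := hg1.differentiable (by simp)
  have hslice' : ∀ (ξ : Metric.sphere (0 : Euc n) 1) y,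
      HasFDerivAt (fun y => g.1 (y + (a * t) • (ξ : Euc n)))
        (fderiv ℝ g.1 (y + (a * t) • (ξ : Euc n))) y := fun ξ y =>
    (hasFDerivAt_comp_add_right _).2 (hgd _).hasFDerivAt
  rw [mean_apply ν a _ x ht]
  change fderiv ℝ (fun y => (mean ν a g).1 y t) x w = _
  rw [hslice, fderiv_fun_const_smul (hd x), _root_.smul_apply,
    fderiv_setIntegral_apply (H := fun y (p : Metric.sphere (0 : Euc n) 1) =>
      g.1 (y + (a * t) • (p : Euc n))) isCompact_univ ?_ ?_ ?_ (hd x), Measure.restrict_univ]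
  · simp only [(hslice' _ _).fderiv]
    rfl
  · exact (g.2.continuous.comp (by fun_prop)).continuousOn
  · simp only [(hslice' _ _).fderiv]
    exact (((hg1.continuous_fderiv (by simp)).comp (by fun_prop)).clm_apply
      continuous_const).continuousOn
  · exact fun ξ _ y => (hslice' ξ y).differentiableAt

lemma spaceOp_mean (ν : ℕ) (a : ℝ) (g : SmoothData 𝕜 n) (x : Euc n) {t : ℝ} (ht : 0 ≤ t) :
    (spaceOp a (mean ν a g)).1 x t = a ^ 2 • meanConst ν • ∫ p : Metric.sphere (0 : Euc n) 1,
      Laplacian.laplacian g.1 (x + (a * t) • (p : Euc n)) ∂sphereMeasure n := by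
  rw [spaceOp_apply_eq_sum]
  simp only [dirDeriv_mean, mean_apply _ _ _ _ ht, laplacian_eq_sum (g.2.of_le two_le_infty)]
  rw [integral_finsetSum, ← Finset.smul_sum]
  · rfl
  · intro i _
    refine integrable_sphere ?_
    exact (((g.dirDeriv (EuclideanSpace.basisFun (Fin n) ℝ i)).dirDeriv
      (EuclideanSpace.basisFun (Fin n) ℝ i)).2.continuous).comp (by fun_prop)

section MeanTime

variable (ν : ℕ) (a : ℝ) (g : SmoothData 𝕜 n) (x : Euc n)

lemma dt_mean {t : ℝ} (ht : 0 ≤ t) :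
    (dt (mean ν a g)).1 x t = meanConst ν • ∫ p : Metric.sphere (0 : Euc n) 1,
      a • fderiv ℝ g.1 (x + (a * t) • (p : Euc n)) p ∂sphereMeasure n := by
  have hg1 : ContDiff ℝ 1 g.1 := g.2.of_le (by simp)
  have h := hasDerivWithinAt_setIntegral_param (μ := sphereMeasure n) (S := Ici 0) (K := univ)
    (F := fun s (p : Metric.sphere (0 : Euc n) 1) => g.1 (x + (a * s) • (p : Euc n)))
    (F' := fun s p => a • fderiv ℝ g.1 (x + (a * s) • (p : Euc n)) p) (y := t)
    (convex_Ici 0) isCompact_univ (g.2.continuous.comp (by fun_prop)).continuousOn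
    ((((hg1.continuous_fderiv (by simp)).comp (by fun_prop)).clm_apply
      (by fun_prop)).const_smul a).continuousOn
    (fun s _ p _ => ?_) ht
  · rw [Measure.restrict_univ] at h
    exact dt_apply_eq ht ((h.const_smul (meanConst ν)).congr
      (fun s hs => mean_apply ν a g x hs) (mean_apply ν a g x ht))
  · have hline : HasDerivAt (fun s : ℝ => x + (a * s) • (p : Euc n)) (a • (p : Euc n)) s := by
      simpa using (((hasDerivAt_id s).const_mul a).smul_const (p : Euc n)).const_add x
    have := HasFDerivAt.comp_hasDerivAt (l := g.1) s
      (hg1.differentiable (by simp) _).hasFDerivAt hline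
    rw [map_smul] at this
    exact this.hasDerivWithinAt

lemma dt_dt_mean {t : ℝ} (ht : 0 ≤ t) :
    (dt (dt (mean ν a g))).1 x t = meanConst ν • ∫ p : Metric.sphere (0 : Euc n) 1,
      a • a • fderiv ℝ (fderiv ℝ g.1) (x + (a * t) • (p : Euc n)) p p ∂sphereMeasure n := by
  have hg1 : ContDiff ℝ 1 (fderiv ℝ g.1) :=
    g.2.fderiv_right (one_add_one_eq_two.trans_le two_le_infty)
  have h := hasDerivWithinAt_setIntegral_param (μ := sphereMeasure n) (S := Ici 0) (K := univ)
    (F := fun s (p : Metric.sphere (0 : Euc n) 1) =>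
      a • fderiv ℝ g.1 (x + (a * s) • (p : Euc n)) (p : Euc n))
    (F' := fun s p => a • a • fderiv ℝ (fderiv ℝ g.1) (x + (a * s) • (p : Euc n)) p p) (y := t)
    (convex_Ici 0) isCompact_univ
    (((hg1.continuous.comp (by fun_prop)).clm_apply (by fun_prop)).const_smul a).continuousOn
    (((((hg1.continuous_fderiv (by simp)).comp (by fun_prop)).clm_apply
      (by fun_prop)).clm_apply (by fun_prop)).const_smul a |>.const_smul a).continuousOn
    (fun s _ p _ => ?_) ht
  · rw [Measure.restrict_univ] at h
    exact dt_apply_eq ht ((h.const_smul (meanConst ν)).congr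
      (fun s hs => dt_mean ν a g x hs) (dt_mean ν a g x ht))
  · have hline : HasDerivAt (fun s : ℝ => x + (a * s) • (p : Euc n)) (a • (p : Euc n)) s := by
      simpa using (((hasDerivAt_id s).const_mul a).smul_const (p : Euc n)).const_add x
    have := (HasFDerivAt.comp_hasDerivAt (l := fderiv ℝ g.1) s
      (hg1.differentiable (by simp) _).hasFDerivAt hline).clm_apply (hasDerivAt_const s (p : Euc n))
    simp only [map_smul, map_zero, add_zero, _root_.smul_apply] at this
    exact (this.const_smul a).hasDerivWithinAt

end MeanTime

/-- The Darboux equation `t ∂ₜ² M + (n - 1) ∂ₜ M = t a² Δ M` for the spherical mean `M`. -/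
lemma darboux_mean (ν : ℕ) (a : ℝ) (g : SmoothData 𝕜 n) :
    mulTime (dt (dt (mean ν a g))) + ((n : ℝ) - 1) • dt (mean ν a g) =
      mulTime (spaceOp a (mean ν a g)) := by
  refine ext_of_nonneg fun x t ht => ?_
  have hg1 : ContDiff ℝ 1 (fderiv ℝ g.1) :=
    g.2.fderiv_right (one_add_one_eq_two.trans_le two_le_infty)
  have h := congrArg (fun z => (meanConst ν * a) • z)
    (darboux_sphere (g.2.of_le two_le_infty) x (a * t))
  simp only [Submodule.coe_add, Pi.add_apply, Submodule.coe_smul, Pi.smul_apply, mulTime_apply,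
    dt_mean ν a g x ht, dt_dt_mean ν a g x ht, spaceOp_mean ν a g x ht] at h ⊢
  rw [integral_add, integral_smul, integral_smul, integral_smul] at h
  · simp only [integral_smul]
    simp only [smul_smul, smul_add] at h ⊢
    rw [show t * (a ^ 2 * meanConst ν) = meanConst ν * a * (a * t) by ring, h]
    congr 2 <;> ring
  · refine integrable_sphere (Continuous.const_smul ?_ _)
    exact (((hg1.continuous_fderiv (by simp)).comp (by fun_prop)).clm_apply
      (by fun_prop)).clm_apply (by fun_prop)
  · refine integrable_sphere (Continuous.const_smul ?_ _)
    exact (hg1.continuous.comp (by fun_prop)).clm_apply (by fun_prop)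

/-- The value at `t = 0` is not `g` itself, since the normalization of the spherical means is not by
the area of the sphere. -/
lemma mean_apply_zero {ν : ℕ} (hn : n = 2 * ν + 3) (a : ℝ) (g : SmoothData 𝕜 n) (x : Euc n) :
    (mean ν a g).1 x 0 = (1 / (Nat.doubleFactorial (2 * ν + 1) : ℝ)) • g.1 x := by
  subst hn
  rw [mean_apply ν a g x le_rfl]
  simp only [mul_zero, zero_smul, add_zero, integral_const, real_sphereMeasure_univ, smul_smul,
    meanConst]
  congr 1
  have : Real.pi ≠ 0 := Real.pi_ne_zero
  field_simp

end HalfSpaceFun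

/-! ### The fundamental solutions of the iterated wave operator -/

namespace HalfSpaceFun

/-- The wave operator `∂ₜ² - a² Δ` as an endomorphism. -/
def box (a : ℝ) : Module.End ℝ (HalfSpaceFun 𝕜 n) := dt * dt - spaceOp a

lemma box_apply (a : ℝ) (u : HalfSpaceFun 𝕜 n) : box a u = dt (dt u) - spaceOp a u := rfl

lemma spaceOp_prim (a : ℝ) (u : HalfSpaceFun 𝕜 n) :
    spaceOp a (prim u) = prim (spaceOp a u) :=
  (congrArg (fun l => l u) (commute_prim_spaceOp (𝕜 := 𝕜) (n := n) a).eq).symm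

lemma spaceOp_mulTime (a : ℝ) (u : HalfSpaceFun 𝕜 n) :
    spaceOp a (mulTime u) = mulTime (spaceOp a u) :=
  (congrArg (fun l => l u) (commute_mulTime_spaceOp (𝕜 := 𝕜) (n := n) a).eq).symm

lemma spaceOp_dt (a : ℝ) (u : HalfSpaceFun 𝕜 n) : spaceOp a (dt u) = dt (spaceOp a u) :=
  (congrArg (fun l => l u) (commute_dt_spaceOp (𝕜 := 𝕜) (n := n) a).eq).symm

lemma commute_pow_apply {A B : Module.End ℝ (HalfSpaceFun 𝕜 n)} (h : Commute A B) (k : ℕ)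
    (u : HalfSpaceFun 𝕜 n) : (A ^ k) (B u) = B ((A ^ k) u) :=
  congrArg (fun l => l u) (h.pow_left k).eq

lemma pow_succ_apply (A : Module.End ℝ (HalfSpaceFun 𝕜 n)) (k : ℕ) (u : HalfSpaceFun 𝕜 n) :
    (A ^ (k + 1)) u = A ((A ^ k) u) := by
  rw [pow_succ', Module.End.mul_apply]

lemma dt_mulTime_pow (k : ℕ) {u : HalfSpaceFun 𝕜 n} (hu : dt u = 0) :
    dt ((mulTime ^ (k + 1)) u) = ((k : ℝ) + 1) • (mulTime ^ k) u := by
  induction k with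
  | zero => simp [dt_mulTime, hu]
  | succ k ih =>
    rw [pow_succ_apply, dt_mulTime, ih, map_smul, ← pow_succ_apply]
    push_cast
    module

lemma add_apply (u v : HalfSpaceFun 𝕜 n) (x : Euc n) (t : ℝ) :
    (u + v).1 x t = u.1 x t + v.1 x t := rfl

lemma sub_apply (u v : HalfSpaceFun 𝕜 n) (x : Euc n) (t : ℝ) :
    (u - v).1 x t = u.1 x t - v.1 x t := rfl

lemma smul_apply (c : ℝ) (u : HalfSpaceFun 𝕜 n) (x : Euc n) (t : ℝ) :
    (c • u).1 x t = c • u.1 x t := rfl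

lemma zero_apply (x : Euc n) (t : ℝ) : (0 : HalfSpaceFun 𝕜 n).1 x t = 0 := rfl

lemma mulTime_pow_succ_apply_zero (k : ℕ) (u : HalfSpaceFun 𝕜 n) (x : Euc n) :
    ((mulTime ^ (k + 1)) u).1 x 0 = 0 := by
  rw [pow_succ_apply, mulTime_apply_zero]

lemma mulTime_pow_apply (k : ℕ) (u : HalfSpaceFun 𝕜 n) (x : Euc n) (t : ℝ) :
    ((mulTime ^ k) u).1 x t = t ^ k • u.1 x t := by
  induction k with
  | zero => simp
  | succ k ih => rw [pow_succ_apply, mulTime_apply, ih, smul_smul, pow_succ']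

/-- The equation satisfied by the `j`-fold weighted primitive of the spherical mean: each weighted
primitive lowers the coefficient of the radial derivative by two. -/
lemma radial_prim_mean {ν : ℕ} (hn : n = 2 * ν + 3) (a : ℝ) (g : SmoothData 𝕜 n) (j : ℕ) :
    mulTime (dt ((prim ^ j) (mean ν a g))) + (2 * (ν : ℝ) + 1 - 2 * j) • (prim ^ j) (mean ν a g) =
      spaceOp a (prim ((prim ^ j) (mean ν a g))) +
        ((2 * (ν : ℝ) + 1) / ((Nat.doubleFactorial (2 * ν + 1) : ℝ) *
          (Nat.doubleFactorial (2 * j) : ℝ))) • (mulTime ^ (2 * j)) (ofData g) := by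
  induction j with
  | zero =>
    refine eq_of_dt_eq ?_ fun x => ?_
    · have h := darboux_mean ν a g
      simp only [pow_zero, Module.End.one_apply, map_add, map_smul, dt_mulTime, ← spaceOp_dt,
        dt_prim, mul_zero, dt_ofData, smul_zero, add_zero, spaceOp_mulTime]
      have hn' : (n : ℝ) = 2 * ν + 3 := by exact_mod_cast hn
      rw [← h, hn']
      push_cast
      module
    · simp only [pow_zero, Module.End.one_apply, mul_zero, add_apply, mulTime_apply_zero, zero_add,
        smul_apply, mean_apply_zero hn, spaceOp_prim, prim_apply_zero, ofData_apply g x le_rfl,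
        smul_smul]
      congr 1
      simp
      ring
  | succ j ih =>
    set W := (prim ^ j) (mean ν a g) with hW
    refine eq_of_dt_eq ?_ fun x => ?_
    · have h := congrArg mulTime ih
      have e1 : dt ((mulTime ^ (2 * (j + 1))) (ofData g)) =
          ((2 * j + 1 : ℕ) + 1 : ℝ) • (mulTime ^ (2 * j + 1)) (ofData g) :=
        dt_mulTime_pow (2 * j + 1) (dt_ofData g)
      have e2 : (Nat.doubleFactorial (2 * (j + 1)) : ℝ) =
          (2 * j + 2) * (Nat.doubleFactorial (2 * j) : ℝ) := by
        rw [show 2 * (j + 1) = 2 * j + 2 by ring, Nat.doubleFactorial_add_two]; push_cast; ring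
      simp only [pow_succ_apply prim, ← hW, dt_prim, map_add, map_smul, dt_mulTime, ← spaceOp_dt,
        e1, e2, spaceOp_mulTime, smul_smul] at h ⊢
      rw [pow_succ_apply]
      have e3 : (2 * (ν : ℝ) + 1) / ((Nat.doubleFactorial (2 * ν + 1) : ℝ) *
          ((2 * j + 2) * (Nat.doubleFactorial (2 * j) : ℝ))) * ((2 * j + 1 : ℕ) + 1 : ℝ) =
          (2 * (ν : ℝ) + 1) / ((Nat.doubleFactorial (2 * ν + 1) : ℝ) *
            (Nat.doubleFactorial (2 * j) : ℝ)) := by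
        have : (2 * (j : ℝ) + 2) ≠ 0 := by positivity
        have h1 : (Nat.doubleFactorial (2 * j) : ℝ) ≠ 0 := by
          exact_mod_cast (Nat.doubleFactorial_pos _).ne'
        have h2 : (Nat.doubleFactorial (2 * ν + 1) : ℝ) ≠ 0 := by
          exact_mod_cast (Nat.doubleFactorial_pos _).ne'
        push_cast
        field_simp
        ring
      rw [e3, ← h]
      push_cast
      module
    · rw [pow_succ_apply, ← hW]
      simp only [add_apply, smul_apply, mulTime_apply_zero, prim_apply_zero, spaceOp_prim,
        show 2 * (j + 1) = 2 * j + 1 + 1 by ring, mulTime_pow_succ_apply_zero, smul_zero]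

lemma dt_spaceOp_pow_ofData (a : ℝ) (g : SmoothData 𝕜 n) (i : ℕ) :
    dt ((spaceOp a ^ i) (ofData g)) = 0 := by
  rw [← commute_pow_apply (commute_dt_spaceOp a).symm, dt_ofData, map_zero]

/-- The solution of the wave equation with vanishing initial value and initial velocity `g`. -/
def waveSol (ν : ℕ) (a : ℝ) (g : SmoothData 𝕜 n) : HalfSpaceFun 𝕜 n :=
  (spaceOp a ^ ν) (mulTime ((prim ^ ν) (mean ν a g))) +
    ∑ i ∈ Finset.range ν, (1 / (Nat.factorial (2 * i + 1) : ℝ)) •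
      (mulTime ^ (2 * i + 1)) ((spaceOp a ^ i) (ofData g))

/-- For `j = ν` the coefficient of the radial term in `radial_prim_mean` is one, so the equation
there expresses `∂ₜ (t J^ν M)`, where `M` is the spherical mean and `J` the weighted primitive. -/
lemma dt_waveSol {ν : ℕ} (hn : n = 2 * ν + 3) (a : ℝ) (g : SmoothData 𝕜 n) :
    dt (waveSol ν a g) = (spaceOp a ^ (ν + 1)) (prim ((prim ^ ν) (mean ν a g))) +
      ∑ i ∈ Finset.range (ν + 1), (1 / (Nat.factorial (2 * i) : ℝ)) •
        (mulTime ^ (2 * i)) ((spaceOp a ^ i) (ofData g)) := by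
  have h := radial_prim_mean hn a g ν
  rw [show 2 * (ν : ℝ) + 1 - 2 * ν = 1 by ring, one_smul] at h
  have hc : (2 * (ν : ℝ) + 1) / ((Nat.doubleFactorial (2 * ν + 1) : ℝ) *
      (Nat.doubleFactorial (2 * ν) : ℝ)) = 1 / (Nat.factorial (2 * ν) : ℝ) := by
    have h1 : (Nat.factorial (2 * ν) : ℝ) ≠ 0 := by exact_mod_cast (Nat.factorial_pos _).ne'
    rw [← Nat.cast_mul, ← Nat.factorial_eq_mul_doubleFactorial, Nat.factorial_succ]
    push_cast
    field_simp
  rw [hc] at h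
  rw [waveSol, map_add, map_sum, ← commute_pow_apply (commute_dt_spaceOp a).symm, dt_mulTime, h,
    map_add, map_smul, Finset.sum_range_succ, ← Module.End.mul_apply, ← pow_succ,
    commute_pow_apply ((commute_mulTime_spaceOp a).symm.pow_right _)]
  have e : ∀ i ∈ Finset.range ν, dt ((1 / (Nat.factorial (2 * i + 1) : ℝ)) •
      (mulTime ^ (2 * i + 1)) ((spaceOp a ^ i) (ofData g))) =
      (1 / (Nat.factorial (2 * i) : ℝ)) • (mulTime ^ (2 * i)) ((spaceOp a ^ i) (ofData g)) := by
    intro i _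
    rw [map_smul, dt_mulTime_pow _ (dt_spaceOp_pow_ofData a g i), smul_smul]
    congr 1
    have h1 : (Nat.factorial (2 * i) : ℝ) ≠ 0 := by exact_mod_cast (Nat.factorial_pos _).ne'
    rw [Nat.factorial_succ]
    push_cast
    field_simp
  rw [Finset.sum_congr rfl e]
  abel

lemma box_waveSol {ν : ℕ} (hn : n = 2 * ν + 3) (a : ℝ) (g : SmoothData 𝕜 n) :
    box a (waveSol ν a g) = 0 := by
  rw [box_apply, dt_waveSol hn, sub_eq_zero, waveSol, map_add, map_add, map_sum, map_sum,
    ← commute_pow_apply (commute_dt_spaceOp a).symm, dt_prim, pow_succ_apply,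
    Finset.sum_range_succ']
  congr 1
  simp only [mul_zero, pow_zero, Module.End.one_apply, map_smul, dt_ofData, smul_zero, add_zero]
  refine Finset.sum_congr rfl fun i _ => ?_
  rw [show 2 * (i + 1) = 2 * i + 1 + 1 by ring, dt_mulTime_pow _ (dt_spaceOp_pow_ofData a g _),
    pow_succ_apply (spaceOp a), ← commute_pow_apply (commute_mulTime_spaceOp a), smul_smul]
  congr 1
  have h1 : (Nat.factorial (2 * i + 1) : ℝ) ≠ 0 := by exact_mod_cast (Nat.factorial_pos _).ne'
  rw [Nat.factorial_succ (2 * i + 1)]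
  push_cast
  field_simp

lemma spaceOp_apply_zero (a : ℝ) {u : HalfSpaceFun 𝕜 n} (h : ∀ x, u.1 x 0 = 0) (x : Euc n) :
    (spaceOp a u).1 x 0 = 0 := by
  rw [coe_spaceOp, MultiWave.spaceOp, scaledLaplacian]
  simp only [h]
  simp [InnerProductSpace.laplacian_const]

lemma spaceOp_pow_apply_zero (a : ℝ) {u : HalfSpaceFun 𝕜 n} (h : ∀ x, u.1 x 0 = 0) (k : ℕ)
    (x : Euc n) : ((spaceOp a ^ k) u).1 x 0 = 0 := by
  induction k generalizing x with
  | zero => exact h x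
  | succ k ih => rw [pow_succ_apply]; exact spaceOp_apply_zero a ih x

lemma waveSol_apply_zero (ν : ℕ) (a : ℝ) (g : SmoothData 𝕜 n) (x : Euc n) :
    (waveSol ν a g).1 x 0 = 0 := by
  rw [waveSol, add_apply, spaceOp_pow_apply_zero a (mulTime_apply_zero _), sum_coe, zero_add]
  exact Finset.sum_eq_zero fun i _ => by
    rw [smul_apply, mulTime_pow_succ_apply_zero, smul_zero]

lemma dt_waveSol_apply_zero {ν : ℕ} (hn : n = 2 * ν + 3) (a : ℝ) (g : SmoothData 𝕜 n)
    (x : Euc n) : (dt (waveSol ν a g)).1 x 0 = g.1 x := by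
  rw [dt_waveSol hn, add_apply, spaceOp_pow_apply_zero a (prim_apply_zero _), zero_add, sum_coe,
    Finset.sum_range_succ', Finset.sum_eq_zero fun i _ => ?_]
  · simp [ofData_apply]
  · rw [smul_apply, show 2 * (i + 1) = 2 * i + 1 + 1 by ring, mulTime_pow_succ_apply_zero,
      smul_zero]

/-- The commutator of the wave operator and the weighted primitive. -/
lemma box_prim (a : ℝ) {u : HalfSpaceFun 𝕜 n} (hu : ∀ x, u.1 x 0 = 0) :
    box a (prim u) = (2 : ℝ) • u + prim (box a u) := by
  have h : prim (dt (dt u)) = mulTime (dt u) - u := by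
    refine eq_of_dt_eq ?_ fun x => ?_
    · rw [dt_prim, map_sub, dt_mulTime]; abel
    · rw [prim_apply_zero, sub_apply, mulTime_apply_zero, hu, sub_zero]
  rw [box_apply, box_apply, dt_prim, dt_mulTime, map_sub, h, spaceOp_prim]
  module

/-- The solution of `(∂ₜ² - a² Δ)^(k+1) u = 0` whose time derivatives at `t = 0` of order at most
`2k + 1` vanish, except that the derivative of order `2k + 1` is `g`. By `box_prim`, each weighted
primitive raises the order by one, and the double factorial compensates the constants. -/
def fundSol (ν : ℕ) (a : ℝ) (k : ℕ) (g : SmoothData 𝕜 n) : HalfSpaceFun 𝕜 n :=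
  (1 / (Nat.doubleFactorial (2 * k) : ℝ)) • (prim ^ k) (waveSol ν a g)

lemma prim_pow_waveSol_apply_zero (ν : ℕ) (a : ℝ) (g : SmoothData 𝕜 n) (k : ℕ) (x : Euc n) :
    ((prim ^ k) (waveSol ν a g)).1 x 0 = 0 := by
  cases k with
  | zero => exact waveSol_apply_zero ν a g x
  | succ k => rw [pow_succ_apply, prim_apply_zero]

lemma fundSol_apply_zero (ν : ℕ) (a : ℝ) (k : ℕ) (g : SmoothData 𝕜 n) (x : Euc n) :
    (fundSol ν a k g).1 x 0 = 0 := by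
  rw [fundSol, smul_apply, prim_pow_waveSol_apply_zero, smul_zero]

lemma box_prim_pow_waveSol {ν : ℕ} (hn : n = 2 * ν + 3) (a : ℝ) (g : SmoothData 𝕜 n) (k : ℕ) :
    box a ((prim ^ (k + 1)) (waveSol ν a g)) = (2 * (k : ℝ) + 2) • (prim ^ k) (waveSol ν a g) := by
  induction k with
  | zero =>
    rw [pow_succ_apply, box_prim a (prim_pow_waveSol_apply_zero ν a g 0), pow_zero,
      Module.End.one_apply, box_waveSol hn]
    simp
  | succ k ih =>
    rw [pow_succ_apply, box_prim a (prim_pow_waveSol_apply_zero ν a g (k + 1)), ih, map_smul,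
      ← pow_succ_apply]
    push_cast
    module

lemma fundSol_zero (ν : ℕ) (a : ℝ) (g : SmoothData 𝕜 n) : fundSol ν a 0 g = waveSol ν a g := by
  simp [fundSol]

lemma box_fundSol_zero {ν : ℕ} (hn : n = 2 * ν + 3) (a : ℝ) (g : SmoothData 𝕜 n) :
    box a (fundSol ν a 0 g) = 0 := by
  rw [fundSol_zero, box_waveSol hn]

lemma box_fundSol_succ {ν : ℕ} (hn : n = 2 * ν + 3) (a : ℝ) (k : ℕ) (g : SmoothData 𝕜 n) :
    box a (fundSol ν a (k + 1) g) = fundSol ν a k g := by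
  rw [fundSol, fundSol, map_smul, box_prim_pow_waveSol hn, smul_smul]
  congr 1
  have h1 : (Nat.doubleFactorial (2 * k) : ℝ) ≠ 0 := by
    exact_mod_cast (Nat.doubleFactorial_pos _).ne'
  rw [show 2 * (k + 1) = 2 * k + 2 by ring, Nat.doubleFactorial_add_two]
  push_cast
  field_simp

lemma box_pow_fundSol {ν : ℕ} (hn : n = 2 * ν + 3) (a : ℝ) (k : ℕ) (g : SmoothData 𝕜 n) :
    (box a ^ (k + 1)) (fundSol ν a k g) = 0 := by
  induction k with
  | zero => simp [box_fundSol_zero hn]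
  | succ k ih => rw [pow_succ, Module.End.mul_apply, box_fundSol_succ hn, ih]

lemma dt_fundSol_succ_apply_zero (ν : ℕ) (a : ℝ) (k : ℕ) (g : SmoothData 𝕜 n) (x : Euc n) :
    (dt (fundSol ν a (k + 1) g)).1 x 0 = 0 := by
  rw [fundSol, map_smul, smul_apply, pow_succ_apply, dt_prim, mulTime_apply_zero, smul_zero]

/-- Two time derivatives are traded for the wave operator and `a² Δ`. -/
lemma dt_pow_add_two (a : ℝ) (u : HalfSpaceFun 𝕜 n) (r : ℕ) :
    (dt ^ (r + 2)) u = (dt ^ r) (box a u) + spaceOp a ((dt ^ r) u) := by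
  rw [← commute_pow_apply (commute_dt_spaceOp a), ← map_add, box_apply, sub_add_cancel, pow_add]
  rfl

/-- Vanishing of the initial derivatives passes from `(∂ₜ² - a² Δ) u` to `u`. -/
lemma dt_pow_apply_zero_of_box (a : ℝ) {u : HalfSpaceFun 𝕜 n} {N : ℕ}
    (h0 : ∀ x, u.1 x 0 = 0) (h1 : ∀ x, (dt u).1 x 0 = 0)
    (h : ∀ r < N, ∀ x, ((dt ^ r) (box a u)).1 x 0 = 0) :
    ∀ r < N + 2, ∀ x, ((dt ^ r) u).1 x 0 = 0 := by
  intro r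
  induction r using Nat.strong_induction_on with
  | _ r ih =>
    intro hr x
    match r, ih, hr with
    | 0, _, _ => exact h0 x
    | 1, _, _ => simpa using h1 x
    | r + 2, ih, hr =>
      rw [dt_pow_add_two a, add_apply, h r (by omega),
        spaceOp_apply_zero a (ih r (by omega) (by omega)), add_zero]

lemma dt_pow_fundSol_apply_zero {ν : ℕ} (hn : n = 2 * ν + 3) (a : ℝ) (k : ℕ) (g : SmoothData 𝕜 n) :
    (∀ r < 2 * k + 1, ∀ x, ((dt ^ r) (fundSol ν a k g)).1 x 0 = 0) ∧
      ∀ x, ((dt ^ (2 * k + 1)) (fundSol ν a k g)).1 x 0 = g.1 x := by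
  induction k with
  | zero =>
    refine ⟨fun r hr x => ?_, fun x => ?_⟩
    · rw [show r = 0 by omega, pow_zero, Module.End.one_apply, fundSol_apply_zero]
    · rw [fundSol_zero, mul_zero, zero_add, pow_one, dt_waveSol_apply_zero hn]
  | succ k ih =>
    have h := dt_pow_apply_zero_of_box a (u := fundSol ν a (k + 1) g) (N := 2 * k + 1)
      (fundSol_apply_zero ν a _ g) (dt_fundSol_succ_apply_zero ν a k g)
      (by simpa only [box_fundSol_succ hn] using ih.1)
    refine ⟨h, fun x => ?_⟩
    rw [show 2 * (k + 1) + 1 = 2 * k + 1 + 2 by ring, dt_pow_add_two a, add_apply,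
      box_fundSol_succ hn, ih.2, spaceOp_apply_zero a (h (2 * k + 1) (by omega)), add_zero]

lemma isJointlySmooth_fundSol (ν : ℕ) (a : ℝ) (k : ℕ) {g : ℝ → SmoothData 𝕜 n}
    (hg : IsJointlySmoothData g) : IsJointlySmooth (fun τ => fundSol ν a k (g τ)) := by
  have hmean : IsJointlySmooth (fun τ => mean ν a (g τ)) := isSmoothFamily_mean _ a hg
  have hdata : IsJointlySmooth (fun τ => ofData (g τ)) := isSmoothFamily_ofData hg
  have hL : ∀ F : ℝ → HalfSpaceFun 𝕜 n, IsJointlySmooth F →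
      IsJointlySmooth (fun τ => spaceOp a (F τ)) := fun _ hF => hF.spaceOp a
  have hP : ∀ F : ℝ → HalfSpaceFun 𝕜 n, IsJointlySmooth F →
      IsJointlySmooth (fun τ => prim (F τ)) := fun _ hF => hF.prim
  have hX : ∀ F : ℝ → HalfSpaceFun 𝕜 n, IsJointlySmooth F →
      IsJointlySmooth (fun τ => mulTime (F τ)) := fun _ hF => hF.mulTime
  refine ((IsJointlySmooth.add ?_ ?_).pow hP k).const_smul _
  · exact (hmean.pow hP ν).mulTime.pow hL ν
  · exact IsJointlySmooth.sum fun i _ => ((hdata.pow hL i).pow hX _).const_smul _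

end HalfSpaceFun

/-! ### Duhamel integrals -/

namespace HalfSpaceFun

variable {F : ℝ → HalfSpaceFun 𝕜 n}

lemma isSmoothFamily_duhamel (hF : IsJointlySmooth F) :
    IsSmoothFamily ∞ (fun _ x t => ∫ τ in (0 : ℝ)..t, (F τ).1 x (t - τ)) := by
  refine IsSmoothFamily.congr (F := fun _ x t => t • ∫ θ in Icc (0 : ℝ) 1,
    (F (t * θ)).1 x (t - t * θ)) ?_ fun _ _ x t _ =>
      intervalIntegral_eq_smul_setIntegral (fun τ => (F τ).1 x (t - τ)) t
  refine ContDiffOn.smul (f := fun p : ℝ × Euc n × ℝ => p.2.2) (by fun_prop) ?_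
  refine contDiffOn_setIntegral_param (V := ℝ) (c := id) (T := Icc 0 1)
    (F := fun q : (ℝ × Euc n × ℝ) × ℝ => (F (q.1.2.2 * q.2)).1 q.1.2.1 (q.1.2.2 - q.1.2.2 * q.2))
    convex_paramHalfSpace isCompact_Icc
    (uniqueDiffOn_paramHalfSpace.prod (uniqueDiffOn_Icc one_pos)) uniqueDiffOn_paramHalfSpace
    continuous_id (mapsTo_id _) ?_
  refine ContDiffOn.comp hF (f := fun q : (ℝ × Euc n × ℝ) × ℝ =>
    (q.1.2.2 * q.2, q.1.2.1, q.1.2.2 - q.1.2.2 * q.2)) (by fun_prop) fun q hq => ?_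
  have h1 : 0 ≤ q.1.2.2 := hq.1.2.2
  refine ⟨mul_nonneg h1 hq.2.1, mem_univ _, ?_⟩
  have := mul_le_mul_of_nonneg_left hq.2.2 h1
  simp only [mem_Ici]
  linarith

/-- The Duhamel integral `∫₀ᵗ F_τ(x, t - τ) dτ` of a jointly smooth family. -/
def duhamel (F : ℝ → HalfSpaceFun 𝕜 n) (hF : IsJointlySmooth F) : HalfSpaceFun 𝕜 n :=
  ⟨fun x t => ∫ τ in (0 : ℝ)..t, (F τ).1 x (t - τ), isSmoothFamily_duhamel hF, fun x t ht => by
    beta_reduce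
    rw [intervalIntegral.integral_symm, intervalIntegral.integral_of_le ht.le,
      integral_Ioc_eq_integral_Ioo, setIntegral_congr_fun (g := fun _ => 0) measurableSet_Ioo]
    · simp
    · exact fun s hs => (F s).apply_of_neg x (by linarith [hs.1])⟩

lemma duhamel_apply (hF : IsJointlySmooth F) (x : Euc n) (t : ℝ) :
    (duhamel F hF).1 x t = ∫ τ in (0 : ℝ)..t, (F τ).1 x (t - τ) := rfl

lemma duhamel_apply_zero (hF : IsJointlySmooth F) (x : Euc n) : (duhamel F hF).1 x 0 = 0 := by
  simp [duhamel_apply]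

lemma continuousOn_duhamel_integrand (hF : IsJointlySmooth F) (t : ℝ) :
    ContinuousOn (fun p : Euc n × ℝ => (F p.2).1 p.1 (t - p.2)) (univ ×ˢ Icc 0 t) :=
  (ContDiffOn.continuousOn hF).comp (f := fun p : Euc n × ℝ => (p.2, p.1, t - p.2)) (by fun_prop)
    fun p hp => ⟨hp.2.1, mem_univ _, sub_nonneg.2 hp.2.2⟩

lemma intervalIntegrable_duhamel_integrand (hF : IsJointlySmooth F) (x : Euc n) {t : ℝ}
    (ht : 0 ≤ t) : IntervalIntegrable (fun τ => (F τ).1 x (t - τ)) volume 0 t :=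
  ContinuousOn.intervalIntegrable_of_Icc ht <|
    (continuousOn_duhamel_integrand hF t).comp (f := fun τ => (x, τ)) (by fun_prop)
      fun _ hτ => ⟨mem_univ _, hτ⟩

lemma dirDeriv_duhamel (hF : IsJointlySmooth F) (w : Euc n) :
    dirDeriv w (duhamel F hF) = duhamel (fun τ => dirDeriv w (F τ)) (hF.dirDeriv w) := by
  refine ext_of_nonneg fun x t ht => ?_
  have e : ∀ G : ℝ → HalfSpaceFun 𝕜 n, ∀ y, ∫ τ in (0 : ℝ)..t, (G τ).1 y (t - τ) =
      ∫ τ in Icc 0 t, (G τ).1 y (t - τ) := fun G y => by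
    rw [intervalIntegral.integral_of_le ht, integral_Icc_eq_integral_Ioc]
  have hd := ((duhamel F hF).contDiff_space t).differentiable (by simp) x
  rw [duhamel_apply, e]
  change fderiv ℝ (fun y => (duhamel F hF).1 y t) x w = _
  simp only [duhamel_apply, e] at hd ⊢
  exact fderiv_setIntegral_apply (H := fun y τ => (F τ).1 y (t - τ)) isCompact_Icc
    (continuousOn_duhamel_integrand hF t)
    (continuousOn_duhamel_integrand (hF.dirDeriv w) t)
    (fun τ _ => ((F τ).contDiff_space _).differentiable (by simp)) hd

lemma spaceOp_duhamel (hF : IsJointlySmooth F) (a : ℝ) :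
    spaceOp a (duhamel F hF) = duhamel (fun τ => spaceOp a (F τ)) (hF.spaceOp a) := by
  refine ext_of_nonneg fun x t ht => ?_
  rw [spaceOp_apply_eq_sum]
  simp only [dirDeriv_duhamel, duhamel_apply, spaceOp_apply_eq_sum]
  rw [intervalIntegral.integral_smul, intervalIntegral.integral_finsetSum]
  exact fun i _ => intervalIntegrable_duhamel_integrand ((hF.dirDeriv _).dirDeriv _) x ht

/-- Differentiation of a Duhamel integral in time. After rescaling the integral to `[0, 1]`, the
boundary term comes from the total derivative of `θ F_{tθ}(x, t - tθ)` in `θ`. -/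
lemma dt_duhamel_apply (hF : IsJointlySmooth F) (x : Euc n) {t : ℝ} (ht : 0 ≤ t) :
    (dt (duhamel F hF)).1 x t =
      (duhamel (fun τ => dt (F τ)) hF.dt).1 x t + (F t).1 x 0 := by
  set Φ : ℝ × Euc n × ℝ → 𝕜 := fun p => (F p.1).1 p.2.1 p.2.2 with hΦ
  set Φ' := fderivWithin ℝ Φ (paramHalfSpace n) with hΦ'
  have hF' : ContDiffOn ℝ ∞ Φ (paramHalfSpace n) := hF
  have hmem : ∀ s ∈ Ici (0 : ℝ), ∀ θ ∈ Icc (0 : ℝ) 1,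
      ((s * θ, x, s - s * θ) : ℝ × Euc n × ℝ) ∈ paramHalfSpace n := fun s hs θ hθ => by
    have hs' : 0 ≤ s := hs
    have := mul_le_mul_of_nonneg_left hθ.2 hs'
    exact ⟨mul_nonneg hs' hθ.1, mem_univ _, by simp only [mem_Ici]; linarith⟩
  have hΦc : ContinuousOn (fun q : ℝ × ℝ => Φ (q.1 * q.2, x, q.1 - q.1 * q.2))
      (Ici 0 ×ˢ Icc 0 1) :=
    hF'.continuousOn.comp (f := fun q : ℝ × ℝ => (q.1 * q.2, x, q.1 - q.1 * q.2)) (by fun_prop)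
      fun q hq => hmem _ hq.1 _ hq.2
  have hΦ'c : ∀ w : ℝ → ℝ × Euc n × ℝ, Continuous w →
      ContinuousOn (fun q : ℝ × ℝ => Φ' (q.1 * q.2, x, q.1 - q.1 * q.2) (w q.2))
      (Ici 0 ×ˢ Icc 0 1) := fun w hw => by
    refine ContinuousOn.clm_apply ?_ (by fun_prop)
    exact (hF'.fderivWithin uniqueDiffOn_paramHalfSpace (m := ∞) (by simp)).continuousOn.comp
      (f := fun q : ℝ × ℝ => (q.1 * q.2, x, q.1 - q.1 * q.2)) (by fun_prop)
      fun q hq => hmem _ hq.1 _ hq.2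
  have hΦd : ∀ p ∈ paramHalfSpace n, HasFDerivWithinAt Φ (Φ' p) (paramHalfSpace n) p :=
    fun p hp => (hF'.differentiableOn (by simp) p hp).hasFDerivWithinAt
  have hint : ∀ w : ℝ → ℝ × Euc n × ℝ, Continuous w →
      IntegrableOn (fun θ => Φ' (t * θ, x, t - t * θ) (w θ)) (Icc 0 1) := fun w hw =>
    ContinuousOn.integrableOn_compact isCompact_Icc ((hΦ'c w hw).comp (f := fun θ => (t, θ))
      (by fun_prop) fun θ hθ => ⟨ht, hθ⟩)
  have hint0 : IntegrableOn (fun θ => Φ (t * θ, x, t - t * θ)) (Icc 0 1) :=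
    ContinuousOn.integrableOn_compact isCompact_Icc (hΦc.comp (f := fun θ => (t, θ))
      (by fun_prop) fun θ hθ => ⟨ht, hθ⟩)
  have hd1 := hasDerivWithinAt_setIntegral_param (μ := volume) (S := Ici 0) (K := Icc 0 1)
    (F := fun s θ => Φ (s * θ, x, s - s * θ))
    (F' := fun s θ => Φ' (s * θ, x, s - s * θ) (θ, 0, 1 - θ)) (y := t)
    (convex_Ici 0) isCompact_Icc hΦc (hΦ'c (fun θ => (θ, 0, 1 - θ)) (by fun_prop))
    (fun s hs θ hθ => by
      refine (hΦd _ (hmem s hs θ hθ)).comp_hasDerivWithinAt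
        (f := fun s => (s * θ, x, s - s * θ)) s ?_ fun r hr => hmem r hr θ hθ
      have h1 : HasDerivAt (fun s : ℝ => s * θ) θ s := by
        simpa using (hasDerivAt_id s).mul_const θ
      exact (h1.prodMk ((hasDerivAt_const s x).prodMk
        ((hasDerivAt_id s).sub h1))).hasDerivWithinAt) ht
  have hd2 := (hasDerivAt_id t).hasDerivWithinAt (s := Ici 0) |>.smul hd1
  -- The derivative of the rescaled integral with respect to `t`.
  have hL : (dt (duhamel F hF)).1 x t = t • (∫ θ in Icc (0 : ℝ) 1,
      Φ' (t * θ, x, t - t * θ) (θ, 0, 1 - θ)) + ∫ θ in Icc (0 : ℝ) 1, Φ (t * θ, x, t - t * θ) := by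
    refine dt_apply_eq ht ?_
    have e := fun s : ℝ => intervalIntegral_eq_smul_setIntegral (fun τ => (F τ).1 x (s - τ)) s
    simp only [id, one_smul] at hd2
    exact hd2.congr (fun s _ => e s) (e t)
  have hR : (duhamel (fun τ => dt (F τ)) hF.dt).1 x t =
      t • ∫ θ in Icc (0 : ℝ) 1, Φ' (t * θ, x, t - t * θ) (0, 0, 1) := by
    rw [duhamel_apply, intervalIntegral_eq_smul_setIntegral
      (fun τ => (dt (F τ)).1 x (t - τ))]
    congr 1
    refine setIntegral_congr_fun measurableSet_Icc fun θ hθ => ?_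
    have hm := hmem t ht θ hθ
    exact IsSmoothFamily.dt_eq hF (by simp) hm.1 hm.2.2 x
  -- The boundary term, by the fundamental theorem of calculus in `θ`.
  have hB : ∫ θ in Icc (0 : ℝ) 1, (t • Φ' (t * θ, x, t - t * θ) (θ, 0, -θ) +
      Φ (t * θ, x, t - t * θ)) = (F t).1 x 0 := by
    have hder : ∀ θ ∈ Icc (0 : ℝ) 1, HasDerivWithinAt (fun θ => θ • Φ (t * θ, x, t - t * θ))
        (t • Φ' (t * θ, x, t - t * θ) (θ, 0, -θ) + Φ (t * θ, x, t - t * θ)) (Icc 0 1) θ := by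
      intro θ hθ
      have h1 : HasDerivAt (fun θ : ℝ => t * θ) t θ := by
        simpa using (hasDerivAt_id θ).const_mul t
      have h2 := (hΦd _ (hmem t ht θ hθ)).comp_hasDerivWithinAt (s := Icc 0 1)
        (f := fun θ => (t * θ, x, t - t * θ)) θ
        (h1.prodMk ((hasDerivAt_const θ x).prodMk (h1.const_sub t))).hasDerivWithinAt
        fun r hr => hmem t ht r hr
      have h3 := (hasDerivAt_id θ).hasDerivWithinAt (s := Icc 0 1) |>.smul h2
      have e : t • Φ' (t * θ, x, t - t * θ) (θ, 0, -θ) =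
          θ • Φ' (t * θ, x, t - t * θ) (t, 0, -t) := by
        rw [← map_smul, ← map_smul]
        congr 1
        simp [mul_comm]
      rw [e]
      simp only [id, one_smul] at h3
      exact h3
    rw [integral_Icc_eq_integral_Ioc, ← intervalIntegral.integral_of_le zero_le_one,
      intervalIntegral.integral_eq_sub_of_hasDerivAt_of_le zero_le_one
        (f := fun θ => θ • Φ (t * θ, x, t - t * θ))
        (fun θ hθ => (hder θ hθ).continuousWithinAt)
        (fun θ hθ => (hder θ (Ioo_subset_Icc_self hθ)).hasDerivAt (Icc_mem_nhds hθ.1 hθ.2))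
        ((intervalIntegrable_iff_integrableOn_Icc_of_le zero_le_one).2
          (((hint (fun θ => (θ, 0, -θ)) (by fun_prop)).smul t).add hint0))]
    simp [hΦ]
  rw [hL, hR, ← hB, integral_add (f := fun θ => t • Φ' (t * θ, x, t - t * θ) (θ, 0, -θ))
    ((hint (fun θ => (θ, 0, -θ)) (by fun_prop)).smul t) hint0,
    integral_smul, ← add_assoc, ← smul_add,
    ← integral_add (hint (fun _ => (0, 0, 1)) (by fun_prop))
      (hint (fun θ => (θ, 0, -θ)) (by fun_prop))]
  simp only [← map_add]
  simp [sub_eq_add_neg]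

/-- If all members of the family vanish at `t = 0`, the Duhamel integral is differentiated under the
integral sign. -/
lemma dt_duhamel_of_zero (hF : IsJointlySmooth F) (h : ∀ τ x, (F τ).1 x 0 = 0) :
    dt (duhamel F hF) = duhamel (fun τ => dt (F τ)) hF.dt :=
  ext_of_nonneg fun x t ht => by rw [dt_duhamel_apply hF x ht, h, add_zero]

lemma duhamel_congr {G : ℝ → HalfSpaceFun 𝕜 n} (hF : IsJointlySmooth F) (hG : IsJointlySmooth G)
    (h : ∀ τ, F τ = G τ) : duhamel F hF = duhamel G hG := by
  obtain rfl : F = G := funext h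
  rfl

lemma box_duhamel_apply (a : ℝ) (hF : IsJointlySmooth F) (hb : IsJointlySmooth fun τ => box a (F τ))
    (h : ∀ τ x, (F τ).1 x 0 = 0) (x : Euc n) {t : ℝ} (ht : 0 ≤ t) :
    (box a (duhamel F hF)).1 x t =
      (duhamel (fun τ => box a (F τ)) hb).1 x t + (dt (F t)).1 x 0 := by
  rw [box_apply, dt_duhamel_of_zero hF h, sub_apply, dt_duhamel_apply hF.dt x ht, spaceOp_duhamel]
  simp only [duhamel_apply, box_apply, sub_apply]
  rw [intervalIntegral.integral_sub
    (intervalIntegrable_duhamel_integrand hF.dt.dt x ht)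
    (intervalIntegrable_duhamel_integrand (hF.spaceOp a) x ht)]
  abel

/-- The solution of the iterated wave equation of order `k + 1` with source `(x, t) ↦ g t x` and
zero initial data. -/
def sourceSol (ν : ℕ) (a : ℝ) (k : ℕ) (g : ℝ → SmoothData 𝕜 n) (hg : IsJointlySmoothData g) :
    HalfSpaceFun 𝕜 n :=
  duhamel (fun τ => fundSol ν a k (g τ)) (isJointlySmooth_fundSol ν a k hg)

variable {g : ℝ → SmoothData 𝕜 n}

lemma duhamel_zero_family (h : IsJointlySmooth fun _ => (0 : HalfSpaceFun 𝕜 n)) :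
    duhamel (fun _ => 0) h = 0 :=
  ext_of_nonneg fun x t _ => by simp [duhamel_apply, zero_apply]

lemma box_sourceSol_zero {ν : ℕ} (hn : n = 2 * ν + 3) (a : ℝ) (hg : IsJointlySmoothData g)
    (x : Euc n) {t : ℝ} (ht : 0 ≤ t) : (box a (sourceSol ν a 0 g hg)).1 x t = (g t).1 x := by
  have h0 : (fun τ => box a (fundSol ν a 0 (g τ))) = fun _ => 0 :=
    funext fun τ => box_fundSol_zero hn a (g τ)
  have hz : IsJointlySmooth fun _ => (0 : HalfSpaceFun 𝕜 n) := contDiffOn_const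
  rw [sourceSol, box_duhamel_apply a _ (h0 ▸ hz) (fun τ x => fundSol_apply_zero ν a 0 (g τ) x) x ht,
    duhamel_congr (G := fun _ => 0) _ hz (fun τ => box_fundSol_zero hn a (g τ)),
    duhamel_zero_family, zero_apply, zero_add, fundSol_zero, dt_waveSol_apply_zero hn]

lemma box_sourceSol_succ {ν : ℕ} (hn : n = 2 * ν + 3) (a : ℝ) (k : ℕ)
    (hg : IsJointlySmoothData g) :
    box a (sourceSol ν a (k + 1) g hg) = sourceSol ν a k g hg := by
  have h0 : (fun τ => box a (fundSol ν a (k + 1) (g τ))) = fun τ => fundSol ν a k (g τ) :=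
    funext fun τ => box_fundSol_succ hn a k (g τ)
  have hz := isJointlySmooth_fundSol ν a k hg
  refine ext_of_nonneg fun x t ht => ?_
  rw [sourceSol, box_duhamel_apply a _ (h0 ▸ hz)
    (fun τ x => fundSol_apply_zero ν a (k + 1) (g τ) x) x ht,
    duhamel_congr (G := fun τ => fundSol ν a k (g τ)) _ hz
      (fun τ => box_fundSol_succ hn a k (g τ)), dt_fundSol_succ_apply_zero, add_zero, sourceSol]

lemma box_pow_sourceSol {ν : ℕ} (hn : n = 2 * ν + 3) (a : ℝ) (k : ℕ) (hg : IsJointlySmoothData g)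
    (x : Euc n) {t : ℝ} (ht : 0 ≤ t) :
    ((box a ^ (k + 1)) (sourceSol ν a k g hg)).1 x t = (g t).1 x := by
  induction k with
  | zero => rw [zero_add, pow_one, box_sourceSol_zero hn a hg x ht]
  | succ k ih => rw [pow_succ, Module.End.mul_apply, box_sourceSol_succ hn, ih]

lemma dt_pow_sourceSol_apply_zero {ν : ℕ} (hn : n = 2 * ν + 3) (a : ℝ) (k : ℕ)
    (hg : IsJointlySmoothData g) :
    ∀ r < 2 * k + 2, ∀ x, ((dt ^ r) (sourceSol ν a k g hg)).1 x 0 = 0 := by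
  have h1 : ∀ k x, (dt (sourceSol ν a k g hg)).1 x 0 = 0 := fun k x => by
    rw [sourceSol, dt_duhamel_of_zero _ fun τ x => fundSol_apply_zero ν a k (g τ) x,
      duhamel_apply_zero]
  induction k with
  | zero => exact dt_pow_apply_zero_of_box a (duhamel_apply_zero _) (h1 0) (by simp)
  | succ k ih =>
    refine dt_pow_apply_zero_of_box a (N := 2 * k + 2) (duhamel_apply_zero _) (h1 _) ?_
    rw [box_sourceSol_succ hn]
    exact ih

end HalfSpaceFun

/-! ### The solution with prescribed initial data -/

lemma commute_mul_self_sub {R : Type*} [Ring R] {D L : R} (h : Commute D L) :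
    Commute (D * D - L) D :=
  ((Commute.refl D).mul_left (Commute.refl D)).sub_left h.symm

lemma commute_mul_self_sub_right {R : Type*} [Ring R] {D L : R} (h : Commute D L) :
    Commute (D * D - L) L :=
  (h.mul_left h).sub_left (Commute.refl L)

lemma mul_self_sub_pow {R : Type*} [Ring R] [Algebra ℝ R] {D L : R} (h : Commute D L) (m : ℕ) :
    (D * D - L) ^ m = ∑ k ∈ Finset.range (m + 1), ((-1 : ℝ) ^ k * (m.choose k : ℝ)) •
      (L ^ k * D ^ (2 * m - 2 * k)) := by
  have hc : Commute (-L) (D * D) := (h.mul_left h).symm.neg_left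
  rw [sub_eq_neg_add, hc.add_pow]
  refine Finset.sum_congr rfl fun k _ => ?_
  rw [← sq, ← pow_mul, Nat.mul_sub, neg_pow, ← Nat.cast_comm, mul_smul, Nat.cast_smul_eq_nsmul,
    nsmul_eq_mul]
  rcases Nat.even_or_odd k with h | h <;> simp [h.neg_one_pow, Nat.cast_comm, mul_assoc]

namespace HalfSpaceFun

lemma commute_box_dt (a : ℝ) : Commute (box a : Module.End ℝ (HalfSpaceFun 𝕜 n)) dt := by
  rw [box]
  exact commute_mul_self_sub (R := Module.End ℝ (HalfSpaceFun 𝕜 n)) (commute_dt_spaceOp a)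

lemma commute_box_spaceOp (a : ℝ) :
    Commute (box a : Module.End ℝ (HalfSpaceFun 𝕜 n)) (spaceOp a) := by
  rw [box]
  exact commute_mul_self_sub_right (R := Module.End ℝ (HalfSpaceFun 𝕜 n)) (commute_dt_spaceOp a)

lemma box_pow_apply (a : ℝ) (m : ℕ) (u : HalfSpaceFun 𝕜 n) :
    (box a ^ m) u = ∑ k ∈ Finset.range (m + 1), ((-1 : ℝ) ^ k * (m.choose k : ℝ)) •
      (spaceOp a ^ k) ((dt ^ (2 * m - 2 * k)) u) := by
  rw [box, mul_self_sub_pow (R := Module.End ℝ (HalfSpaceFun 𝕜 n)) (commute_dt_spaceOp a),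
    LinearMap.sum_apply]
  rfl

lemma pow_apply_pow_apply (A : Module.End ℝ (HalfSpaceFun 𝕜 n)) (i j : ℕ) (u : HalfSpaceFun 𝕜 n) :
    (A ^ i) ((A ^ j) u) = (A ^ (i + j)) u := by
  rw [pow_add, Module.End.mul_apply]

/-- The solution of the iterated wave equation of order `m` with zero source and initial
derivatives `φ 0, …, φ (2m - 1)`. -/
def dataSol (ν : ℕ) (a : ℝ) (m : ℕ) (φ : ℕ → SmoothData 𝕜 n) : HalfSpaceFun 𝕜 n :=
  ∑ k ∈ Finset.range m, ((-1 : ℝ) ^ k * (m.choose k : ℝ)) •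
    (spaceOp a ^ k) (∑ r ∈ Finset.range (2 * m - 2 * k),
      (dt ^ (2 * m - 1 - 2 * k - r)) (fundSol ν a (m - 1) (φ r)))

lemma box_pow_dataSol {ν : ℕ} (hn : n = 2 * ν + 3) (a : ℝ) {m : ℕ} (hm : 1 ≤ m)
    (φ : ℕ → SmoothData 𝕜 n) : (box a ^ m) (dataSol ν a m φ) = 0 := by
  obtain ⟨m, rfl⟩ : ∃ m', m = m' + 1 := ⟨m - 1, by omega⟩
  rw [dataSol, map_sum]
  refine Finset.sum_eq_zero fun k _ => ?_
  rw [map_smul, commute_pow_apply ((commute_box_spaceOp a).pow_right _), map_sum,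
    Finset.sum_eq_zero, map_zero, smul_zero]
  intro r _
  rw [commute_pow_apply ((commute_box_dt a).pow_right _), Nat.add_sub_cancel, box_pow_fundSol hn,
    map_zero]

/-- The contribution of the datum `φ r` to the initial derivative of order `j`. For `j ≤ r` only the
term `k = 0` can survive; for `j > r` the terms complete to `(∂ₜ² - a² Δ)^m` of a derivative of the
fundamental solution, up to terms that vanish at `t = 0`. -/
lemma sum_dt_pow_fundSol_apply_zero {ν : ℕ} (hn : n = 2 * ν + 3) (a : ℝ) {m : ℕ} (hm : 1 ≤ m)
    (g : SmoothData 𝕜 n) {r j : ℕ} (hr : r < 2 * m) (hj : j < 2 * m) (x : Euc n) :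
    ∑ k ∈ Finset.range m with 2 * k + r < 2 * m, ((-1 : ℝ) ^ k * (m.choose k : ℝ)) •
      ((spaceOp a ^ k) ((dt ^ (2 * m - 1 - 2 * k - r + j)) (fundSol ν a (m - 1) g))).1 x 0 =
      if r = j then g.1 x else 0 := by
  obtain ⟨m, rfl⟩ : ∃ m', m = m' + 1 := ⟨m - 1, by omega⟩
  rw [Nat.add_sub_cancel]
  obtain ⟨hz, hone⟩ := dt_pow_fundSol_apply_zero hn a m g
  rcases le_or_gt j r with hjr | hjr
  · rw [Finset.sum_eq_single_of_mem 0 (by simp; omega)]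
    · split_ifs with h
      · subst h
        rw [show 2 * (m + 1) - 1 - 2 * 0 - r + r = 2 * m + 1 by omega]
        simpa using hone x
      · rw [spaceOp_pow_apply_zero a (hz _ (by omega)), smul_zero]
    · intro k hk hk0
      simp only [Finset.mem_filter, Finset.mem_range] at hk
      rw [spaceOp_pow_apply_zero a (hz _ (by omega)), smul_zero]
  · rw [if_neg hjr.ne]
    have h := box_pow_apply a (m + 1) ((dt ^ (j - 1 - r)) (fundSol ν a m g))
    rw [commute_pow_apply ((commute_box_dt a).pow_right _), box_pow_fundSol hn, map_zero] at h
    have h2 := congrArg (fun u : HalfSpaceFun 𝕜 n => u.1 x 0) h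
    simp only [sum_coe, smul_apply, zero_apply] at h2
    rw [h2]
    have hsub : (Finset.range (m + 1)).filter (fun k => 2 * k + r < 2 * (m + 1)) ⊆
        Finset.range (m + 1 + 1) := fun k hk => by
      simp only [Finset.mem_filter, Finset.mem_range] at hk ⊢; omega
    rw [← Finset.sum_subset hsub]
    · refine Finset.sum_congr rfl fun k hk => ?_
      simp only [Finset.mem_filter, Finset.mem_range] at hk
      rw [pow_apply_pow_apply dt,
        show 2 * (m + 1) - 1 - 2 * k - r + j = 2 * (m + 1) - 2 * k + (j - 1 - r) by omega]
    · intro k hk hk'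
      simp only [Finset.mem_filter, Finset.mem_range, not_and, not_lt] at hk hk'
      rw [pow_apply_pow_apply dt, spaceOp_pow_apply_zero a (hz _ ?_), smul_zero]
      rcases Nat.lt_or_ge k (m + 1) with hkm | hkm
      · have := hk' hkm; omega
      · omega

lemma dt_pow_dataSol_apply_zero {ν : ℕ} (hn : n = 2 * ν + 3) (a : ℝ) {m : ℕ} (hm : 1 ≤ m)
    (φ : ℕ → SmoothData 𝕜 n) {j : ℕ} (hj : j < 2 * m) (x : Euc n) :
    ((dt ^ j) (dataSol ν a m φ)).1 x 0 = (φ j).1 x := by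
  have h1 : ((dt ^ j) (dataSol ν a m φ)).1 x 0 =
      ∑ k ∈ Finset.range m, ∑ r ∈ Finset.range (2 * m - 2 * k),
        ((-1 : ℝ) ^ k * (m.choose k : ℝ)) • ((spaceOp a ^ k)
          ((dt ^ (2 * m - 1 - 2 * k - r + j)) (fundSol ν a (m - 1) (φ r)))).1 x 0 := by
    rw [dataSol, map_sum, sum_coe]
    refine Finset.sum_congr rfl fun k _ => ?_
    rw [map_smul, smul_apply, commute_pow_apply ((commute_dt_spaceOp a).pow_right _), map_sum,
      map_sum, sum_coe, Finset.smul_sum]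
    refine Finset.sum_congr rfl fun r _ => ?_
    rw [pow_apply_pow_apply dt, add_comm j]
  rw [h1, Finset.sum_comm' (t' := Finset.range (2 * m))
    (s' := fun r => (Finset.range m).filter (fun k => 2 * k + r < 2 * m))]
  · rw [Finset.sum_congr rfl fun r hr =>
      sum_dt_pow_fundSol_apply_zero hn a hm (φ r) (Finset.mem_range.1 hr) hj x,
      Finset.sum_ite_eq' (Finset.range (2 * m)) j fun r => (φ r).1 x,
      if_pos (Finset.mem_range.2 hj)]
  · intro k r
    simp only [Finset.mem_range, Finset.mem_filter]
    omega

/-- The solution of the Cauchy problem. -/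
def cauchySol (ν : ℕ) (a : ℝ) (m : ℕ) (g : ℝ → SmoothData 𝕜 n) (hg : IsJointlySmoothData g)
    (φ : ℕ → SmoothData 𝕜 n) : HalfSpaceFun 𝕜 n :=
  sourceSol ν a (m - 1) g hg + dataSol ν a m φ

lemma coe_dt_pow (u : HalfSpaceFun 𝕜 n) (r : ℕ) (x : Euc n) :
    timeDeriv r (u.1 x) = ((dt ^ r) u).1 x := by
  induction r with
  | zero => rfl
  | succ r ih =>
    rw [timeDeriv, iteratedDerivWithin_succ, pow_succ_apply]
    change derivWithin (timeDeriv r (u.1 x)) _ = _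
    rw [ih]
    rfl

lemma coe_box (a : ℝ) (u : HalfSpaceFun 𝕜 n) : waveOp a u.1 = (box a u).1 := by
  funext x t
  rw [waveOp, coe_dt_pow, box_apply, sub_apply, coe_spaceOp, pow_two]
  rfl

lemma coe_box_pow (a : ℝ) (u : HalfSpaceFun 𝕜 n) (m : ℕ) :
    (waveOp a)^[m] u.1 = ((box a ^ m) u).1 := by
  induction m with
  | zero => rfl
  | succ m ih => rw [Function.iterate_succ_apply', ih, coe_box, pow_succ_apply]

lemma isCauchySolution_cauchySol {ν : ℕ} (hn : n = 2 * ν + 3) (a : ℝ) {m : ℕ} (hm : 1 ≤ m)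
    {g : ℝ → SmoothData 𝕜 n} (hg : IsJointlySmoothData g) (φ : ℕ → SmoothData 𝕜 n) :
    IsCauchySolution m a (fun x t => (g t).1 x) (fun r => (φ r).1)
      (cauchySol ν a m g hg φ).1 where
  contDiffOn := by
    refine ((isSmoothFamily_const_iff.1 (cauchySol ν a m g hg φ).smooth)).of_le ?_
    exact WithTop.coe_le_coe.2 (show ((2 * m : ℕ) : ℕ∞) ≤ ⊤ from le_top)
  equation x t ht := by
    obtain ⟨m, rfl⟩ : ∃ m', m = m' + 1 := ⟨m - 1, by omega⟩
    rw [coe_box_pow, cauchySol, map_add, add_apply, box_pow_dataSol hn a hm, zero_apply, add_zero,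
      Nat.add_sub_cancel, box_pow_sourceSol hn a m hg x ht.le]
  initial r hr x := by
    rw [coe_dt_pow, cauchySol, map_add, add_apply, dt_pow_dataSol_apply_zero hn a hm φ hr,
      dt_pow_sourceSol_apply_zero hn a _ hg r (by omega), zero_add]

end HalfSpaceFun

/-! ### Dependence on the values at `t ≥ 0` only -/

lemma timeDeriv_congr {g h : ℝ → 𝕜} (hgh : ∀ t, 0 ≤ t → g t = h t) (r : ℕ) {t : ℝ} (ht : 0 ≤ t) :
    timeDeriv r g t = timeDeriv r h t :=
  iteratedDerivWithin_congr (fun s hs => hgh s hs) ht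

lemma waveOp_congr (a : ℝ) {u v : Euc n → ℝ → 𝕜} (huv : ∀ x t, 0 ≤ t → u x t = v x t)
    (x : Euc n) {t : ℝ} (ht : 0 ≤ t) : waveOp a u x t = waveOp a v x t := by
  rw [waveOp, waveOp, timeDeriv_congr (huv x) 2 ht,
    show (fun y => u y t) = fun y => v y t from funext fun y => huv y t ht]

lemma waveOp_iterate_congr (a : ℝ) {u v : Euc n → ℝ → 𝕜} (huv : ∀ x t, 0 ≤ t → u x t = v x t)
    (m : ℕ) (x : Euc n) {t : ℝ} (ht : 0 ≤ t) :
    (waveOp a)^[m] u x t = (waveOp a)^[m] v x t := by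
  induction m generalizing x t with
  | zero => exact huv x t ht
  | succ m ih =>
    rw [Function.iterate_succ_apply', Function.iterate_succ_apply']
    exact waveOp_congr a (fun x t ht => ih x ht) x ht

lemma IsCauchySolution.congr {m : ℕ} {a : ℝ} {f f' : Euc n → ℝ → 𝕜} {φ φ' : ℕ → Euc n → 𝕜}
    {u v : Euc n → ℝ → 𝕜} (hu : IsCauchySolution m a f φ u)
    (hf : ∀ x t, 0 < t → f' x t = f x t) (hφ : ∀ r < 2 * m, φ' r = φ r)
    (huv : ∀ x t, 0 ≤ t → v x t = u x t) : IsCauchySolution m a f' φ' v where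
  contDiffOn := hu.contDiffOn.congr fun p hp => huv p.1 p.2 hp.2
  equation x t ht := by
    rw [waveOp_iterate_congr a huv m x ht.le, hu.equation x t ht, hf x t ht]
  initial r hr x := by
    rw [timeDeriv_congr (huv x) r le_rfl, hu.initial r hr x, hφ r hr]

/-! ### The explicit formula -/

/-- Repeated integration by parts: the kernel `(t² - τ²)^j τ / (2j)!!` integrates like `j + 1`
weighted primitives. -/
lemma integral_kernel_eq_iterate (j : ℕ) {q : ℝ → 𝕜} (hq : ContinuousOn q (Ici 0)) {t : ℝ}
    (ht : 0 ≤ t) :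
    ∫ τ in (0 : ℝ)..t, ((t ^ 2 - τ ^ 2) ^ j * τ / (Nat.doubleFactorial (2 * j) : ℝ)) • q τ =
      weightedPrimitive^[j + 1] q t := by
  induction j generalizing q with
  | zero => simp [weightedPrimitive]
  | succ j ih =>
    have hsq : ContinuousOn (fun s : ℝ => s • q s) (Ici 0) :=
      ContinuousOn.smul (by fun_prop) hq
    have hd : ∀ s, 0 ≤ s → HasDerivWithinAt (weightedPrimitive q) (s • q s) (Ici 0) s :=
      fun s hs => hasDerivWithinAt_intervalIntegral hsq hs
    have hJ : ContinuousOn (weightedPrimitive q) (Ici 0) := fun s hs => (hd s hs).continuousWithinAt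
    rw [Function.iterate_succ_apply, ← ih hJ]
    have hc : (Nat.doubleFactorial (2 * (j + 1)) : ℝ) =
        (2 * j + 2) * (Nat.doubleFactorial (2 * j) : ℝ) := by
      rw [show 2 * (j + 1) = 2 * j + 2 by ring, Nat.doubleFactorial_add_two]; push_cast; ring
    have h1 : (Nat.doubleFactorial (2 * j) : ℝ) ≠ 0 := by
      exact_mod_cast (Nat.doubleFactorial_pos _).ne'
    have h2 : (2 * (j : ℝ) + 2) ≠ 0 := by positivity
    set A : ℝ → 𝕜 := fun τ => ((t ^ 2 - τ ^ 2) ^ (j + 1) * τ /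
      (Nat.doubleFactorial (2 * (j + 1)) : ℝ)) • q τ
    set B : ℝ → 𝕜 := fun τ => ((t ^ 2 - τ ^ 2) ^ j * τ / (Nat.doubleFactorial (2 * j) : ℝ)) •
      weightedPrimitive q τ
    have hA : IntervalIntegrable A volume 0 t :=
      ContinuousOn.intervalIntegrable_of_Icc ht
        (ContinuousOn.smul (by fun_prop) (hq.mono Icc_subset_Ici_self))
    have hB : IntervalIntegrable B volume 0 t :=
      ContinuousOn.intervalIntegrable_of_Icc ht
        (ContinuousOn.smul (by fun_prop) (hJ.mono Icc_subset_Ici_self))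
    set P : ℝ → 𝕜 := fun τ => ((t ^ 2 - τ ^ 2) ^ (j + 1) /
      (Nat.doubleFactorial (2 * (j + 1)) : ℝ)) • weightedPrimitive q τ
    have hP : ∀ s, 0 ≤ s → HasDerivWithinAt P (A s - B s) (Ici 0) s := fun s hs => by
      have hk : HasDerivAt (fun τ : ℝ => (t ^ 2 - τ ^ 2) ^ (j + 1) /
          (Nat.doubleFactorial (2 * (j + 1)) : ℝ))
          (-((t ^ 2 - s ^ 2) ^ j * s / (Nat.doubleFactorial (2 * j) : ℝ))) s := by
        have := (((hasDerivAt_pow 2 s).const_sub (t ^ 2)).pow (j + 1)).div_const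
          (Nat.doubleFactorial (2 * (j + 1)) : ℝ)
        have e : -((t ^ 2 - s ^ 2) ^ j * s / (Nat.doubleFactorial (2 * j) : ℝ)) =
            ((j + 1 : ℕ) : ℝ) * (t ^ 2 - s ^ 2) ^ (j + 1 - 1) * (-(((2 : ℕ) : ℝ) * s ^ (2 - 1))) /
              (Nat.doubleFactorial (2 * (j + 1)) : ℝ) := by
          rw [hc, Nat.add_sub_cancel]
          push_cast
          field_simp
        rw [e]
        exact this
      have := hk.hasDerivWithinAt (s := Ici 0) |>.smul (hd s hs)
      have e : A s - B s = ((t ^ 2 - s ^ 2) ^ (j + 1) /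
          (Nat.doubleFactorial (2 * (j + 1)) : ℝ)) • (s • q s) +
          (-((t ^ 2 - s ^ 2) ^ j * s / (Nat.doubleFactorial (2 * j) : ℝ))) •
            weightedPrimitive q s := by
        simp only [A, B, smul_smul, neg_smul, ← sub_eq_add_neg]
        congr 2
        ring
      rw [e]
      exact this
    have hFTC := intervalIntegral.integral_eq_sub_of_hasDerivAt_of_le ht (f := P)
      (fun s hs => (hP s hs.1).continuousWithinAt.mono Icc_subset_Ici_self)
      (fun s hs => (hP s hs.1.le).hasDerivAt (Ici_mem_nhds hs.1)) (hA.sub hB)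
    rw [intervalIntegral.integral_sub hA hB] at hFTC
    have h0 : P t - P 0 = 0 := by simp [P, weightedPrimitive]
    rw [h0] at hFTC
    exact sub_eq_zero.1 hFTC

/-- Only positive times matter; the spherical mean of radius zero has a junk value. -/
lemma kernelIntegral_congr (m : ℕ) {g h : ℝ → 𝕜} (hgh : ∀ t, 0 < t → g t = h t) {t : ℝ}
    (ht : 0 ≤ t) : kernelIntegral m g t = kernelIntegral m h t := by
  unfold kernelIntegral
  split_ifs
  · rcases ht.eq_or_lt with rfl | ht'
    · simp
    · rw [hgh t ht']
  · refine intervalIntegral.integral_congr_ae (ae_of_all _ fun s hs => ?_)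
    rw [uIoc_of_le ht] at hs
    rw [hgh s hs.1]

lemma weightedPrimitive_iterate_congr (k : ℕ) {g h : ℝ → 𝕜} (hgh : ∀ t, 0 < t → g t = h t) {t : ℝ}
    (ht : 0 < t) : weightedPrimitive^[k] g t = weightedPrimitive^[k] h t := by
  induction k generalizing t with
  | zero => exact hgh t ht
  | succ k ih =>
    rw [Function.iterate_succ_apply', Function.iterate_succ_apply']
    exact weightedPrimitive_congr (fun t ht => ih ht) ht.le

lemma sphericalMean_eq_mean (ν : ℕ) {a : ℝ} (ha : 0 < a) (g : SmoothData 𝕜 n) (x : Euc n) {t : ℝ}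
    (ht : 0 < t) : sphericalMean ν a g.1 x t = (HalfSpaceFun.mean ν a g).1 x t := by
  rw [HalfSpaceFun.mean_apply ν a g x ht.le, sphericalMean, sphereIntegral, smul_smul, meanConst]
  congr 1
  have h1 : (a * t) ^ (n - 1) ≠ 0 := (pow_pos (mul_pos ha ht) _).ne'
  have h2 : Real.pi ≠ 0 := Real.pi_ne_zero
  field_simp

namespace HalfSpaceFun

lemma coe_spaceOp_pow (a : ℝ) (u : HalfSpaceFun 𝕜 n) (k : ℕ) (t : ℝ) :
    (scaledLaplacian a)^[k] (fun y => u.1 y t) = fun y => ((spaceOp a ^ k) u).1 y t := by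
  induction k with
  | zero => rfl
  | succ k ih =>
    rw [Function.iterate_succ_apply', ih, pow_succ_apply, coe_spaceOp]
    rfl

lemma coe_prim_pow (u : HalfSpaceFun 𝕜 n) (k : ℕ) (x : Euc n) :
    weightedPrimitive^[k] (u.1 x) = ((prim ^ k) u).1 x := by
  induction k with
  | zero => rfl
  | succ k ih => rw [Function.iterate_succ_apply', ih, pow_succ_apply, coe_prim]

/-- The kernel integral is a multiple of the `(m - 1)`-fold weighted primitive of `t u`. -/
lemma kernelIntegral_eq {m : ℕ} (hm : 1 ≤ m) (u : HalfSpaceFun 𝕜 n) (x : Euc n) {t : ℝ}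
    (ht : 0 ≤ t) :
    kernelIntegral m (u.1 x) t =
      ((1 / (Nat.doubleFactorial (2 * (m - 1)) : ℝ)) • (prim ^ (m - 1)) (mulTime u)).1 x t := by
  rw [smul_apply, ← coe_prim_pow]
  unfold kernelIntegral
  split_ifs with h
  · subst h
    simp [mulTime_apply]
  · obtain ⟨j, rfl⟩ : ∃ j, m = j + 2 := ⟨m - 2, by omega⟩
    have hc := ((mulTime u).contDiffOn_time x).continuousOn
    rw [show j + 2 - 1 = j + 1 by omega, ← integral_kernel_eq_iterate j hc ht,
      ← intervalIntegral.integral_smul]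
    refine intervalIntegral.integral_congr fun τ _ => ?_
    simp only [mulTime_apply, smul_smul]
    congr 1
    rw [show j + 2 - 2 = j by omega, show 2 * (j + 2) - 2 = 2 * (j + 1) by omega,
      show 2 * (j + 2) - 4 = 2 * j by omega]
    have h1 : (Nat.doubleFactorial (2 * j) : ℝ) ≠ 0 := by
      exact_mod_cast (Nat.doubleFactorial_pos _).ne'
    have h2 : (Nat.doubleFactorial (2 * (j + 1)) : ℝ) ≠ 0 := by
      exact_mod_cast (Nat.doubleFactorial_pos _).ne'
    field_simp

/-- The part of the fundamental solution, before the application of `(a² Δ)^ν`, that consists of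
spherical means. -/
def meanPart (ν : ℕ) (a : ℝ) (k : ℕ) (g : SmoothData 𝕜 n) : HalfSpaceFun 𝕜 n :=
  (1 / (Nat.doubleFactorial (2 * k) : ℝ)) • (prim ^ k) (mulTime ((prim ^ ν) (mean ν a g)))

/-- The term of index `i` of the part of the fundamental solution that is polynomial in `t`. -/
def polyPart (a : ℝ) (k i : ℕ) (g : SmoothData 𝕜 n) : HalfSpaceFun 𝕜 n :=
  (((k + i).choose i : ℝ) / (Nat.factorial (2 * k + 2 * i + 1) : ℝ)) •
    (mulTime ^ (2 * k + 2 * i + 1)) ((spaceOp a ^ i) (ofData g))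

lemma prim_mulTime_pow (j : ℕ) {w : HalfSpaceFun 𝕜 n} (hw : dt w = 0) :
    prim ((mulTime ^ j) w) = (1 / ((j : ℝ) + 2)) • (mulTime ^ (j + 2)) w := by
  refine eq_of_dt_eq ?_ fun x => ?_
  · rw [dt_prim, map_smul, dt_mulTime_pow (j + 1) hw, smul_smul, ← pow_succ_apply]
    have : ((j : ℝ) + 2) ≠ 0 := by positivity
    push_cast
    rw [show 1 / ((j : ℝ) + 2) * (j + 1 + 1) = 1 by field_simp; ring, one_smul]
  · rw [prim_apply_zero, smul_apply, mulTime_pow_succ_apply_zero, smul_zero]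

/-- The weighted primitives of the Taylor terms of `waveSol` produce the binomial coefficients of
the explicit formula. -/
lemma prim_pow_mulTime_pow (k i : ℕ) {w : HalfSpaceFun 𝕜 n} (hw : dt w = 0) :
    (1 / (Nat.doubleFactorial (2 * k) : ℝ)) • (prim ^ k)
        ((1 / (Nat.factorial (2 * i + 1) : ℝ)) • (mulTime ^ (2 * i + 1)) w) =
      (((k + i).choose i : ℝ) / (Nat.factorial (2 * k + 2 * i + 1) : ℝ)) •
        (mulTime ^ (2 * k + 2 * i + 1)) w := by
  induction k with
  | zero => simp
  | succ k ih =>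
    have hc : (Nat.doubleFactorial (2 * (k + 1)) : ℝ) =
        (2 * k + 2) * (Nat.doubleFactorial (2 * k) : ℝ) := by
      rw [show 2 * (k + 1) = 2 * k + 2 by ring, Nat.doubleFactorial_add_two]; push_cast; ring
    rw [pow_succ_apply, hc, ← one_div_mul_one_div, mul_smul, ← map_smul prim, ih, map_smul,
      prim_mulTime_pow _ hw, smul_smul, smul_smul,
      show 2 * (k + 1) + 2 * i + 1 = 2 * k + 2 * i + 1 + 2 by ring]
    congr 1
    have h1 : (Nat.factorial (2 * k + 2 * i + 1) : ℝ) ≠ 0 := by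
      exact_mod_cast (Nat.factorial_pos _).ne'
    have h2 := Nat.choose_mul_succ_eq (k + i) i
    rw [show k + i + 1 - i = k + 1 by omega, show k + i + 1 = k + 1 + i by ring] at h2
    have h3 : ((k + i).choose i : ℝ) * (k + 1 + i) = ((k + 1 + i).choose i : ℝ) * (k + 1) := by
      exact_mod_cast h2
    rw [Nat.factorial_succ (2 * k + 2 * i + 1 + 1), Nat.factorial_succ (2 * k + 2 * i + 1)]
    push_cast
    have h4 : (2 * (k : ℝ) + 2) ≠ 0 := by positivity
    have h5 : (2 * (k : ℝ) + 2 * i + 1 + 2) ≠ 0 := by positivity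
    have h6 : (2 * (k : ℝ) + 2 * i + 1 + 1 + 1) ≠ 0 := by positivity
    have h7 : (2 * (k : ℝ) + 2 * i + 1 + 1) ≠ 0 := by positivity
    field_simp
    linear_combination 2 * (2 * (k : ℝ) + 2 * i + 3) * h3

lemma fundSol_eq (ν : ℕ) (a : ℝ) (k : ℕ) (g : SmoothData 𝕜 n) :
    fundSol ν a k g = (spaceOp a ^ ν) (meanPart ν a k g) +
      ∑ i ∈ Finset.range ν, polyPart a k i g := by
  rw [fundSol, waveSol, map_add, smul_add, meanPart, map_smul,
    ← commute_pow_apply ((commute_prim_spaceOp a).pow_right ν), map_sum, Finset.smul_sum]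
  congr 1
  exact Finset.sum_congr rfl fun i _ => prim_pow_mulTime_pow k i (dt_spaceOp_pow_ofData a g i)

lemma dt_pow_mulTime_pow (N J : ℕ) {w : HalfSpaceFun 𝕜 n} (hw : dt w = 0) :
    (dt ^ N) ((1 / (Nat.factorial (J + N) : ℝ)) • (mulTime ^ (J + N)) w) =
      (1 / (Nat.factorial J : ℝ)) • (mulTime ^ J) w := by
  induction N with
  | zero => rfl
  | succ N ih =>
    rw [pow_succ, Module.End.mul_apply, map_smul, ← ih, ← add_assoc, dt_mulTime_pow _ hw,
      smul_smul, Nat.factorial_succ]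
    congr 2
    have h1 : (Nat.factorial (J + N) : ℝ) ≠ 0 := by exact_mod_cast (Nat.factorial_pos _).ne'
    have h2 : ((J : ℝ) + N + 1) ≠ 0 := by positivity
    push_cast
    field_simp

lemma spaceOp_pow_ofData_apply (a : ℝ) (g : SmoothData 𝕜 n) (i : ℕ) (x : Euc n) {t : ℝ}
    (ht : 0 ≤ t) : ((spaceOp a ^ i) (ofData g)).1 x t = (scaledLaplacian a)^[i] g.1 x := by
  have h := coe_spaceOp_pow a (ofData g) i t
  rw [show (fun y => (ofData g).1 y t) = g.1 from funext fun y => ofData_apply g y ht] at h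
  rw [h]

lemma choose_div_factorial (k r : ℕ) :
    ((k + r).choose r : ℝ) / (Nat.factorial (2 * k + 2 * r + 1) : ℝ) =
      1 / (Nat.doubleFactorial (2 * k) : ℝ) * (1 / ((Nat.doubleFactorial (2 * k + 2 * r + 1) : ℝ) *
        (Nat.doubleFactorial (2 * r) : ℝ))) := by
  rw [Nat.factorial_eq_mul_doubleFactorial (2 * k + 2 * r), ← mul_add 2 k r,
    Nat.doubleFactorial_two_mul, Nat.doubleFactorial_two_mul, Nat.doubleFactorial_two_mul]
  have h := Nat.add_choose_mul_factorial_mul_factorial k r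
  have h' : ((k + r).choose r : ℝ) * (Nat.factorial k) * (Nat.factorial r) =
      (Nat.factorial (k + r) : ℝ) := by
    exact_mod_cast h
  have h1 : (Nat.factorial r : ℝ) ≠ 0 := by exact_mod_cast (Nat.factorial_pos _).ne'
  have h2 : (Nat.factorial k : ℝ) ≠ 0 := by exact_mod_cast (Nat.factorial_pos _).ne'
  have h3 : (Nat.factorial (k + r) : ℝ) ≠ 0 := by exact_mod_cast (Nat.factorial_pos _).ne'
  have h4 : (Nat.doubleFactorial (2 * (k + r) + 1) : ℝ) ≠ 0 := by
    exact_mod_cast (Nat.doubleFactorial_pos _).ne'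
  push_cast
  field_simp
  rw [← h', pow_add]
  ring

lemma isJointlySmooth_meanPart (ν : ℕ) (a : ℝ) (k : ℕ) {g : ℝ → SmoothData 𝕜 n}
    (hg : IsJointlySmoothData g) :
    IsJointlySmooth (fun τ => (spaceOp a ^ ν) (meanPart ν a k (g τ))) := by
  have hmean : IsJointlySmooth (fun τ => mean ν a (g τ)) := isSmoothFamily_mean _ a hg
  exact IsJointlySmooth.pow (fun _ hF => hF.spaceOp a)
    (((hmean.pow (fun _ hF => hF.prim) ν).mulTime.pow (fun _ hF => hF.prim) k).const_smul _) ν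

lemma isJointlySmooth_polyPart (a : ℝ) (k i : ℕ) {g : ℝ → SmoothData 𝕜 n}
    (hg : IsJointlySmoothData g) : IsJointlySmooth (fun τ => polyPart a k i (g τ)) := by
  have hdata : IsJointlySmooth (fun τ => ofData (g τ)) := isSmoothFamily_ofData hg
  exact ((hdata.pow (fun _ hF => hF.spaceOp a) i).pow (fun _ hF => hF.mulTime) _).const_smul _

lemma sourceSol_apply (ν : ℕ) (a : ℝ) (k : ℕ) {g : ℝ → SmoothData 𝕜 n}
    (hg : IsJointlySmoothData g) (x : Euc n) {t : ℝ} (ht : 0 ≤ t) :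
    (sourceSol ν a k g hg).1 x t =
      (∫ τ in (0 : ℝ)..t, ((spaceOp a ^ ν) (meanPart ν a k (g τ))).1 x (t - τ)) +
      ∑ i ∈ Finset.range ν, ∫ τ in (0 : ℝ)..t, (polyPart a k i (g τ)).1 x (t - τ) := by
  rw [sourceSol, duhamel_apply]
  simp only [fundSol_eq, add_apply, sum_coe]
  have hI := fun i => intervalIntegrable_duhamel_integrand (isJointlySmooth_polyPart a k i hg) x ht
  rw [intervalIntegral.integral_add (intervalIntegrable_duhamel_integrand
    (isJointlySmooth_meanPart ν a k hg) x ht), intervalIntegral.integral_finsetSum fun i _ => hI i]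
  have := IntervalIntegrable.sum (Finset.range ν) fun i _ => hI i
  simpa only [Finset.sum_fn] using this

lemma kernelIntegral_sphericalMean (ν : ℕ) {m : ℕ} (hm : 1 ≤ m) {a : ℝ} (ha : 0 < a)
    (g : SmoothData 𝕜 n) (x : Euc n) {t : ℝ} (ht : 0 ≤ t) :
    kernelIntegral m (weightedPrimitive^[ν] fun τ => sphericalMean ν a g.1 x τ) t =
      (meanPart ν a (m - 1) g).1 x t := by
  rw [kernelIntegral_congr m (h := ((prim ^ ν) (mean ν a g)).1 x) (fun s hs => ?_) ht,
    kernelIntegral_eq hm _ x ht, meanPart]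
  rw [← coe_prim_pow]
  exact weightedPrimitive_iterate_congr ν (fun r hr => sphericalMean_eq_mean ν ha g x hr) hs

lemma kernelIntegral_scaledLaplacian_sphericalMean (ν : ℕ) {m : ℕ} (hm : 1 ≤ m) {a : ℝ} (ha : 0 < a)
    (g : SmoothData 𝕜 n) (x : Euc n) {t : ℝ} (ht : 0 ≤ t) :
    kernelIntegral m (weightedPrimitive^[ν] fun s =>
      ((scaledLaplacian a)^[ν] fun y => sphericalMean ν a g.1 y s) x) t =
      ((spaceOp a ^ ν) (meanPart ν a (m - 1) g)).1 x t := by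
  rw [kernelIntegral_congr m (h := ((prim ^ ν) ((spaceOp a ^ ν) (mean ν a g))).1 x)
    (fun s hs => ?_) ht, kernelIntegral_eq hm _ x ht, meanPart, map_smul]
  · rw [commute_pow_apply ((commute_prim_spaceOp a).pow_right ν),
      ← commute_pow_apply (commute_mulTime_spaceOp a).symm,
      commute_pow_apply ((commute_prim_spaceOp a).pow_right ν)]
  · rw [← coe_prim_pow]
    refine weightedPrimitive_iterate_congr ν (fun r hr => ?_) hs
    rw [show (fun y => sphericalMean ν a g.1 y r) = fun y => (mean ν a g).1 y r from
      funext fun y => sphericalMean_eq_mean ν ha g y hr, coe_spaceOp_pow]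

lemma sourceTerms_eq (ν : ℕ) {m : ℕ} (hm : 1 ≤ m) {a : ℝ} (ha : 0 < a) {f : Euc n → ℝ → 𝕜}
    {g : ℝ → SmoothData 𝕜 n} (hg : IsJointlySmoothData g)
    (hfg : ∀ τ, 0 ≤ τ → (g τ).1 = fun x => f x τ) (x : Euc n) {t : ℝ} (ht : 0 ≤ t) :
    sourceMeanTerm ν m a f x t + sourcePolyTerm ν m a f x t =
      (sourceSol ν a (m - 1) g hg).1 x t := by
  obtain ⟨k, rfl⟩ : ∃ k, m = k + 1 := ⟨m - 1, by omega⟩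
  rw [sourceSol_apply ν a _ hg x ht, sourceMeanTerm, sourcePolyTerm, Finset.smul_sum]
  congr 1
  · refine intervalIntegral.integral_congr fun τ hτ => ?_
    rw [uIcc_of_le ht] at hτ
    simp only [← hfg τ hτ.1]
    exact kernelIntegral_scaledLaplacian_sphericalMean ν hm ha (g τ) x (sub_nonneg.2 hτ.2)
  · refine Finset.sum_congr rfl fun i _ => ?_
    rw [← intervalIntegral.integral_smul]
    refine intervalIntegral.integral_congr fun τ hτ => ?_
    rw [uIcc_of_le ht] at hτ
    simp only [← hfg τ hτ.1]
    rw [Nat.add_sub_cancel, polyPart, HalfSpaceFun.smul_apply, mulTime_pow_apply,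
      spaceOp_pow_ofData_apply a (g τ) i x (sub_nonneg.2 hτ.2), smul_smul, smul_smul,
      choose_div_factorial, show 2 * (k + 1) - 2 = 2 * k by omega,
      show 2 * (k + 1) + 2 * i - 1 = 2 * k + 2 * i + 1 by omega]
    congr 1
    ring

lemma dataTerms_eq (ν : ℕ) {m : ℕ} (hm : 1 ≤ m) {a : ℝ} (ha : 0 < a) {φ : ℕ → Euc n → 𝕜}
    {ψ : ℕ → SmoothData 𝕜 n} (hφ : ∀ r < 2 * m, (ψ r).1 = φ r) (x : Euc n) {t : ℝ} (ht : 0 ≤ t) :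
    dataMeanTerm ν m a φ x t + dataPolyTerm ν m a φ x t = (dataSol ν a m ψ).1 x t := by
  obtain ⟨j, rfl⟩ : ∃ k, m = k + 1 := ⟨m - 1, by omega⟩
  rw [dataMeanTerm, dataPolyTerm, dataSol, sum_coe, ← Finset.sum_add_distrib]
  refine Finset.sum_congr rfl fun k _ => ?_
  rw [← smul_add, HalfSpaceFun.smul_apply]
  congr 1
  have h1 : (fun y => ∑ r ∈ Finset.range (2 * (j + 1) - 2 * k),
      timeDeriv (2 * (j + 1) - 1 - 2 * k - r) (kernelIntegral (j + 1)
        (weightedPrimitive^[ν] fun τ => sphericalMean ν a (φ r) y τ)) t) = fun y =>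
      (∑ r ∈ Finset.range (2 * (j + 1) - 2 * k),
        (dt ^ (2 * (j + 1) - 1 - 2 * k - r)) (meanPart ν a j (ψ r))).1 y t := by
    funext y
    rw [sum_coe]
    refine Finset.sum_congr rfl fun r hr => ?_
    rw [← coe_dt_pow, ← hφ r (by simp only [Finset.mem_range] at hr; omega)]
    exact timeDeriv_congr (fun s hs => kernelIntegral_sphericalMean ν hm ha (ψ r) y hs) _ ht
  rw [h1, coe_spaceOp_pow, pow_add, Module.End.mul_apply]
  beta_reduce
  simp only [map_sum, sum_coe]
  rw [← Finset.sum_add_distrib]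
  refine Finset.sum_congr rfl fun r hr => ?_
  have hr' : r < 2 * (j + 1) - 2 * k := Finset.mem_range.1 hr
  rw [Nat.add_sub_cancel, fundSol_eq, map_add, map_add, add_apply,
    commute_pow_apply ((commute_dt_spaceOp a).symm.pow_right _)]
  congr 1
  simp only [map_sum, sum_coe]
  refine Finset.sum_congr rfl fun i _ => ?_
  rw [show 2 * (j + 1) - 1 - 2 * k - r = 2 * j + 1 - 2 * k - r by omega, polyPart,
    div_eq_mul_one_div ((j + i).choose i : ℝ), mul_smul _ (1 / _), map_smul, map_smul,
    HalfSpaceFun.smul_apply,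
    show 2 * j + 2 * i + 1 = 2 * k + 2 * i + r + (2 * j + 1 - 2 * k - r) by omega,
    dt_pow_mulTime_pow _ _ (dt_spaceOp_pow_ofData a (ψ r) i), map_smul, HalfSpaceFun.smul_apply,
    commute_pow_apply ((commute_mulTime_spaceOp a).symm.pow_right _), mulTime_pow_apply,
    ← Module.End.mul_apply, ← pow_add, spaceOp_pow_ofData_apply a (ψ r) _ x ht, hφ r (by omega),
    smul_smul, smul_smul]
  congr 1
  ring

/-- The explicit formula agrees with the solution built from the fundamental solutions. -/
lemma solutionFormula_eq (ν : ℕ) {m : ℕ} (hm : 1 ≤ m) {a : ℝ} (ha : 0 < a) {f : Euc n → ℝ → 𝕜}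
    {g : ℝ → SmoothData 𝕜 n} (hg : IsJointlySmoothData g)
    (hfg : ∀ τ, 0 ≤ τ → (g τ).1 = fun x => f x τ) {φ : ℕ → Euc n → 𝕜}
    {ψ : ℕ → SmoothData 𝕜 n} (hφ : ∀ r < 2 * m, (ψ r).1 = φ r) (x : Euc n) {t : ℝ} (ht : 0 ≤ t) :
    solutionFormula ν m a f φ x t = (cauchySol ν a m g hg ψ).1 x t := by
  rw [solutionFormula, add_assoc, sourceTerms_eq ν hm ha hg hfg x ht,
    dataTerms_eq ν hm ha hφ x ht, cauchySol, add_apply]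

end HalfSpaceFun

/-! ### Finite speed of propagation -/

namespace HalfSpaceFun

/-- Functions on the half-space that vanish for `‖x‖ > R` as long as `t < T`. -/
def vanishingOutside (𝕜 : Type*) [RCLike 𝕜] (n : ℕ) (R T : ℝ) :
    Submodule ℝ (HalfSpaceFun 𝕜 n) where
  carrier := {u | ∀ x, R < ‖x‖ → ∀ t < T, u.1 x t = 0}
  add_mem' {u v} hu hv x hx t ht := by rw [add_apply, hu x hx t ht, hv x hx t ht, add_zero]
  zero_mem' _ _ _ _ := rfl
  smul_mem' c u hu x hx t ht := by rw [smul_apply, hu x hx t ht, smul_zero]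

variable {R T : ℝ} {u : HalfSpaceFun 𝕜 n}

lemma mulTime_mem_vanishingOutside (hu : u ∈ vanishingOutside 𝕜 n R T) :
    mulTime u ∈ vanishingOutside 𝕜 n R T := fun x hx t ht => by
  rw [mulTime_apply, hu x hx t ht, smul_zero]

lemma prim_mem_vanishingOutside (hu : u ∈ vanishingOutside 𝕜 n R T) :
    prim u ∈ vanishingOutside 𝕜 n R T := fun x hx t ht => by
  rw [coe_prim, weightedPrimitive]
  refine intervalIntegral.integral_zero_ae (ae_of_all _ fun s hs => ?_)
  rcases lt_or_ge s 0 with h | h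
  · rw [u.apply_of_neg x h, smul_zero]
  · rcases le_total 0 t with h0 | h0
    · rw [uIoc_of_le h0] at hs
      rw [hu x hx s (hs.2.trans_lt ht), smul_zero]
    · rw [uIoc_of_ge h0] at hs
      rw [le_antisymm hs.2 h, zero_smul]

lemma dirDeriv_mem_vanishingOutside (w : Euc n) (hu : u ∈ vanishingOutside 𝕜 n R T) :
    dirDeriv w u ∈ vanishingOutside 𝕜 n R T := fun x hx t ht => by
  change fderiv ℝ (fun y => u.1 y t) x w = 0
  have h : (fun y => u.1 y t) =ᶠ[𝓝 x] fun _ => 0 := by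
    filter_upwards [(isOpen_lt continuous_const continuous_norm).mem_nhds hx] with y hy
    exact hu y hy t ht
  rw [h.fderiv_eq]
  simp

lemma spaceOp_mem_vanishingOutside (a : ℝ) (hu : u ∈ vanishingOutside 𝕜 n R T) :
    spaceOp a u ∈ vanishingOutside 𝕜 n R T := by
  rw [spaceOp, LinearMap.smul_apply, LinearMap.sum_apply]
  exact Submodule.smul_mem _ _ (Submodule.sum_mem _ fun i _ =>
    dirDeriv_mem_vanishingOutside _ (dirDeriv_mem_vanishingOutside _ hu))

lemma mean_mem_vanishingOutside (ν : ℕ) {a : ℝ} (ha : 0 < a) {g : SmoothData 𝕜 n}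
    (hg : ∀ x, R < ‖x‖ → g.1 x = 0) :
    mean ν a g ∈ vanishingOutside 𝕜 n (R + a * T) T := fun x hx t ht => by
  rcases lt_or_ge t 0 with h | h
  · exact (mean ν a g).apply_of_neg x h
  · rw [mean_apply ν a g x h, integral_eq_zero_of_ae (ae_of_all _ fun p => hg _ ?_), smul_zero]
    have hp : ‖(a * t) • (p : Euc n)‖ = a * t := by
      rw [norm_smul, norm_eq_of_mem_sphere p, mul_one, Real.norm_of_nonneg (by positivity)]
    have h1 := norm_sub_le (x + (a * t) • (p : Euc n)) ((a * t) • (p : Euc n))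
    rw [add_sub_cancel_right, hp] at h1
    have := mul_lt_mul_of_pos_left ht ha
    linarith

lemma ofData_mem_vanishingOutside {g : SmoothData 𝕜 n} (hg : ∀ x, R < ‖x‖ → g.1 x = 0) :
    ofData g ∈ vanishingOutside 𝕜 n R T := fun x hx t _ => by
  change (if 0 ≤ t then g.1 x else 0) = 0
  rw [hg x hx, ite_self]

/-- Finite speed of propagation: data supported in a ball of radius `R` reach at most distance
`R + a T` before time `T`. -/
lemma waveSol_mem_vanishingOutside (ν : ℕ) {a : ℝ} (ha : 0 < a) {g : SmoothData 𝕜 n}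
    (hg : ∀ x, R < ‖x‖ → g.1 x = 0) (hT : 0 ≤ T) :
    waveSol ν a g ∈ vanishingOutside 𝕜 n (R + a * T) T := by
  have hR : R ≤ R + a * T := le_add_of_nonneg_right (by positivity)
  refine Submodule.add_mem _ ?_ (Submodule.sum_mem _ fun i _ => Submodule.smul_mem _ _ ?_)
  · exact Module.End.pow_apply_mem_of_forall_mem ν
      (fun _ h => spaceOp_mem_vanishingOutside a h) _ (mulTime_mem_vanishingOutside
      (Module.End.pow_apply_mem_of_forall_mem ν (fun _ h => prim_mem_vanishingOutside h) _
      (mean_mem_vanishingOutside ν ha hg)))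
  · exact Module.End.pow_apply_mem_of_forall_mem _ (fun _ h => mulTime_mem_vanishingOutside h) _
      (Module.End.pow_apply_mem_of_forall_mem i (fun _ h => spaceOp_mem_vanishingOutside a h) _
      (ofData_mem_vanishingOutside fun x hx => hg x (hR.trans_lt hx)))

end HalfSpaceFun

/-! ### Uniqueness for the wave equation -/

/-- Green's identity against a compactly supported function. -/
lemma integral_smul_scaledLaplacian (a : ℝ) {p : Euc n → ℝ} {q : Euc n → 𝕜} (hp : ContDiff ℝ 2 p)
    (hpc : HasCompactSupport p) (hq : ContDiff ℝ 2 q) :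
    ∫ x, p x • scaledLaplacian a q x = ∫ x, scaledLaplacian a p x • q x := by
  have h11 : (1 : WithTop ℕ∞) + 1 ≤ 2 := one_add_one_eq_two.le
  have hD : ∀ v, ContDiff ℝ 1 fun y => fderiv ℝ p y v := fun v =>
    (hp.fderiv_right h11).clm_apply contDiff_const
  have hD' : ∀ v, ContDiff ℝ 1 fun y => fderiv ℝ q y v := fun v =>
    (hq.fderiv_right h11).clm_apply contDiff_const
  have hDc : ∀ v, HasCompactSupport fun y => fderiv ℝ p y v := fun v => hpc.fderiv_apply ℝ v
  have hDD : ∀ v, Continuous fun x => fderiv ℝ (fun y => fderiv ℝ p y v) x v := fun v =>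
    ((hD v).continuous_fderiv (by simp)).clm_apply continuous_const
  have hDD' : ∀ v, Continuous fun x => fderiv ℝ (fun y => fderiv ℝ q y v) x v := fun v =>
    ((hD' v).continuous_fderiv (by simp)).clm_apply continuous_const
  have hint : ∀ {f : Euc n → ℝ} {g : Euc n → 𝕜}, Continuous f → HasCompactSupport f →
      Continuous g → Integrable fun x => f x • g x := fun hf hfc hg =>
    (hf.smul hg).integrable_of_hasCompactSupport hfc.smul_right
  have h1 : ∀ v, Integrable fun x => p x • fderiv ℝ (fun y => fderiv ℝ q y v) x v := fun v =>
    hint hp.continuous hpc (hDD' v)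
  have h2 : ∀ v, Integrable fun x => fderiv ℝ (fun y => fderiv ℝ p y v) x v • q x := fun v =>
    hint (hDD v) ((hDc v).fderiv_apply ℝ v) hq.continuous
  have h3 : ∀ v, Integrable fun x => fderiv ℝ p x v • fderiv ℝ q x v := fun v =>
    hint (hD v).continuous (hDc v) (hD' v).continuous
  have key : ∀ v, ∫ x, p x • fderiv ℝ (fun y => fderiv ℝ q y v) x v =
      ∫ x, fderiv ℝ (fun y => fderiv ℝ p y v) x v • q x := fun v => by
    rw [integral_smul_fderiv_eq_neg_fderiv_smul_of_integrable (h3 v) (h1 v)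
      (hint hp.continuous hpc (hD' v).continuous)
      (fun x _ => hp.differentiable (by simp) x)
      (fun x _ => (hD' v).differentiable (by simp) x),
      integral_smul_fderiv_eq_neg_fderiv_smul_of_integrable (h2 v) (h3 v)
      (hint (hD v).continuous (hDc v) hq.continuous)
      (fun x _ => (hD v).differentiable (by simp) x)
      (fun x _ => hq.differentiable (by simp) x), neg_neg]
  simp only [scaledLaplacian, laplacian_eq_sum hp, laplacian_eq_sum hq, Finset.smul_sum,
    Finset.sum_smul, smul_assoc, smul_comm (p _) (a ^ 2)]
  rw [integral_finsetSum _ fun i _ => ?_, integral_finsetSum _ fun i _ => ?_]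
  · simp only [integral_smul, key]
  · exact (h2 _).smul (a ^ 2)
  · exact (h1 _).smul (a ^ 2)

section Uniqueness

variable {w : Euc n → ℝ → 𝕜}

lemma timeDeriv_succ (r : ℕ) (u : Euc n → ℝ → 𝕜) (x : Euc n) :
    timeDeriv (r + 1) (u x) = dt (fun y => timeDeriv r (u y)) x := by
  rw [timeDeriv, iteratedDerivWithin_succ]
  rfl

lemma timeDeriv_succ' (r : ℕ) (u : Euc n → ℝ → 𝕜) (x : Euc n) :
    timeDeriv (r + 1) (u x) = timeDeriv r (dt u x) :=
  iteratedDerivWithin_succ'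

lemma timeDeriv_two (u : Euc n → ℝ → 𝕜) (x : Euc n) :
    timeDeriv 2 (u x) = dt (dt u) x := by
  rw [timeDeriv_succ', timeDeriv_succ' 0, timeDeriv, iteratedDerivWithin_zero]

lemma waveOp_eq (a : ℝ) (u : Euc n → ℝ → 𝕜) (x : Euc n) (t : ℝ) :
    waveOp a u x t = dt (dt u) x t - spaceOp a u x t := by
  rw [waveOp, timeDeriv_two u x, spaceOp]

open HalfSpaceFun in
/-- Holmgren's duality argument. Let `e` solve the wave equation with zero initial value and initial
velocity `φ`. The integral of `e(x, T - t) ∂ₜw(x, t) + ∂ₜe(x, T - t) w(x, t)` over `x` does not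
depend on `t`; at `t = 0` it vanishes, and at `t = T` it is the integral of `φ w`. -/
lemma integral_pairing_eq_zero {ν : ℕ} (hn : n = 2 * ν + 3) {a : ℝ} (ha : 0 < a)
    (hw : IsSmoothFamily 2 (fun _ => w))
    (hbox : ∀ x t, 0 ≤ t → dt (dt w) x t = spaceOp a w x t) (h0 : ∀ x, w x 0 = 0)
    (h1 : ∀ x, dt w x 0 = 0) {T : ℝ} (hT : 0 ≤ T) (φ : SmoothData ℝ n)
    (hφ : HasCompactSupport φ.1) : ∫ x, φ.1 x • w x T = 0 := by
  obtain ⟨R₀, hR₀⟩ := hφ.isCompact.isBounded.subset_closedBall 0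
  have hφ0 : ∀ x, R₀ < ‖x‖ → φ.1 x = 0 := fun x hx => by
    by_contra h
    have := hR₀ (subset_tsupport _ h)
    rw [mem_closedBall_zero_iff] at this
    exact absurd this (not_le.2 hx)
  -- Time `T + 1`, since `vanishingOutside` refers to times strictly before its bound.
  set R := R₀ + a * (T + 1)
  set e := waveSol ν a φ with he
  have hev : e ∈ vanishingOutside ℝ n R (T + 1) :=
    waveSol_mem_vanishingOutside ν ha hφ0 (by linarith)
  have hebox : HalfSpaceFun.dt (HalfSpaceFun.dt e) = HalfSpaceFun.spaceOp a e := by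
    rw [← sub_eq_zero, ← box_apply]; exact box_waveSol hn a φ
  have hwt : IsSmoothFamily 1 (fun _ => dt w) := hw.dt one_add_one_eq_two.le
  have hcont : ∀ {u : Euc n → ℝ → 𝕜} {k : WithTop ℕ∞}, IsSmoothFamily k (fun _ => u) →
      ContinuousOn (fun p : ℝ × Euc n => u p.2 p.1) (Icc 0 T ×ˢ Metric.closedBall 0 R) :=
    fun {u k} hu => ContinuousOn.comp (isSmoothFamily_const_iff.1 hu).continuousOn
      (f := fun p : ℝ × Euc n => (p.2, p.1)) (by fun_prop) fun p hp => ⟨mem_univ _, hp.1.1⟩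
  have hcont' : ∀ u : HalfSpaceFun ℝ n,
      ContinuousOn (fun p : ℝ × Euc n => u.1 p.2 (T - p.1)) (Icc 0 T ×ˢ Metric.closedBall 0 R) :=
    fun u => ContinuousOn.comp (isSmoothFamily_const_iff.1 u.smooth).continuousOn
      (f := fun p : ℝ × Euc n => (p.2, T - p.1)) (by fun_prop)
      fun p hp => ⟨mem_univ _, sub_nonneg.2 hp.1.2⟩
  have hder : ∀ u : HalfSpaceFun ℝ n, ∀ x, ∀ t ∈ Icc 0 T,
      HasDerivWithinAt (fun s => u.1 x (T - s)) (-(HalfSpaceFun.dt u).1 x (T - t)) (Icc 0 T) t :=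
    fun u x t ht => by
      have := (u.hasDerivWithinAt x (sub_nonneg.2 ht.2)).scomp t
        ((hasDerivAt_id t).const_sub T).hasDerivWithinAt (s := Icc 0 T)
        fun s hs => sub_nonneg.2 hs.2
      rw [neg_one_smul] at this
      exact this
  have hder' : ∀ {u : Euc n → ℝ → 𝕜} {k : WithTop ℕ∞}, IsSmoothFamily k (fun _ => u) → k ≠ 0 →
      ∀ x, ∀ t ∈ Icc 0 T, HasDerivWithinAt (u x) (dt u x t) (Icc 0 T) t :=
    fun {u k} hu hk x t ht => by
      rw [hu.dt_eq (τ := 0) hk le_rfl ht.1]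
      exact (hu.hasDerivWithinAt hk le_rfl ht.1 x).mono Icc_subset_Ici_self
  have hpt : ∀ t ∈ Icc 0 T, ∀ x ∈ Metric.closedBall (0 : Euc n) R, HasDerivWithinAt
      (fun t => e.1 x (T - t) • dt w x t + (HalfSpaceFun.dt e).1 x (T - t) • w x t)
      (e.1 x (T - t) • spaceOp a w x t - (HalfSpaceFun.spaceOp a e).1 x (T - t) • w x t)
      (Icc 0 T) t := fun t ht x _ => by
    have h := ((hder e x t ht).smul (hder' hwt one_ne_zero x t ht)).add
      ((hder (HalfSpaceFun.dt e) x t ht).smul (hder' hw two_ne_zero x t ht))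
    have e1 : e.1 x (T - t) • spaceOp a w x t -
        (HalfSpaceFun.spaceOp a e).1 x (T - t) • w x t =
        (e.1 x (T - t) • dt (dt w) x t + (-(HalfSpaceFun.dt e).1 x (T - t)) • dt w x t) +
        ((HalfSpaceFun.dt e).1 x (T - t) • dt w x t +
        (-(HalfSpaceFun.dt (HalfSpaceFun.dt e)).1 x (T - t)) • w x t) := by
      rw [hbox x t ht.1, hebox]
      module
    rw [e1]
    exact h
  have hI := fun {t₀ : ℝ} (ht₀ : t₀ ∈ Icc 0 T) =>
    hasDerivWithinAt_setIntegral_param (μ := (volume : Measure (Euc n))) (S := Icc 0 T)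
    (K := Metric.closedBall 0 R)
    (F := fun t x => e.1 x (T - t) • dt w x t + (HalfSpaceFun.dt e).1 x (T - t) • w x t)
    (F' := fun t x => e.1 x (T - t) • spaceOp a w x t -
      (HalfSpaceFun.spaceOp a e).1 x (T - t) • w x t)
    (convex_Icc 0 T) (isCompact_closedBall 0 R)
    (((hcont' e).smul (hcont hwt)).add ((hcont' _).smul (hcont hw)))
    (((hcont' e).smul (hcont (hw.spaceOp (l := 0) (by simp) a))).sub ((hcont' _).smul (hcont hw)))
    hpt ht₀
  have hzero : ∀ u ∈ vanishingOutside ℝ n R (T + 1), ∀ (v : Euc n → 𝕜), ∀ t, 0 ≤ t →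
      ∫ x in Metric.closedBall 0 R, u.1 x (T - t) • v x = ∫ x, u.1 x (T - t) • v x :=
    fun u hu v t ht => setIntegral_eq_integral_of_forall_compl_eq_zero fun x hx => by
      rw [mem_closedBall_zero_iff, not_le] at hx
      rw [hu x hx _ (by linarith), zero_smul]
  have hF' : ∀ t ∈ Icc 0 T, ∫ x in Metric.closedBall 0 R, (e.1 x (T - t) • spaceOp a w x t -
      (HalfSpaceFun.spaceOp a e).1 x (T - t) • w x t) = 0 := fun t ht => by
    have hes : HasCompactSupport fun y => e.1 y (T - t) := by
      refine HasCompactSupport.intro (isCompact_closedBall 0 R) fun x hx => ?_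
      rw [mem_closedBall_zero_iff, not_le] at hx
      exact hev x hx _ (by linarith [ht.1])
    have hslice := fun {u : Euc n → ℝ → 𝕜} {k : WithTop ℕ∞}
      (hu : IsSmoothFamily k (fun _ => u)) => (hu.contDiff_space (τ := 0) le_rfl ht.1).continuous
    rw [integral_sub, sub_eq_zero, hzero _ hev (fun x => spaceOp a w x t) t ht.1,
      hzero _ (spaceOp_mem_vanishingOutside a hev) (fun x => w x t) t ht.1]
    · have := integral_smul_scaledLaplacian a ((e.contDiff_space (T - t)).of_le two_le_infty) hes
        (hw.contDiff_space (τ := 0) le_rfl ht.1)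
      rw [coe_spaceOp]
      exact this
    · exact (((e.contDiff_space (T - t)).continuous.smul (hslice (hw.spaceOp (l := 0) (by simp) a))
        ).continuousOn).integrableOn_compact (isCompact_closedBall 0 R)
    · exact ((((HalfSpaceFun.spaceOp a e).contDiff_space (T - t)).continuous.smul (hslice hw)
        ).continuousOn).integrableOn_compact (isCompact_closedBall 0 R)
  have hconst := constant_of_derivWithin_zero (fun t ht => (hI ht).differentiableWithinAt)
    (fun t ht => ?_) T (right_mem_Icc.2 hT)
  · simp only [h0, h1, smul_zero, add_zero, integral_zero, sub_self, he, waveSol_apply_zero,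
      dt_waveSol_apply_zero hn, zero_smul, zero_add] at hconst
    rw [← hconst]
    refine (setIntegral_eq_integral_of_forall_compl_eq_zero fun x hx => ?_).symm
    rw [mem_closedBall_zero_iff, not_le] at hx
    rw [hφ0 x (lt_of_le_of_lt (le_add_of_nonneg_right (by positivity)) hx), zero_smul]
  · have ht' := Ico_subset_Icc_self ht
    rw [(hI ht').derivWithin (uniqueDiffOn_Icc (ht.1.trans_lt ht.2) t ht'), hF' t ht']

/-- Uniqueness for the wave equation among functions of class `C²`, without growth conditions. -/
lemma eq_zero_of_wave {ν : ℕ} (hn : n = 2 * ν + 3) {a : ℝ} (ha : 0 < a)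
    (hw : IsSmoothFamily 2 (fun _ => w))
    (hbox : ∀ x t, 0 ≤ t → dt (dt w) x t = spaceOp a w x t) (h0 : ∀ x, w x 0 = 0)
    (h1 : ∀ x, dt w x 0 = 0) (x : Euc n) {t : ℝ} (ht : 0 ≤ t) : w x t = 0 := by
  have hc : Continuous fun y => w y t := (hw.contDiff_space (τ := 0) le_rfl ht).continuous
  have h := ae_eq_zero_of_integral_contDiff_smul_eq_zero hc.locallyIntegrable fun g hg hgc =>
    integral_pairing_eq_zero hn ha hw hbox h0 h1 ht ⟨g, hg⟩ hgc
  exact congrFun (Continuous.ae_eq_iff_eq volume hc continuous_const |>.1 h) x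

end Uniqueness

/-! ### Uniqueness for the iterated operator -/

lemma dt_spaceOp {k : WithTop ℕ∞} {u : Euc n → ℝ → 𝕜} (hu : IsSmoothFamily k (fun _ => u))
    (hk : 3 ≤ k) (a : ℝ) (x : Euc n) {t : ℝ} (ht : 0 ≤ t) :
    dt (spaceOp a u) x t = spaceOp a (dt u) x t := by
  have h1 : (2 : WithTop ℕ∞) + 1 ≤ k := two_add_one_eq_three.trans_le hk
  have h2 : (2 : WithTop ℕ∞) ≤ k := le_trans (by norm_num) hk
  have h11 : (1 : WithTop ℕ∞) + 1 ≤ 2 := one_add_one_eq_two.le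
  rw [(hu.dt h1).spaceOp_eq (τ := 0) le_rfl a le_rfl ht]
  have hd : HasDerivWithinAt (spaceOp a u x) (a ^ 2 • ∑ i, dt
      (dirDeriv (EuclideanSpace.basisFun (Fin n) ℝ i)
      (dirDeriv (EuclideanSpace.basisFun (Fin n) ℝ i) u)) x t) (Ici 0) t := by
    refine HasDerivWithinAt.congr ((HasDerivWithinAt.fun_sum fun i _ => ?_).const_smul (a ^ 2))
      (fun s hs => hu.spaceOp_eq (τ := 0) h2 a le_rfl hs x)
      (hu.spaceOp_eq (τ := 0) h2 a le_rfl ht x)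
    have := (hu.dirDeriv h1 (EuclideanSpace.basisFun (Fin n) ℝ i)).dirDeriv h11
      (EuclideanSpace.basisFun (Fin n) ℝ i)
    rw [this.dt_eq (τ := 0) one_ne_zero le_rfl ht]
    exact this.hasDerivWithinAt (τ := 0) one_ne_zero le_rfl ht x
  refine (hd.derivWithin (uniqueDiffOn_Ici 0 t ht)).trans ?_
  congr 1
  refine Finset.sum_congr rfl fun i _ => ?_
  rw [(hu.dirDeriv h1 _).dt_dirDeriv (τ := 0) le_rfl le_rfl ht]
  have e : (fun y => dt (dirDeriv (EuclideanSpace.basisFun (Fin n) ℝ i) u) y t) =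
      fun y => dirDeriv (EuclideanSpace.basisFun (Fin n) ℝ i) (dt u) y t :=
    funext fun y => hu.dt_dirDeriv (τ := 0) h2 le_rfl ht _ y
  rw [dirDeriv, e, dirDeriv]

lemma timeDeriv_spaceOp (r : ℕ) {u : Euc n → ℝ → 𝕜}
    (hu : IsSmoothFamily ((r + 2 : ℕ) : WithTop ℕ∞) (fun _ => u)) (a : ℝ) (x : Euc n) {t : ℝ}
    (ht : 0 ≤ t) :
    timeDeriv r (spaceOp a u x) t = scaledLaplacian a (fun y => timeDeriv r (u y) t) x := by
  induction r generalizing u with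
  | zero => rfl
  | succ r ih =>
    have h3 : (3 : WithTop ℕ∞) ≤ ((r + 1 + 2 : ℕ) : WithTop ℕ∞) := by
      exact_mod_cast (by omega : 3 ≤ r + 1 + 2)
    rw [timeDeriv_succ' r _ x,
      timeDeriv_congr (fun s hs => dt_spaceOp hu h3 a x hs) r ht,
      ih (hu.dt (by exact_mod_cast (by omega : r + 2 + 1 ≤ r + 1 + 2)))]
    congr 1
    exact funext fun y => congrFun (timeDeriv_succ' r u y).symm t

lemma isSmoothFamily_waveOp {l k : WithTop ℕ∞} {u : Euc n → ℝ → 𝕜}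
    (hu : IsSmoothFamily k (fun _ => u)) (hl : l + 2 ≤ k) (a : ℝ) :
    IsSmoothFamily l (fun _ => waveOp a u) := by
  have h2 : l + 1 + 1 ≤ k := by rwa [add_assoc, one_add_one_eq_two]
  exact IsSmoothFamily.congr (F := fun _ x t => dt (dt u) x t - spaceOp a u x t)
    (ContDiffOn.sub ((hu.dt h2).dt le_rfl) (hu.spaceOp hl a))
    fun _ _ x t _ => waveOp_eq a u x t

/-- Applying the wave operator to a solution lowers the order of the Cauchy problem by one. -/
lemma IsCauchySolution.waveOp {m : ℕ} {a : ℝ} {f : Euc n → ℝ → 𝕜} {φ : ℕ → Euc n → 𝕜}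
    {u : Euc n → ℝ → 𝕜} (hu : IsCauchySolution (m + 1) a f φ u) :
    IsCauchySolution m a f (fun r x => φ (r + 2) x - scaledLaplacian a (φ r) x)
      (waveOp a u) where
  contDiffOn := isSmoothFamily_const_iff.1 <|
    isSmoothFamily_waveOp (isSmoothFamily_const_iff.2 hu.contDiffOn) (by exact_mod_cast le_rfl) a
  equation x t ht := by rw [← Function.iterate_succ_apply, hu.equation x t ht]
  initial r hr x := by
    have hs := isSmoothFamily_const_iff.2 hu.contDiffOn
    have hs' : IsSmoothFamily ((r + 2 : ℕ) : WithTop ℕ∞) (fun _ => u) :=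
      ContDiffOn.of_le hs (by exact_mod_cast (by omega : r + 2 ≤ 2 * (m + 1)))
    have htime : ∀ {v : Euc n → ℝ → 𝕜}, IsSmoothFamily (r : WithTop ℕ∞) (fun _ => v) →
        ContDiffWithinAt ℝ r (v x) (Ici 0) 0 := fun {v} hv =>
      ContDiffOn.comp hv (f := fun t => ((0 : ℝ), x, t)) (by fun_prop)
        (fun _ ht => ⟨self_mem_Ici, mem_univ _, ht⟩) 0 self_mem_Ici
    rw [show MultiWave.waveOp a u x = dt (dt u) x - spaceOp a u x from
      funext fun t => waveOp_eq a u x t, timeDeriv,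
      iteratedDerivWithin_sub self_mem_Ici (uniqueDiffOn_Ici 0)
      (htime ((hs'.dt (l := (r + 1 : ℕ)) le_rfl).dt (l := r) le_rfl))
      (htime (hs'.spaceOp (l := r) le_rfl a))]
    change timeDeriv r (dt (dt u) x) 0 - timeDeriv r (spaceOp a u x) 0 = _
    rw [timeDeriv_spaceOp r hs' a x le_rfl, ← timeDeriv_succ' r (dt u) x,
      ← timeDeriv_succ' (r + 1) u x, hu.initial (r + 2) (by omega),
      show (fun y => timeDeriv r (u y) 0) = φ r from funext fun y => hu.initial r (by omega) y]

/-- By induction the images of two solutions under the wave operator agree, so their difference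
solves the wave equation with zero initial data. -/
lemma IsCauchySolution.unique {ν : ℕ} (hn : n = 2 * ν + 3) {m : ℕ} {a : ℝ} (ha : 0 < a)
    {f : Euc n → ℝ → 𝕜} {φ : ℕ → Euc n → 𝕜} {u v : Euc n → ℝ → 𝕜}
    (hu : IsCauchySolution m a f φ u) (hv : IsCauchySolution m a f φ v) (x : Euc n) {t : ℝ}
    (ht : 0 ≤ t) : u x t = v x t := by
  induction m generalizing φ u v x t with
  | zero =>
    have hc : ∀ {w : Euc n → ℝ → 𝕜}, IsCauchySolution 0 a f φ w → ContinuousOn (w x) (Ici 0) :=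
      fun hw => hw.contDiffOn.continuousOn.comp (f := fun t => (x, t)) (by fun_prop)
        fun _ ht => ⟨mem_univ _, ht⟩
    -- For `m = 0` the equation determines the solution at `t > 0`, and continuity at `t = 0`.
    have heq : EqOn (u x) (v x) (Ioi 0) := fun s hs =>
      (hu.equation x s hs).trans (hv.equation x s hs).symm
    exact heq.of_subset_closure (hc hu) (hc hv) Ioi_subset_Ici_self (closure_Ioi _).ge ht
  | succ m ih =>
    have h2 : (2 : WithTop ℕ∞) ≤ ((2 * (m + 1) : ℕ) : WithTop ℕ∞) := by
      exact_mod_cast (by omega : 2 ≤ 2 * (m + 1))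
    have hu2 : IsSmoothFamily 2 (fun _ => u) := isSmoothFamily_const_iff.2 (hu.contDiffOn.of_le h2)
    have hv2 : IsSmoothFamily 2 (fun _ => v) := isSmoothFamily_const_iff.2 (hv.contDiffOn.of_le h2)
    have h11 : (1 : WithTop ℕ∞) + 1 ≤ 2 := one_add_one_eq_two.le
    have hdt : ∀ {u v : Euc n → ℝ → 𝕜} {k : WithTop ℕ∞}, IsSmoothFamily k (fun _ => u) →
        IsSmoothFamily k (fun _ => v) → k ≠ 0 → ∀ x t, 0 ≤ t →
        dt (fun x t => u x t - v x t) x t = dt u x t - dt v x t :=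
      fun hu hv hk x t ht => derivWithin_fun_sub
        (hu.hasDerivWithinAt (τ := 0) hk le_rfl ht x).differentiableWithinAt
        (hv.hasDerivWithinAt (τ := 0) hk le_rfl ht x).differentiableWithinAt
    refine sub_eq_zero.1 (eq_zero_of_wave (w := fun x t => u x t - v x t) hn ha
      (ContDiffOn.sub hu2 hv2) (fun x t ht => ?_) (fun x => ?_) (fun x => ?_) x ht)
    · have hw := ih hu.waveOp hv.waveOp x ht
      rw [waveOp_eq a u x t, waveOp_eq a v x t] at hw
      have e1 : dt (dt (fun x t => u x t - v x t)) x t = dt (fun x t => dt u x t - dt v x t) x t :=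
        derivWithin_congr (fun s hs => hdt hu2 hv2 two_ne_zero x s hs)
          (hdt hu2 hv2 two_ne_zero x t ht)
      have e2 : spaceOp a (fun x t => u x t - v x t) x t = spaceOp a u x t - spaceOp a v x t := by
        have := ContDiffAt.laplacian_sub (hu2.contDiff_space (τ := 0) le_rfl ht).contDiffAt
          (hv2.contDiff_space (τ := 0) le_rfl ht).contDiffAt (x := x)
        simp only [spaceOp, scaledLaplacian, ← smul_sub]
        congr 1
      rw [e1, hdt (hu2.dt h11) (hv2.dt h11) one_ne_zero x t ht, e2]
      linear_combination hw
    · have := (hu.initial 0 (by omega) x).trans (hv.initial 0 (by omega) x).symm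
      simpa [timeDeriv, sub_eq_zero] using this
    · have := (hu.initial 1 (by omega) x).trans (hv.initial 1 (by omega) x).symm
      rw [hdt hu2 hv2 two_ne_zero x 0 le_rfl, sub_eq_zero]
      rw [timeDeriv_succ, timeDeriv_succ] at this
      simpa [timeDeriv] using this

/-! ### The Cauchy problem -/

/-- A smooth source, seen as a jointly smooth family of functions of `x`, indexed by the time. -/
lemma exists_smoothData_source {f : Euc n → ℝ → 𝕜}
    (hf : ContDiffOn ℝ ∞ (Function.uncurry f) (univ ×ˢ Ici 0)) :
    ∃ g : ℝ → SmoothData 𝕜 n, IsJointlySmoothData g ∧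
      ∀ τ, 0 ≤ τ → (g τ).1 = fun x => f x τ := by
  have hslice : ∀ τ, 0 ≤ τ → ContDiff ℝ ∞ fun x => f x τ := fun τ hτ =>
    (isSmoothFamily_const_iff.2 hf).contDiff_space (τ := 0) le_rfl hτ
  refine ⟨fun τ => if hτ : 0 ≤ τ then ⟨fun x => f x τ, hslice τ hτ⟩ else ⟨0, contDiff_const⟩,
    ?_, fun τ hτ => by simp [hτ]⟩
  refine ContDiffOn.congr (f := fun p : ℝ × Euc n => f p.2 p.1) ?_ fun p hp => ?_
  · exact hf.comp (f := fun p : ℝ × Euc n => (p.2, p.1)) (by fun_prop)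
      fun p hp => ⟨mem_univ _, hp.1⟩
  · have : (0 : ℝ) ≤ p.1 := hp.1
    simp [this]

end MultiWave

end

theorem theorem3p5 {𝕜 : Type*} [RCLike 𝕜] (n ν m : ℕ) (hn : n = 2 * ν + 3) (hm : 1 ≤ m)
    (a : ℝ) (ha : 0 < a)
    (f : EuclideanSpace ℝ (Fin n) → ℝ → 𝕜) (φ : ℕ → EuclideanSpace ℝ (Fin n) → 𝕜)
    (hf : ContDiffOn ℝ ∞ (Function.uncurry f) (Set.univ ×ˢ Set.Ici 0))
    (hφ : ∀ r < 2 * m, ContDiff ℝ ∞ (φ r)) :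
    ContDiffOn ℝ ∞ (Function.uncurry (MultiWave.solutionFormula ν m a f φ))
        (Set.univ ×ˢ Set.Ici 0) ∧
      MultiWave.IsCauchySolution m a f φ (MultiWave.solutionFormula ν m a f φ) ∧
      ∀ u : EuclideanSpace ℝ (Fin n) → ℝ → 𝕜, MultiWave.IsCauchySolution m a f φ u →
        ∀ x : EuclideanSpace ℝ (Fin n), ∀ t : ℝ, 0 ≤ t →
          u x t = MultiWave.solutionFormula ν m a f φ x t := by
  obtain ⟨g, hg, hfg⟩ := MultiWave.exists_smoothData_source hf
  set ψ : ℕ → MultiWave.SmoothData 𝕜 n := fun r =>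
    if hr : r < 2 * m then ⟨φ r, hφ r hr⟩ else ⟨0, contDiff_const⟩ with hψ
  have hψφ : ∀ r < 2 * m, (ψ r).1 = φ r := fun r hr => by simp [hψ, hr]
  have hformula : ∀ x t, 0 ≤ t → MultiWave.solutionFormula ν m a f φ x t =
      (MultiWave.HalfSpaceFun.cauchySol ν a m g hg ψ).1 x t := fun x t ht =>
    MultiWave.HalfSpaceFun.solutionFormula_eq ν hm ha hg hfg hψφ x ht
  have hsol : MultiWave.IsCauchySolution m a f φ (MultiWave.solutionFormula ν m a f φ) :=
    (MultiWave.HalfSpaceFun.isCauchySolution_cauchySol hn a hm hg ψ).congr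
      (fun x t ht => by rw [hfg t ht.le]) (fun r hr => (hψφ r hr).symm) hformula
  exact ⟨(MultiWave.isSmoothFamily_const_iff.1
    (MultiWave.HalfSpaceFun.cauchySol ν a m g hg ψ).smooth).congr
      fun p hp => hformula p.1 p.2 hp.2, hsol, fun u hu x t ht => hu.unique hn ha hsol x ht⟩
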